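/- **Conventions.** Hamiltonians are Hermitian matrices in the computational basis $\{|x\rangle : x\in\{0,1\}^n\}$ of $n$ qubits, and $\|\cdot\|$ is the operator norm. $H$ is *stoquastic* if its entries are real and its off-diagonal entries are $\le 0$. It is *$s$-sparse* if it has at most $s$ nonzero entries per row and per column. $X_i$ is the Pauli $X$ operator on qubit $i$. A Hamiltonian $K$ on $\mathcal H_{\rm sim}$ and an isometry $\mathcal E:\mathcal H\to\mathcal H_{\rm sim}$ *simulate* $H$ (on $\mathcal H$, $\dim\mathcal H=N$) *with error $(\eta,\epsilon)$* if there is an isometry $\tilde{\mathcal E}:\mathcal H\to\mathcal H_{\rm sim}$ whose image is spanned by eigenvectors of $K$ associated with its $N$ smallest eigenvalues (with multiplicity) such that $\|H-\tilde{\mathcal E}^\dagger K\tilde{\mathcal E}\|\le\epsilon$ and $\|\mathcal E-\tilde{\mathcal E}\|\le\eta$. An *oracle* (with $s$ slots) for $H$ answers two kinds of queries: given $x$, it returns the adjacency list of $x$, in an arbitrary order and with at most $s$ elements, in some graph $G$ (loops allowed) that contains all $(x,y)$ with $\langle x|H|y\rangle\neq0$; given $x,y$, it returns the number $\langle x|H|y\rangle$.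 Queries act reversibly, $|x\rangle|b\rangle\mapsto|x\rangle|b\oplus \mathrm{adj}(x)\rangle$ and $|x,y\rangle|r\rangle\mapsto|x,y\rangle|r\pm\langle x|H|y\rangle\rangle$, and so can be made classically or in superposition. *Gate complexity* is the number of gates (queries included) of a reversible circuit on bits and real numbers, with NOT and Toffoli gates, exact unit-cost arithmetic (adding or subtracting constants, numbers, products, inverses, or bits), sign tests, and oracle queries. **Proposition.** There are constants $n_0,s_0,M_0$, $\eta_0,\epsilon_0>0$ and $C$ and polynomials $p$ and $q$ such that the following holds for all $n\ge n_0$, $s\ge s_0$, $M\ge M_0$, $0<\eta\le\eta_0$ and $0<\epsilon\le\epsilon_0$. There exist $a>0$ and a mapping that transforms any $n$-qubit $s$-sparse stoquastic Hamiltonian $H$ satisfying $\|H\|\le M$ into a $(6n+4s)$-qubit stoquastic Hamiltonian $$K=-a\sum_{i=1}^{6n+4s}X_i+D$$ with $D$ real diagonal, such that: 1. $(K,\mathcal E)$ simulates $H$ with error $(\eta,\epsilon)$, where $\mathcal E:|x\rangle\mapsto|x,x,0^s,0^s,0^n,x,x,0^s,0^s,0^n\rangle$. 2. $\|K\|\le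 p(1/\eta,1/\epsilon,n,s,M)$. 3. There is an oracle for $K$ with $6n+4s+1$ slots, each of whose two kinds of queries is simulated exactly, with all ancillas returned to zero, by a circuit with at most $C(ns+s^2)$ queries to an oracle for $H$ and gate complexity at most $q(n,s)$. The two circuits depend only on $n,s,M,\eta,\epsilon$; they are correct for all such $H$ and for every oracle (with $s$ slots) for $H$. -/

import Mathlib

noncomputable section

namespace StoqTFD

/-! ### Qubits, operators and Hamiltonians -/

/-- Bit strings of length `n`, the labels of the computational basis of `n` qubits. -/
abbrev Bits (n : ℕ) : Type := Fin n → Bool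

/-- Operators on `n` qubits, as matrices in the computational basis. -/
abbrev Op (n : ℕ) : Type := Matrix (Bits n) (Bits n) ℂ

/-- The Hilbert space of `n` qubits. -/
abbrev Hilb (n : ℕ) : Type := EuclideanSpace ℂ (Bits n)

/-- The operator (spectral) norm. -/
def opNorm {n : ℕ} (A : Op n) : ℝ := ‖Matrix.toEuclideanCLM (n := Bits n) (𝕜 := ℂ) A‖

/-- A stoquastic Hamiltonian: Hermitian, with real entries, and with nonpositive off-diagonal
entries in the computational basis. -/
def IsStoquastic {n : ℕ} (H : Op n) : Prop :=
  H.IsHermitian ∧ (∀ x y, (H x y).im = 0) ∧ ∀ x y, x ≠ y → (H x y).re ≤ 0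

/-- At most `s` nonzero entries per row and per column. -/
def IsSparse {n : ℕ} (s : ℕ) (H : Op n) : Prop :=
  (∀ x, {y | H x y ≠ 0}.ncard ≤ s) ∧ ∀ y, {x | H x y ≠ 0}.ncard ≤ s

/-- The Pauli operator `X` acting on qubit `i`: it flips the `i`-th bit. -/
def pauliX {n : ℕ} (i : Fin n) : Op n :=
  Matrix.of fun x y => if y = Function.update x i (!(x i)) then 1 else 0

/-- The transverse field diagonal Hamiltonian `-a ∑ᵢ Xᵢ + D`, with `D` real diagonal. -/
def tfd {n : ℕ} (a : ℝ) (D : Bits n → ℝ) : Op n :=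
  -((a : ℂ) • ∑ i : Fin n, pauliX i) + Matrix.diagonal fun x => (D x : ℂ)

/-! ### Simulation of one Hamiltonian by another -/

/-- `L` is spanned by eigenvectors of the Hamiltonian `K` associated with its `N` smallest
eigenvalues (counted with multiplicity). -/
def IsLowEnergySubspace {m : ℕ} (K : Op m) (N : ℕ) (L : Submodule ℂ (Hilb m)) : Prop :=
  ∃ (b : OrthonormalBasis (Fin (Fintype.card (Bits m))) ℂ (Hilb m))
    (μ : Fin (Fintype.card (Bits m)) → ℝ),
    Monotone μ ∧
    (∀ i, Matrix.toEuclideanCLM (n := Bits m) (𝕜 := ℂ) K (b i) = (μ i : ℂ) • b i) ∧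
    L = Submodule.span ℂ (b '' {i | (i : ℕ) < N})

/-- `(K, E)` simulates the Hamiltonian `H` with error `(η, ε)`. -/
def Simulates {n m : ℕ} (K : Op m) (E : Hilb n →ₗᵢ[ℂ] Hilb m) (H : Op n) (η ε : ℝ) : Prop :=
  ∃ E' : Hilb n →ₗᵢ[ℂ] Hilb m,
    IsLowEnergySubspace K (Fintype.card (Bits n)) (LinearMap.range E'.toLinearMap) ∧
    ‖Matrix.toEuclideanCLM (n := Bits n) (𝕜 := ℂ) H -
      (ContinuousLinearMap.adjoint E'.toContinuousLinearMap).comp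
        ((Matrix.toEuclideanCLM (n := Bits m) (𝕜 := ℂ) K).comp E'.toContinuousLinearMap)‖ ≤ ε ∧
    ‖E.toContinuousLinearMap - E'.toContinuousLinearMap‖ ≤ η

/-! ### The copy encoding -/

/-- The bit string `(x, x, 0ˢ, 0ˢ, 0ⁿ)`. -/
def halfString {n : ℕ} (s : ℕ) (x : Bits n) : Bits (n + n + s + s + n) :=
  Fin.append (Fin.append (Fin.append (Fin.append x x) (fun _ : Fin s => false))
    (fun _ : Fin s => false)) (fun _ : Fin n => false)

/-- The bit string `(x, x, 0ˢ, 0ˢ, 0ⁿ, x, x, 0ˢ, 0ˢ, 0ⁿ)`. -/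
def encString {n : ℕ} (s : ℕ) (x : Bits n) : Bits (6 * n + 4 * s) :=
  fun i => Fin.append (halfString s x) (halfString s x)
    (Fin.cast (by ring : 6 * n + 4 * s = (n + n + s + s + n) + (n + n + s + s + n)) i)

theorem encString_injective {n : ℕ} (s : ℕ) :
    Function.Injective (encString s : Bits n → Bits (6 * n + 4 * s)) := by
  intro x y h
  have h1 : halfString s x = halfString s y := by
    funext j
    have := congrFun h (Fin.cast (by ring) (Fin.castAdd (n + n + s + s + n) j))
    simpa [encString] using this
  funext j
  have := congrFun h1
    (Fin.castAdd n (Fin.castAdd s (Fin.castAdd s (Fin.castAdd n j))))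
  simpa [halfString] using this

theorem encoding_orthonormal {n : ℕ} (s : ℕ) :
    Orthonormal ℂ fun x : Bits n =>
      EuclideanSpace.single (𝕜 := ℂ) (encString s x) (1 : ℂ) := by
  have h := (EuclideanSpace.basisFun (Bits (6 * n + 4 * s)) ℂ).orthonormal.comp _
    (encString_injective (n := n) s)
  have e : ((EuclideanSpace.basisFun (Bits (6 * n + 4 * s)) ℂ : _ → _) ∘ encString s) =
      fun x : Bits n => EuclideanSpace.single (𝕜 := ℂ) (encString s x) (1 : ℂ) := by
    funext x
    simp
  rwa [e] at h

/-- The isometry `|x⟩ ↦ |x, x, 0ˢ, 0ˢ, 0ⁿ, x, x, 0ˢ, 0ˢ, 0ⁿ⟩`, extended linearly. -/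
def encoding (n s : ℕ) : Hilb n →ₗᵢ[ℂ] Hilb (6 * n + 4 * s) :=
  LinearMap.isometryOfOrthonormal
    ((EuclideanSpace.basisFun (Bits n) ℂ).toBasis.constr ℂ fun x =>
      EuclideanSpace.single (𝕜 := ℂ) (encString s x) (1 : ℂ))
    (v := (EuclideanSpace.basisFun (Bits n) ℂ).toBasis)
    (by simp)
    (by
      have e : (((EuclideanSpace.basisFun (Bits n) ℂ).toBasis.constr ℂ fun x =>
            EuclideanSpace.single (𝕜 := ℂ) (encString s x) (1 : ℂ)) ∘
            (EuclideanSpace.basisFun (Bits n) ℂ).toBasis) =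
          fun x : Bits n => EuclideanSpace.single (𝕜 := ℂ) (encString s x) (1 : ℂ) := by
        funext x
        exact Module.Basis.constr_basis _ _ _ _
      rw [e]
      exact encoding_orthonormal s)

theorem encoding_single {n : ℕ} (s : ℕ) (x : Bits n) :
    encoding n s (EuclideanSpace.single x 1) = EuclideanSpace.single (encString s x) 1 := by
  have h : (EuclideanSpace.single x 1 : Hilb n) =
      (EuclideanSpace.basisFun (Bits n) ℂ).toBasis x := by simp
  rw [h]
  exact Module.Basis.constr_basis _ _ _ _

/-! ### Oracle access to a Hamiltonian -/

/-- The two functions to which oracle access to an `n`-qubit Hamiltonian gives access: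
`adj x` is an adjacency list with `s` slots, some of which may be empty, and `entry x y` is a
matrix element. -/
structure Oracle (n s : ℕ) where
  adj : Bits n → Fin s → Option (Bits n)
  entry : Bits n → Bits n → ℝ

/-- `O` is an oracle for `H`: there is a graph `G` on the bit strings (loops allowed) that contains
the interaction graph of `H`, `O.adj` lists the neighbours in `G` without repetition, in an
arbitrary order, and `O.entry` returns the matrix elements of `H`. As lists have `s` slots, the
maximum degree of `G` is at most `s`. -/
def Oracle.IsFor {n s : ℕ} (O : Oracle n s) (H : Op n) : Prop :=
  (∃ G : Bits n → Bits n → Prop,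
    (∀ x y, G x y → G y x) ∧
    (∀ x y, H x y ≠ 0 → G x y) ∧
    (∀ x y, G x y ↔ ∃ i, O.adj x i = some y) ∧
    ∀ x i j y, O.adj x i = some y → O.adj x j = some y → i = j) ∧
  ∀ x y, H x y = (O.entry x y : ℂ)

/-- The binary form of an adjacency list: every slot consists of a flag (index `none`), which tells
whether the slot is occupied, and of `n` bits (indices `some j`), which are zero if it is not. -/
def Oracle.adjBits {n s : ℕ} (O : Oracle n s) (x : Bits n) : Fin s × Option (Fin n) → Bool
  | (i, none) => (O.adj x i).isSome
  | (i, some j) => ((O.adj x i).map fun y => y j).getD false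

/-! ### Reversible circuits with oracle queries

A circuit acts on wires that carry bits (indexed by `β`) and on wires that carry real numbers
(indexed by `ρ`). Every gate is a permutation of the set of configurations, so that a circuit makes
sense classically and, by linear extension, on superpositions of configurations. Arithmetic on real
numbers is exact and has unit cost; its gates have bounded fan-in. -/

/-- The contents of all wires: a computational basis state of the circuit. -/
structure Config (β ρ : Type) where
  bit : β → Bool
  real : ρ → ℝ

/-- The gates. The parameters `n`, `s` give the format of the oracle that is queried. In the real
gates, `neg = true` subtracts where `neg = false` adds, so that every gate has an inverse gate. -/
inductive Gate (n s : ℕ) (β ρ : Type) where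
  /-- Flip the bit on wire `t`. -/
  | not (t : β)
  /-- Add the conjunction of the bits on `i` and `j` to the bit on `t`, modulo two. -/
  | toffoli (i j t : β) (hi : i ≠ t) (hj : j ≠ t)
  /-- Add the constant `c` to the number on `t`. -/
  | const (c : ℝ) (t : ρ)
  /-- Add (subtract) the number on `i` to (from) the number on `t`. -/
  | add (neg : Bool) (i t : ρ) (hi : i ≠ t)
  /-- Add (subtract) the product of the numbers on `i` and `j`. -/
  | mul (neg : Bool) (i j t : ρ) (hi : i ≠ t) (hj : j ≠ t)
  /-- Add (subtract) the inverse of the number on `i`, and nothing if that number is zero. -/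
  | inv (neg : Bool) (i t : ρ) (hi : i ≠ t)
  /-- Add (subtract) the number one if the bit on `i` is set. -/
  | ofBit (neg : Bool) (i : β) (t : ρ)
  /-- Flip the bit on `t` if the number on `i` is positive. -/
  | pos (i : ρ) (t : β)
  /-- Query the adjacency list of the string on the wires `x` and add it, bit by bit and modulo
  two, to the wires `ans`. -/
  | queryAdj (x : Fin n → β) (ans : Fin s × Option (Fin n) ↪ β) (hx : ∀ j p, x j ≠ ans p)
  /-- Query the matrix element at the strings on the wires `x` and `y` and add (subtract) it to
  (from) the number on `t`. -/
  | queryEntry (neg : Bool) (x y : Fin n → β) (t : ρ)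

/-- Flip bit `t` if `v` holds. -/
def Config.xorBit {β ρ : Type} [DecidableEq β] (c : Config β ρ) (t : β) (v : Bool) : Config β ρ :=
  { c with bit := Function.update c.bit t (xor (c.bit t) v) }

/-- Add `v` to (or subtract it from) the number on `t`. -/
def Config.addReal {β ρ : Type} [DecidableEq ρ] (c : Config β ρ) (neg : Bool) (t : ρ) (v : ℝ) :
    Config β ρ :=
  { c with real := Function.update c.real t (c.real t + if neg then -v else v) }

open Classical in
/-- The action of a gate on a configuration, for queries to the oracle `O`. -/
def Gate.step {n s : ℕ} {β ρ : Type} [DecidableEq β] [DecidableEq ρ] (O : Oracle n s)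
    (c : Config β ρ) : Gate n s β ρ → Config β ρ
  | .not t => c.xorBit t true
  | .toffoli i j t _ _ => c.xorBit t (c.bit i && c.bit j)
  | .const r t => c.addReal false t r
  | .add neg i t _ => c.addReal neg t (c.real i)
  | .mul neg i j t _ _ => c.addReal neg t (c.real i * c.real j)
  | .inv neg i t _ => c.addReal neg t (c.real i)⁻¹
  | .ofBit neg i t => c.addReal neg t (if c.bit i then 1 else 0)
  | .pos i t => c.xorBit t (decide (0 < c.real i))
  | .queryAdj x ans _ =>
      ⟨fun w => xor (c.bit w)
        (Function.extend ans (O.adjBits fun j => c.bit (x j)) (fun _ => false) w), c.real⟩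
  | .queryEntry neg x y t =>
      c.addReal neg t (O.entry (fun j => c.bit (x j)) (fun j => c.bit (y j)))

/-- Whether a gate is a query, of either kind. -/
def Gate.isQuery {n s : ℕ} {β ρ : Type} : Gate n s β ρ → Bool
  | .queryAdj _ _ _ => true
  | .queryEntry _ _ _ _ => true
  | _ => false

/-- A circuit is a list of gates; its gate complexity is its length. -/
abbrev Circuit (n s : ℕ) (β ρ : Type) : Type := List (Gate n s β ρ)

/-- The action of a circuit, first gate first. -/
def Circuit.run {n s : ℕ} {β ρ : Type} [DecidableEq β] [DecidableEq ρ] (O : Oracle n s)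
    (P : Circuit n s β ρ) (c : Config β ρ) : Config β ρ :=
  P.foldl (fun c g => g.step O c) c

/-- The number of queries. -/
def Circuit.queries {n s : ℕ} {β ρ : Type} (P : Circuit n s β ρ) : ℕ := P.countP Gate.isQuery

/-- Adjoin ancilla wires, all of which carry zero. -/
def Config.withAncillas {β ρ : Type} (c : Config β ρ) : Config (β ⊕ ℕ) (ρ ⊕ ℕ) where
  bit := Sum.elim c.bit fun _ => false
  real := Sum.elim c.real fun _ => 0

/-- With queries to `O`, the circuit `P` acts on every configuration as the gate `g` does with the
oracle `O'`, and it returns all ancilla wires to zero. -/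
def Circuit.Implements {n s N S : ℕ} {β ρ : Type} [DecidableEq β] [DecidableEq ρ]
    (P : Circuit n s (β ⊕ ℕ) (ρ ⊕ ℕ)) (O : Oracle n s) (g : Gate N S β ρ) (O' : Oracle N S) :
    Prop :=
  ∀ c : Config β ρ, P.run O c.withAncillas = (g.step O' c).withAncillas

/-- The bit wires of an adjacency query: the query register and the answer register. -/
abbrev AdjReg (N S : ℕ) : Type := Fin N ⊕ (Fin S × Option (Fin N))

/-- The bit wires of a matrix element query: a row and a column. -/
abbrev EntryReg (N : ℕ) : Type := Fin N ⊕ Fin N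

/-- A single adjacency query. -/
def adjGate (N S : ℕ) : Gate N S (AdjReg N S) Empty :=
  .queryAdj Sum.inl ⟨Sum.inr, Sum.inr_injective⟩ (by simp)

/-- A single matrix element query. -/
def entryGate (N S : ℕ) : Gate N S (EntryReg N) Unit :=
  .queryEntry false Sum.inl Sum.inr ()

end StoqTFD

end

set_option linter.unusedSectionVars false

/-! ### Isometries near a map: polar decomposition -/

noncomputable section
namespace StoqTFD

/-! The transverse field makes a particle hop on the hypercube, and D confines it to a sparse graph.
The vertices of this graph are the codewords `encString s x` and, for every ordered pair (x, y)
whose matrix element g has -g above a small cutoff, the L = 4n + 7 interior vertices of a path from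
the codeword of x to that of y. Off this graph D is a large penalty Δ.

In the interior of a path D equals 2a, so K acts there as a times the negative discrete Laplacian
and annihilates affine profiles. The two end energies a(1 + b) and a(1 + d), with d = `slope`, are
tuned so that a unit amplitude on either codeword extends along the path to an affine profile,
annihilated by K, whose value at the far end is ω = -g/(2a). Acting on these far ends, the field
gives -aω from each of the two paths (x, y) and (y, x), which is g in total. The amplitude returned
from the near ends is cancelled by `codeEnergy`. So the encoding dressed with the profiles satisfies
K W = E H exactly, apart from the neglected matrix elements and a leak off the graph of order a/Δ
(`path_equation`, `code_equation`, `simReal_mul_dressed`).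

All amplitudes are at most 3/b, so W is close to E when b is large. On the orthogonal complement of
the codewords the quadratic form of K is at least a/(2L²): a concave parabola along each path is a
positive strict supersolution (`gap_of_supersolution`, `simulator_gap`). As a = MLb², this gap is
large compared with M. A dimension count then puts all but the lowest 2ⁿ eigenvalues above the gap,
the vectors W u have small K W u and so lie near the low-energy space, and projecting W and
orthonormalizing gives the required isometry (`simulates_of_approx`).

All this needs the codewords and paths to be an induced subgraph of the hypercube: no further
adjacencies. The registers are redundant for this purpose. Each half stores its string twice, and
each flag occurs in both halves, so that two vertices which differ in at most one bit must agree on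
the data and labels that identify the edge (`label_eq_of_close`, `not_close_state`,
`eq_of_close_base`). One half is rewritten while the other is intact; tally bits are flipped where x
and y agree, so all paths have equal length.

The labels of an edge are the rank of y among the neighbours of x and conversely, in numerical
order. Thus D depends on H alone and not on the order in which an oracle lists neighbours. Every
path vertex shows one end of its edge in one of its halves, so D is computed from the adjacency
lists of two strings and of their neighbours, with O(s²) queries; the result is added to the output
and the computation undone (`energy_eq`, `Derives.exists_circuit`). The adjacency lists of K can be
taken to be those of the cube with loops and need no queries. -/

theorem abs_inv_sqrt_sub_one_le {x : ℝ} (hx : |x - 1| ≤ 1 / 2) :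
    |(Real.sqrt x)⁻¹ - 1| ≤ |x - 1| := by
  rw [abs_le] at hx
  have hx0 : 0 < x := by linarith
  set y := Real.sqrt x with hy
  have hy0 : 0 < y := Real.sqrt_pos.mpr hx0
  have hyy : y * y = x := Real.mul_self_sqrt hx0.le
  have h1 : y⁻¹ - 1 = (1 - x) / (y * (1 + y)) := by
    rw [← hyy]; field_simp; ring
  rw [h1, abs_div, abs_sub_comm 1 x, abs_of_pos (by positivity : 0 < y * (1 + y))]
  apply div_le_self (abs_nonneg _)
  have : 1 / 2 ≤ y := by
    rw [hy]; apply Real.le_sqrt_of_sq_le; linarith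
  nlinarith

section Polar

variable {F : Type*} [NormedAddCommGroup F] [InnerProductSpace ℂ F] [CompleteSpace F]

/-- S is the inverse square root in the functional calculus. The spectrum of A lies within c of 1,
where the scalar bound `abs_inv_sqrt_sub_one_le` applies. -/
theorem exists_inv_sqrt_near_one {A : F →L[ℂ] F} (hA : IsSelfAdjoint A) {c : ℝ}
    (hc : ‖A - 1‖ ≤ c) (hc2 : c ≤ 1 / 2) :
    ∃ S : F →L[ℂ] F, IsSelfAdjoint S ∧ S * A * S = 1 ∧ ‖S - 1‖ ≤ c := by
  have hsub : cfc (fun x : ℝ => x - 1) A = A - 1 := by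
    rw [cfc_sub .., cfc_id' ℝ A, cfc_const_one ℝ A]
  have hspec : ∀ x ∈ spectrum ℝ A, |x - 1| ≤ c := by
    intro x hx
    have := norm_apply_le_norm_cfc (fun x : ℝ => x - 1) A hx
    rw [hsub] at this
    exact this.trans hc
  have hpos : ∀ x ∈ spectrum ℝ A, 0 < x := by
    intro x hx
    have := (abs_le.mp (hspec x hx)).1
    linarith
  have hcont : ContinuousOn (fun x : ℝ => (Real.sqrt x)⁻¹) (spectrum ℝ A) := by
    apply ContinuousOn.inv₀ Real.continuous_sqrt.continuousOn
    intro x hx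
    exact (Real.sqrt_pos.mpr (hpos x hx)).ne'
  set f : ℝ → ℝ := fun x => (Real.sqrt x)⁻¹ with hf
  refine ⟨cfc f A, cfc_predicate f A, ?_, ?_⟩
  · have h1 : cfc f A * A = cfc (fun x => f x * x) A := by
      rw [cfc_mul f (fun x => x) A hcont continuousOn_id, cfc_id' ℝ A hA]
    rw [h1, ← cfc_mul (fun x => f x * x) f A (hcont.mul continuousOn_id) hcont,
      ← cfc_const_one ℝ A hA]
    apply cfc_congr
    intro x hx
    have h0 := hpos x hx
    have hs := Real.mul_self_sqrt h0.le
    have h2 : Real.sqrt x ≠ 0 := (Real.sqrt_pos.mpr h0).ne'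
    simp only [hf]
    field_simp
    nlinarith
  · have h1 : cfc (fun x : ℝ => f x - 1) A = cfc f A - 1 := by
      rw [cfc_sub f (fun _ => 1) A hcont continuousOn_const, cfc_const_one ℝ A hA]
    rw [← h1]
    apply norm_cfc_le ((norm_nonneg _).trans hc)
    intro x hx
    have h := hspec x hx
    exact (abs_inv_sqrt_sub_one_le (h.trans hc2)).trans h

variable {G : Type*} [NormedAddCommGroup G] [InnerProductSpace ℂ G] [CompleteSpace G]

open ContinuousLinearMap

theorem isometry_adjoint_comp_self (E : F →ₗᵢ[ℂ] G) :
    (adjoint E.toContinuousLinearMap).comp E.toContinuousLinearMap = 1 := by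
  ext1 x
  refine ext_inner_left ℂ fun y => ?_
  simp

theorem norm_isometry_le (E : F →ₗᵢ[ℂ] G) : ‖E.toContinuousLinearMap‖ ≤ 1 :=
  opNorm_le_bound _ zero_le_one fun x => by simp

theorem norm_adjoint_isometry_le (E : F →ₗᵢ[ℂ] G) : ‖adjoint E.toContinuousLinearMap‖ ≤ 1 := by
  rw [LinearIsometryEquiv.norm_map]; exact norm_isometry_le E

/-- Polar decomposition: E' is V times the inverse square root S of V†V. Because E' factors through
V, it stays in any subspace that contains the range of V; the factor S is kept in the statement to
carry energies from V to E'. -/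
theorem exists_isometry_near {V : F →L[ℂ] G} {E : F →ₗᵢ[ℂ] G} {δ : ℝ}
    (hV : ‖V - E.toContinuousLinearMap‖ ≤ δ) (hδ : δ ≤ 1 / 16) :
    ∃ (S : F →L[ℂ] F) (E' : F →ₗᵢ[ℂ] G), ‖S - 1‖ ≤ 3 * δ ∧
      E'.toContinuousLinearMap = V.comp S ∧
      ‖E.toContinuousLinearMap - E'.toContinuousLinearMap‖ ≤ 5 * δ := by
  have hδ0 : 0 ≤ δ := (norm_nonneg _).trans hV
  set E₁ := E.toContinuousLinearMap with hE₁
  have hVn : ‖V‖ ≤ 1 + δ := by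
    calc ‖V‖ = ‖E₁ + (V - E₁)‖ := by congr 1; abel
      _ ≤ 1 + δ := (norm_add_le _ _).trans (add_le_add (norm_isometry_le E) hV)
  set A : F →L[ℂ] F := (adjoint V).comp V with hA
  have hAsa : IsSelfAdjoint A := by
    rw [isSelfAdjoint_iff', hA, adjoint_comp, adjoint_adjoint]
  have hA1 : ‖A - 1‖ ≤ 3 * δ := by
    have : A - 1 = (adjoint V).comp (V - E₁) + (adjoint (V - E₁)).comp E₁ := by
      rw [← isometry_adjoint_comp_self E, hA]
      simp only [map_sub, comp_sub, sub_comp]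
      abel
    rw [this]
    have h1 : ‖(adjoint V).comp (V - E₁)‖ ≤ (1 + δ) * δ := by
      refine (opNorm_comp_le _ _).trans ?_
      rw [LinearIsometryEquiv.norm_map]
      gcongr
    have h2 : ‖(adjoint (V - E₁)).comp E₁‖ ≤ δ * 1 := by
      refine (opNorm_comp_le _ _).trans ?_
      rw [LinearIsometryEquiv.norm_map]
      gcongr
      exact norm_isometry_le E
    refine (norm_add_le _ _).trans ((add_le_add h1 h2).trans ?_)
    nlinarith
  obtain ⟨S, hS, hSA, hS1⟩ := exists_inv_sqrt_near_one hAsa hA1 (by linarith)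
  have hiso : ∀ x, ‖V (S x)‖ = ‖x‖ := by
    intro x
    have h : inner ℂ (V (S x)) (V (S x)) = inner ℂ x x := by
      have h2 : inner ℂ (V (S x)) (V (S x)) = inner ℂ (S x) (A (S x)) := by
        simp [hA, adjoint_inner_right]
      have h3 : inner ℂ (S x) (A (S x)) = inner ℂ x (S (A (S x))) := by
        rw [← adjoint_inner_right S, isSelfAdjoint_iff'.mp hS]
      have h4 : S (A (S x)) = x := by
        have := congrArg (fun T : F →L[ℂ] F => T x) hSA
        simpa using this
      rw [h2, h3, h4]
    rw [norm_eq_sqrt_re_inner (𝕜 := ℂ), norm_eq_sqrt_re_inner (𝕜 := ℂ) x, h]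
  refine ⟨S, ⟨(V.comp S).toLinearMap, fun x => by simpa using hiso x⟩, hS1, ?_, ?_⟩
  · ext x; rfl
  · have h1 : E₁ - V.comp S = -(V.comp (S - 1) + (V - E₁)) := by
      rw [comp_sub]
      have : V.comp (1 : F →L[ℂ] F) = V := by ext x; rfl
      rw [this]; abel
    have h2 : ‖E₁ - V.comp S‖ ≤ 5 * δ := by
      rw [h1, norm_neg]
      have h3 : ‖V.comp (S - 1)‖ ≤ (1 + δ) * (3 * δ) :=
        (opNorm_comp_le _ _).trans (by gcongr)
      refine (norm_add_le _ _).trans ((add_le_add h3 hV).trans ?_)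
      nlinarith
    exact h2

end Polar

end StoqTFD
end

/-! ### Low-energy subspaces and the simulation criterion -/

noncomputable section
namespace StoqTFD
open ContinuousLinearMap

section LowEnergy

variable {G : Type*} [NormedAddCommGroup G] [InnerProductSpace ℂ G]
variable {d : ℕ} (b : OrthonormalBasis (Fin d) ℂ G)

/-- The orthogonal projection on the span of the first `N` vectors of an orthonormal basis. -/
def initialProj (N : ℕ) : G →L[ℂ] G :=
  ∑ j : Fin d, if (j : ℕ) < N then (innerSL ℂ (b j)).smulRight (b j) else 0

theorem inner_initialProj (N : ℕ) (i : Fin d) (ψ : G) :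
    inner ℂ (b i) (initialProj b N ψ) = if (i : ℕ) < N then inner ℂ (b i) ψ else 0 := by
  have h : initialProj b N ψ = ∑ j : Fin d, (if (j : ℕ) < N then inner ℂ (b j) ψ else 0) • b j := by
    unfold initialProj
    rw [sum_apply]
    refine Finset.sum_congr rfl fun j _ => ?_
    split_ifs <;> simp
  rw [h, inner_sum]
  simp only [inner_smul_right, b.inner_eq_ite, mul_ite, mul_one, mul_zero]
  simp

theorem ext_inner_basis {ψ φ : G} (h : ∀ i, inner ℂ (b i) ψ = inner ℂ (b i) φ) : ψ = φ := by
  rw [← b.sum_repr' ψ, ← b.sum_repr' φ]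
  simp [h]

theorem initialProj_mem_span (N : ℕ) (ψ : G) :
    initialProj b N ψ ∈ Submodule.span ℂ (b '' {i | (i : ℕ) < N}) := by
  unfold initialProj
  rw [sum_apply]
  refine Submodule.sum_mem _ fun j _ => ?_
  split_ifs with hj
  · exact Submodule.smul_mem _ _ (Submodule.subset_span ⟨j, hj, rfl⟩)
  · simp

theorem initialProj_idem (N : ℕ) (ψ : G) :
    initialProj b N (initialProj b N ψ) = initialProj b N ψ := by
  apply ext_inner_basis b
  intro i
  simp only [inner_initialProj]
  split_ifs <;> rfl

theorem inner_eq_sum (φ ψ : G) :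
    inner ℂ φ ψ = ∑ i, inner ℂ φ (b i) * inner ℂ (b i) ψ :=
  (b.sum_inner_mul_inner φ ψ).symm

theorem inner_initialProj_left (N : ℕ) (φ ψ : G) :
    inner ℂ (initialProj b N φ) ψ = inner ℂ φ (initialProj b N ψ) := by
  rw [inner_eq_sum b, inner_eq_sum b φ]
  refine Finset.sum_congr rfl fun i _ => ?_
  rw [← inner_conj_symm, inner_initialProj, inner_initialProj]
  split_ifs <;> simp

variable {b} {T : G →L[ℂ] G} {μ : Fin d → ℝ}

theorem inner_eigen (hT : (T : G →ₗ[ℂ] G).IsSymmetric) (hb : ∀ i, T (b i) = (μ i : ℂ) • b i)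
    (i : Fin d) (ψ : G) : inner ℂ (b i) (T ψ) = μ i * inner ℂ (b i) ψ := by
  have := hT (b i) ψ
  simp only [coe_coe] at this
  rw [← this, hb, inner_smul_left]
  simp

theorem initialProj_comm (hT : (T : G →ₗ[ℂ] G).IsSymmetric) (hb : ∀ i, T (b i) = (μ i : ℂ) • b i)
    (N : ℕ) (ψ : G) : T (initialProj b N ψ) = initialProj b N (T ψ) := by
  apply ext_inner_basis b
  intro i
  rw [inner_eigen hT hb, inner_initialProj, inner_initialProj, inner_eigen hT hb]
  split_ifs <;> simp

variable {F : Type*} [NormedAddCommGroup F] [InnerProductSpace ℂ F] [FiniteDimensional ℂ F]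

variable [FiniteDimensional ℂ G]

/-- Courant–Fischer: the span of the first dim F + 1 eigenvectors contains a nonzero vector
orthogonal to the range of E. Its energy is at least Γ times its squared norm by `hgap`, and at most
μ i times it by monotonicity. -/
theorem gap_le_eigenvalue (hT : (T : G →ₗ[ℂ] G).IsSymmetric)
    (hb : ∀ i, T (b i) = (μ i : ℂ) • b i) (hμ : Monotone μ)
    (E : F →ₗᵢ[ℂ] G) {Γ : ℝ}
    (hgap : ∀ ψ : G, (∀ u, inner ℂ (E u) ψ = 0) → Γ * ‖ψ‖ ^ 2 ≤ (inner ℂ ψ (T ψ) : ℂ).re)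
    (i : Fin d) (hi : Module.finrank ℂ F ≤ i) : Γ ≤ μ i := by
  set N := Module.finrank ℂ F with hN
  have hle : N + 1 ≤ d := by omega
  let f : (Fin (N + 1) → ℂ) →ₗ[ℂ] G :=
    Fintype.linearCombination ℂ fun j => b (Fin.castLE hle j)
  let g : (Fin (N + 1) → ℂ) →ₗ[ℂ] F := (adjoint E.toContinuousLinearMap).toLinearMap ∘ₗ f
  have hker : LinearMap.ker g ≠ ⊥ := by
    apply LinearMap.ker_ne_bot_of_finrank_lt
    simp [← hN]
  obtain ⟨c, hc, hc0⟩ := Submodule.exists_mem_ne_zero_of_ne_bot hker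
  have hort : ∀ u, inner ℂ (E u) (f c) = 0 := by
    intro u
    have h1 : adjoint E.toContinuousLinearMap (f c) = 0 := hc
    have h2 := adjoint_inner_right E.toContinuousLinearMap u (f c)
    rw [h1, inner_zero_right] at h2
    exact h2.symm
  have hcoef : ∀ k : Fin d, i < k → inner ℂ (b k) (f c) = 0 := by
    intro k hk
    simp only [f, Fintype.linearCombination_apply, inner_sum, inner_smul_right, b.inner_eq_ite]
    refine Finset.sum_eq_zero fun j _ => ?_
    rw [if_neg, mul_zero]
    intro h
    have h1 := congrArg Fin.val h
    have h2 : (i : ℕ) < k := hk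
    simp only [Fin.val_castLE] at h1
    omega
  have hf0 : f c ≠ 0 := by
    intro h
    apply hc0
    have hli : LinearIndependent ℂ fun j => b (Fin.castLE hle j) :=
      b.orthonormal.linearIndependent.comp _ (Fin.castLE_injective hle)
    rw [Fintype.linearIndependent_iff] at hli
    funext j
    exact hli c (by simpa [f, Fintype.linearCombination_apply] using h) j
  have hpos : 0 < ‖f c‖ ^ 2 := by positivity
  have hupper : (inner ℂ (f c) (T (f c)) : ℂ).re ≤ μ i * ‖f c‖ ^ 2 := by
    rw [inner_eq_sum b, ← b.sum_sq_norm_inner_right (f c), Finset.mul_sum, Complex.re_sum]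
    refine Finset.sum_le_sum fun k _ => ?_
    rw [inner_eigen hT hb]
    have h1 : inner ℂ (f c) (b k) * ((μ k : ℂ) * inner ℂ (b k) (f c))
        = ((μ k * ‖(inner ℂ (b k) (f c) : ℂ)‖ ^ 2 : ℝ) : ℂ) := by
      rw [← inner_conj_symm (f c) (b k)]
      push_cast
      rw [← Complex.conj_mul']
      ring
    rw [h1, Complex.ofReal_re]
    by_cases hk : i < k
    · rw [hcoef k hk]; simp
    · have := hμ (not_lt.mp hk)
      gcongr
  have := (hgap (f c) hort).trans hupper
  exact le_of_mul_le_mul_right this hpos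

/-- Components beyond the first N eigenvectors are stretched by at least Γ under T, so a vector with
small image lies near the low-energy space. -/
theorem norm_sub_initialProj_le (hT : (T : G →ₗ[ℂ] G).IsSymmetric)
    (hb : ∀ i, T (b i) = (μ i : ℂ) • b i) {N : ℕ} {Γ : ℝ} (hΓ : 0 < Γ)
    (hgap : ∀ i : Fin d, N ≤ i → Γ ≤ μ i) (ψ : G) :
    ‖ψ - initialProj b N ψ‖ ≤ ‖T ψ‖ / Γ := by
  rw [le_div_iff₀ hΓ]
  apply le_of_sq_le_sq _ (norm_nonneg _)
  rw [mul_pow, ← b.sum_sq_norm_inner_right (T ψ), ← b.sum_sq_norm_inner_right (ψ - _),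
    Finset.sum_mul]
  refine Finset.sum_le_sum fun i _ => ?_
  rw [inner_sub_right, inner_initialProj, inner_eigen hT hb]
  split_ifs with hi
  · simp; positivity
  · rw [sub_zero, norm_mul, mul_pow, mul_comm]
    have h1 := hgap i (not_lt.mp hi)
    gcongr
    rw [Complex.norm_real]
    exact h1.trans (le_abs_self _)

end LowEnergy

/-- It suffices to have an approximate solution W of K W = E H near E, and a lower bound on K off
the range of E. The exact low-energy space is reached by projecting W on it and orthonormalizing;
the projection moves W by at most (M + t)/Γ. -/
theorem simulates_of_approx {n m : ℕ} {K : Op m} (hK : K.IsHermitian)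
    {E : Hilb n →ₗᵢ[ℂ] Hilb m} {H : Op n} {W : Hilb n →L[ℂ] Hilb m} {M r t Γ δ η ε : ℝ}
    (hM : opNorm H ≤ M) (hr : ‖W - E.toContinuousLinearMap‖ ≤ r)
    (ht : ‖(Matrix.toEuclideanCLM (n := Bits m) (𝕜 := ℂ) K).comp W -
      E.toContinuousLinearMap.comp (Matrix.toEuclideanCLM (n := Bits n) (𝕜 := ℂ) H)‖ ≤ t)
    (hΓ : 0 < Γ)
    (hgap : ∀ ψ : Hilb m, (∀ u, inner ℂ (E u) ψ = 0) → Γ * ‖ψ‖ ^ 2 ≤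
      (inner ℂ ψ (Matrix.toEuclideanCLM (n := Bits m) (𝕜 := ℂ) K ψ) : ℂ).re)
    (hδ : (M + t) / Γ + r ≤ δ) (hδ16 : δ ≤ 1 / 16) (hη : 5 * δ ≤ η)
    (hε : 13 * δ * M + 2 * t ≤ ε) : Simulates K E H η ε := by
  set T := Matrix.toEuclideanCLM (n := Bits m) (𝕜 := ℂ) K with hTdef
  set H₁ := Matrix.toEuclideanCLM (n := Bits n) (𝕜 := ℂ) H with hH₁
  set E₁ := E.toContinuousLinearMap with hE₁
  have hT : (T : Hilb m →ₗ[ℂ] Hilb m).IsSymmetric := by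
    have := Matrix.isSymmetric_toEuclideanLin_iff.mpr hK
    exact this
  have hrank : Module.finrank ℂ (Hilb m) = Fintype.card (Bits m) := finrank_euclideanSpace
  have hrankn : Module.finrank ℂ (Hilb n) = Fintype.card (Bits n) := finrank_euclideanSpace
  -- The eigenvalues come in decreasing order, hence the reversal of indices.
  let b : OrthonormalBasis (Fin (Fintype.card (Bits m))) ℂ (Hilb m) :=
    (hT.eigenvectorBasis hrank).reindex Fin.revPerm
  let μ : Fin (Fintype.card (Bits m)) → ℝ := fun i => hT.eigenvalues hrank (Fin.rev i)
  have hμ : Monotone μ := fun i j hij =>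
    hT.eigenvalues_antitone hrank (Fin.rev_le_rev.mpr hij)
  have hb : ∀ i, T (b i) = (μ i : ℂ) • b i := by
    intro i
    have := hT.apply_eigenvectorBasis hrank (Fin.rev i)
    simp only [b, μ, OrthonormalBasis.reindex_apply]
    exact this
  set N := Fintype.card (Bits n) with hN
  have hgap' : ∀ i : Fin (Fintype.card (Bits m)), N ≤ i → Γ ≤ μ i := fun i hi =>
    gap_le_eigenvalue hT hb hμ E hgap i (by rw [hrankn]; exact hi)
  set Q := initialProj b N with hQ
  have hM0 : 0 ≤ M := (norm_nonneg _).trans hM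
  have ht0 : 0 ≤ t := (norm_nonneg _).trans ht
  have hTW : ‖T.comp W‖ ≤ M + t := by
    have h1 : T.comp W = E₁.comp H₁ + (T.comp W - E₁.comp H₁) := by abel
    rw [h1]
    refine (norm_add_le _ _).trans (add_le_add ?_ ht)
    refine (opNorm_comp_le _ _).trans ?_
    calc ‖E₁‖ * ‖H₁‖ ≤ 1 * M := by
          gcongr
          · exact norm_isometry_le E
          · exact hM
      _ = M := one_mul M
  have hVW : ‖Q.comp W - W‖ ≤ (M + t) / Γ := by
    apply opNorm_le_bound _ (by positivity)
    intro u
    rw [← norm_neg]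
    have h1 := norm_sub_initialProj_le hT hb hΓ hgap' (W u)
    have h2 : ‖T (W u)‖ ≤ (M + t) * ‖u‖ := ((T.comp W).le_opNorm u).trans (by gcongr)
    calc ‖-((Q.comp W - W) u)‖ = ‖W u - Q (W u)‖ := by simp
      _ ≤ ‖T (W u)‖ / Γ := h1
      _ ≤ (M + t) * ‖u‖ / Γ := by gcongr
      _ = (M + t) / Γ * ‖u‖ := by ring
  have hV : ‖Q.comp W - E₁‖ ≤ δ := by
    have h1 : Q.comp W - E₁ = (Q.comp W - W) + (W - E₁) := by abel
    rw [h1]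
    exact (norm_add_le _ _).trans ((add_le_add hVW hr).trans hδ)
  obtain ⟨S, E', hS, hE', hEE'⟩ := exists_isometry_near hV hδ16
  have hδ0 : 0 ≤ δ := (norm_nonneg _).trans hV
  have hSn : ‖S‖ ≤ 2 := by
    have h1 : S = 1 + (S - 1) := by abel
    rw [h1]
    have h2 : ‖(1 : Hilb n →L[ℂ] Hilb n)‖ ≤ 1 := norm_id_le
    exact (norm_add_le _ _).trans (by linarith)
  have hE'Q : ∀ u, Q (E' u) = E' u := by
    intro u
    have h1 : E' u = Q (W (S u)) := congrArg (fun A : Hilb n →L[ℂ] Hilb m => A u) hE'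
    rw [h1]
    exact initialProj_idem b N _
  refine ⟨E', ⟨b, μ, hμ, hb, ?_⟩, ?_, hEE'.trans hη⟩
  · apply Submodule.eq_of_le_of_finrank_le
    · rintro _ ⟨u, rfl⟩
      have := initialProj_mem_span b N (E' u)
      rw [← hQ, hE'Q] at this
      exact this
    · rw [LinearMap.finrank_range_of_inj E'.injective, hrankn]
      refine (finrank_span_le_card _).trans ?_
      rw [Set.toFinset_card, ← Nat.card_eq_fintype_card, Nat.card_coe_set_eq]
      refine (Set.ncard_image_le (Set.toFinite _)).trans ?_
      rw [← Set.ncard_image_of_injective _ Fin.val_injective]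
      have h1 : (Fin.val '' {i : Fin (Fintype.card (Bits m)) | (i : ℕ) < N}) ⊆
          ((Finset.range N : Finset ℕ) : Set ℕ) := by
        rintro _ ⟨i, hi, rfl⟩
        simpa using hi
      refine (Set.ncard_le_ncard h1 (Finset.finite_toSet _)).trans ?_
      rw [Set.ncard_coe_finset, Finset.card_range]
  · set E₂ := E'.toContinuousLinearMap with hE₂
    -- The spectral projection commutes with T and fixes the range of E', so it can be dropped
    -- between E'† and W. This brings in T W, which is known approximately.
    have hcomp : (adjoint E₂).comp (T.comp E₂) = (adjoint E₂).comp ((T.comp W).comp S) := by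
      ext1 u
      refine ext_inner_left ℂ fun y => ?_
      simp only [coe_comp, Function.comp_apply, adjoint_inner_right]
      have h1 : E₂ u = Q (W (S u)) := congrArg (fun A : Hilb n →L[ℂ] Hilb m => A u) hE'
      have h2 : Q (E₂ y) = E₂ y := hE'Q y
      rw [h1, initialProj_comm hT hb, ← inner_initialProj_left, ← hQ, h2]
    -- Three errors: T W in place of E H costs 2t, E in place of E' costs 10δM, and S in place of 1
    -- costs 3δM.
    have hdecomp : H₁ - (adjoint E₂).comp (T.comp E₂) =
        -((adjoint E₂).comp ((T.comp W - E₁.comp H₁).comp S)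
          + ((adjoint E₂).comp (E₁ - E₂)).comp (H₁.comp S) + H₁.comp (S - 1)) := by
      rw [hcomp]
      ext1 u
      have h1 : (adjoint E₂) (E₂ (H₁ (S u))) = H₁ (S u) :=
        congrArg (fun A : Hilb n →L[ℂ] Hilb n => A (H₁ (S u))) (isometry_adjoint_comp_self E')
      simp [h1]
    have hA : ‖adjoint E₂‖ ≤ 1 := norm_adjoint_isometry_le E'
    rw [hdecomp, norm_neg]
    have hH : ‖H₁‖ ≤ M := hM
    have n1 : ‖(adjoint E₂).comp ((T.comp W - E₁.comp H₁).comp S)‖ ≤ 1 * (t * 2) :=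
      (opNorm_comp_le _ _).trans (mul_le_mul hA ((opNorm_comp_le _ _).trans
        (mul_le_mul ht hSn (norm_nonneg _) ht0)) (norm_nonneg _) zero_le_one)
    have n2 : ‖((adjoint E₂).comp (E₁ - E₂)).comp (H₁.comp S)‖ ≤ (1 * (5 * δ)) * (M * 2) :=
      (opNorm_comp_le _ _).trans (mul_le_mul ((opNorm_comp_le _ _).trans
        (mul_le_mul hA hEE' (norm_nonneg _) zero_le_one)) ((opNorm_comp_le _ _).trans
        (mul_le_mul hH hSn (norm_nonneg _) hM0)) (norm_nonneg _) (by positivity))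
    have n3 : ‖H₁.comp (S - 1)‖ ≤ M * (3 * δ) :=
      (opNorm_comp_le _ _).trans (mul_le_mul hH hS (norm_nonneg _) hM0)
    refine (norm_add_le _ _).trans ((add_le_add ((norm_add_le _ _).trans
      (add_le_add n1 n2)) n3).trans ?_)
    linarith

end StoqTFD
end

/-! ### Norms and quadratic forms of matrices -/

noncomputable section
namespace StoqTFD

section RectangularMatrices

variable {I J L : Type*} [Fintype I] [Fintype J] [Fintype L]
  [DecidableEq I] [DecidableEq J] [DecidableEq L]

/-- The continuous linear map of a rectangular matrix. -/
def matCLM (A : Matrix I J ℂ) : EuclideanSpace ℂ J →L[ℂ] EuclideanSpace ℂ I :=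
  (Matrix.toEuclideanLin A).toContinuousLinearMap

omit [DecidableEq I] in
theorem matCLM_apply (A : Matrix I J ℂ) (u : EuclideanSpace ℂ J) (i : I) :
    matCLM A u i = ∑ j, A i j * u j := by
  simp [matCLM, Matrix.toEuclideanLin, Matrix.mulVec, dotProduct]

omit [DecidableEq I] in
theorem matCLM_mul (A : Matrix I J ℂ) (B : Matrix J L ℂ) :
    matCLM (A * B) = (matCLM A).comp (matCLM B) := by
  ext u i
  simp only [ContinuousLinearMap.coe_comp, Function.comp_apply, matCLM_apply, Matrix.mul_apply,
    Finset.sum_mul, Finset.mul_sum]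
  rw [Finset.sum_comm]
  simp only [mul_assoc]

omit [DecidableEq I] in
theorem matCLM_sub (A B : Matrix I J ℂ) : matCLM (A - B) = matCLM A - matCLM B := by
  simp [matCLM]

theorem toEuclideanCLM_eq_matCLM (A : Matrix I I ℂ) :
    Matrix.toEuclideanCLM (n := I) (𝕜 := ℂ) A = matCLM A := rfl

omit [DecidableEq I] in
/-- The Schur test. -/
theorem norm_matCLM_le (A : Matrix I J ℂ) {r : ℝ} (hr : 0 ≤ r)
    (hrow : ∀ i, ∑ j, ‖A i j‖ ≤ r) (hcol : ∀ j, ∑ i, ‖A i j‖ ≤ r) : ‖matCLM A‖ ≤ r := by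
  apply ContinuousLinearMap.opNorm_le_bound _ hr
  intro u
  apply le_of_sq_le_sq _ (by positivity)
  rw [mul_pow, EuclideanSpace.norm_sq_eq, EuclideanSpace.norm_sq_eq]
  have h1 : ∀ i, ‖matCLM A u i‖ ^ 2 ≤ r * ∑ j, ‖A i j‖ * ‖u j‖ ^ 2 := by
    intro i
    have h2 : ‖matCLM A u i‖ ≤ ∑ j, ‖A i j‖ * ‖u j‖ := by
      rw [matCLM_apply]
      exact (norm_sum_le _ _).trans (by simp)
    have h3 : (∑ j, ‖A i j‖ * ‖u j‖) ^ 2 ≤ (∑ j, ‖A i j‖) * ∑ j, ‖A i j‖ * ‖u j‖ ^ 2 :=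
      Finset.sum_sq_le_sum_mul_sum_of_sq_le_mul _ (fun _ _ => norm_nonneg _)
        (fun _ _ => by positivity) (fun _ _ => le_of_eq (by ring))
    calc ‖matCLM A u i‖ ^ 2 ≤ (∑ j, ‖A i j‖ * ‖u j‖) ^ 2 := by gcongr
      _ ≤ _ := h3
      _ ≤ _ := by
        gcongr
        exact hrow i
  calc ∑ i, ‖matCLM A u i‖ ^ 2 ≤ ∑ i, r * ∑ j, ‖A i j‖ * ‖u j‖ ^ 2 :=
        Finset.sum_le_sum fun i _ => h1 i
    _ = r * ∑ j, (∑ i, ‖A i j‖) * ‖u j‖ ^ 2 := by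
        rw [← Finset.mul_sum, Finset.sum_comm]
        simp only [Finset.sum_mul]
    _ ≤ r * ∑ j, r * ‖u j‖ ^ 2 := by
        gcongr with j
        exact hcol j
    _ = r ^ 2 * ∑ j, ‖u j‖ ^ 2 := by rw [← Finset.mul_sum]; ring

omit [DecidableEq I] in
theorem norm_entry_le_matCLM (A : Matrix I J ℂ) (i : I) (j : J) : ‖A i j‖ ≤ ‖matCLM A‖ := by
  have h1 := (matCLM A).le_opNorm (EuclideanSpace.single j 1)
  have h2 : A i j = matCLM A (EuclideanSpace.single j 1) i := by
    rw [matCLM_apply]; simp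
  rw [h2]
  refine (PiLp.norm_apply_le _ i).trans (h1.trans ?_)
  simp

theorem inner_matCLM_ofReal (κ : I → I → ℝ) (ψ : EuclideanSpace ℂ I) :
    (inner ℂ ψ (matCLM (Matrix.of fun x y => (κ x y : ℂ)) ψ) : ℂ).re =
      ∑ x, ∑ y, κ x y * ((ψ x).re * (ψ y).re + (ψ x).im * (ψ y).im) := by
  rw [PiLp.inner_apply, Complex.re_sum]
  refine Finset.sum_congr rfl fun x _ => ?_
  rw [matCLM_apply, RCLike.inner_apply, Finset.sum_mul, Complex.re_sum]
  refine Finset.sum_congr rfl fun y _ => ?_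
  simp
  ring

/-- A positive strict supersolution on `Q` bounds from below the quadratic form of a real symmetric
matrix with nonpositive off-diagonal entries, on the vectors that are supported in `Q`. -/
theorem gap_of_supersolution {κ : I → I → ℝ} (hsymm : ∀ x y, κ x y = κ y x)
    (hoff : ∀ x y, x ≠ y → κ x y ≤ 0) {v : I → ℝ} (hv : ∀ x, 0 < v x) {Q : I → Prop} {Γ : ℝ}
    (hsup : ∀ x, Q x → Γ * v x ≤ ∑ y, κ x y * v y) {ψ : EuclideanSpace ℂ I}
    (hψ : ∀ x, ¬ Q x → ψ x = 0) :
    Γ * ‖ψ‖ ^ 2 ≤ (inner ℂ ψ (matCLM (Matrix.of fun x y => (κ x y : ℂ)) ψ) : ℂ).re := by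
  rw [inner_matCLM_ofReal, EuclideanSpace.norm_sq_eq]
  set w : I → ℝ := fun x => (ψ x).re ^ 2 + (ψ x).im ^ 2 with hw
  have hnorm : ∀ x, ‖ψ x‖ ^ 2 = w x := fun x => by
    rw [← Complex.normSq_eq_norm_sq, Complex.normSq_apply, hw]; ring
  -- Arithmetic–geometric mean with weights v y / v x and v x / v y; the sign of the off-diagonal
  -- entries reverses the inequality. Summed over all pairs it bounds the form below by the sum of w
  -- x (κv)(x)/v(x).
  have key : ∀ x y, (κ x y * (w x * (v y / v x)) + κ y x * (w y * (v x / v y))) / 2 ≤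
      κ x y * ((ψ x).re * (ψ y).re + (ψ x).im * (ψ y).im) := by
    intro x y
    rw [← hsymm x y]
    by_cases hxy : x = y
    · subst hxy
      rw [div_self (hv x).ne']
      apply le_of_eq
      simp only [hw]; ring
    · have h1 := hoff x y hxy
      have h2 : (ψ x).re * (ψ y).re + (ψ x).im * (ψ y).im ≤
          (w x * (v y / v x) + w y * (v x / v y)) / 2 := by
        have hx := hv x
        have hy := hv y
        have h3 : (w x * (v y / v x) + w y * (v x / v y)) / 2 -
            ((ψ x).re * (ψ y).re + (ψ x).im * (ψ y).im) =
            ((v y * (ψ x).re - v x * (ψ y).re) ^ 2 + (v y * (ψ x).im - v x * (ψ y).im) ^ 2)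
              / (2 * v x * v y) := by
          simp only [hw]
          field_simp
          ring
        have h4 : 0 ≤ ((v y * (ψ x).re - v x * (ψ y).re) ^ 2 +
            (v y * (ψ x).im - v x * (ψ y).im) ^ 2) / (2 * v x * v y) := by positivity
        linarith
      nlinarith
  have hsum : ∑ x, w x * ((∑ y, κ x y * v y) / v x) ≤
      ∑ x, ∑ y, κ x y * ((ψ x).re * (ψ y).re + (ψ x).im * (ψ y).im) := by
    have h1 : ∑ x, ∑ y, (κ x y * (w x * (v y / v x)) + κ y x * (w y * (v x / v y))) / 2 =
        ∑ x, w x * ((∑ y, κ x y * v y) / v x) := by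
      have h2 : ∑ x, ∑ y, κ y x * (w y * (v x / v y)) = ∑ x, ∑ y, κ x y * (w x * (v y / v x)) :=
        Finset.sum_comm
      have h3 : ∑ x, ∑ y, κ x y * (w x * (v y / v x)) = ∑ x, w x * ((∑ y, κ x y * v y) / v x) := by
        refine Finset.sum_congr rfl fun x _ => ?_
        rw [Finset.sum_div, Finset.mul_sum]
        refine Finset.sum_congr rfl fun y _ => ?_
        ring
      simp only [add_div, Finset.sum_add_distrib, ← Finset.sum_div]
      rw [h2, h3]; ring
    rw [← h1]
    exact Finset.sum_le_sum fun x _ => Finset.sum_le_sum fun y _ => key x y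
  refine le_trans ?_ hsum
  rw [Finset.mul_sum]
  refine Finset.sum_le_sum fun x _ => ?_
  rw [hnorm]
  by_cases hx : Q x
  · have h1 : Γ ≤ (∑ y, κ x y * v y) / v x := by
      rw [le_div_iff₀ (hv x)]; exact hsup x hx
    have h2 : 0 ≤ w x := by simp only [hw]; positivity
    nlinarith
  · have : w x = 0 := by rw [← hnorm, hψ x hx]; simp
    simp [this]

end RectangularMatrices

/-! ### The hypercube -/

/-- The adjacency matrix of the hypercube. -/
def cube {m : ℕ} (x y : Bits m) : ℝ :=
  ∑ i : Fin m, if y = Function.update x i (!(x i)) then 1 else 0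

theorem eq_flip_comm {m : ℕ} {x y : Bits m} {i : Fin m} :
    y = Function.update x i (!(x i)) ↔ x = Function.update y i (!(y i)) := by
  constructor <;> · rintro rfl; simp

theorem cube_comm {m : ℕ} (x y : Bits m) : cube x y = cube y x :=
  Finset.sum_congr rfl fun i _ => by simp only [eq_flip_comm (x := x)]

theorem cube_nonneg {m : ℕ} (x y : Bits m) : 0 ≤ cube x y :=
  Finset.sum_nonneg fun i _ => by split_ifs <;> simp

theorem sum_cube_mul {m : ℕ} (x : Bits m) (f : Bits m → ℝ) :
    ∑ y, cube x y * f y = ∑ i : Fin m, f (Function.update x i (!(x i))) := by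
  simp only [cube, Finset.sum_mul]
  rw [Finset.sum_comm]
  simp

theorem sum_cube {m : ℕ} (x : Bits m) : ∑ y, cube x y = m := by
  simpa using sum_cube_mul x fun _ => 1

theorem cube_self {m : ℕ} (x : Bits m) : cube x x = 0 := by
  refine Finset.sum_eq_zero fun i _ => if_neg fun h => ?_
  have := congrFun h i
  simp at this

/-- Two strings that differ in at most one place. -/
def Close {ι : Type*} (x y : ι → Bool) : Prop := ∀ i j, i ≠ j → x i = y i ∨ x j = y j

theorem cube_eq_zero {m : ℕ} {x y : Bits m} (h : ¬ Close x y) : cube x y = 0 := by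
  refine Finset.sum_eq_zero fun i _ => if_neg fun hi => h fun j k hjk => ?_
  subst hi
  by_cases hj : j = i
  · subst hj
    right
    rw [Function.update_of_ne hjk.symm]
  · left
    rw [Function.update_of_ne hj]

theorem cube_eq_one {m : ℕ} {x y : Bits m} (h : ∃! i, x i ≠ y i) : cube x y = 1 := by
  obtain ⟨i, hi, hu⟩ := h
  have h1 : y = Function.update x i (!(x i)) := by
    funext j
    by_cases hj : j = i
    · subst hj
      simp only [Function.update_self]
      revert hi
      cases x j <;> cases y j <;> simp
    · rw [Function.update_of_ne hj]
      by_contra hne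
      exact hj (hu j (Ne.symm hne))
  unfold cube
  rw [Finset.sum_eq_single i, if_pos h1]
  · intro j _ hj
    refine if_neg fun h2 => hi ?_
    rw [h2, Function.update_of_ne (Ne.symm hj)]
  · simp

/-- The entries of a transverse field diagonal Hamiltonian. -/
def tfdEntry {m : ℕ} (a : ℝ) (D : Bits m → ℝ) (x y : Bits m) : ℝ :=
  -a * cube x y + if x = y then D x else 0

theorem tfd_apply {m : ℕ} (a : ℝ) (D : Bits m → ℝ) (x y : Bits m) :
    tfd a D x y = (tfdEntry a D x y : ℂ) := by
  simp only [tfd, tfdEntry, cube, pauliX, Matrix.add_apply, Matrix.neg_apply, Matrix.smul_apply,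
    Matrix.sum_apply, Matrix.of_apply, Matrix.diagonal_apply, smul_eq_mul]
  rw [Complex.ofReal_add, Complex.ofReal_mul, Complex.ofReal_sum]
  simp only [apply_ite Complex.ofReal]
  split_ifs <;> simp

theorem tfd_eq {m : ℕ} (a : ℝ) (D : Bits m → ℝ) :
    tfd a D = Matrix.of fun x y => (tfdEntry a D x y : ℂ) := by
  ext x y; rw [tfd_apply]; rfl

theorem tfdEntry_comm {m : ℕ} (a : ℝ) (D : Bits m → ℝ) (x y : Bits m) :
    tfdEntry a D x y = tfdEntry a D y x := by
  unfold tfdEntry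
  rw [cube_comm]
  by_cases h : x = y
  · subst h; rfl
  · rw [if_neg h, if_neg (Ne.symm h)]

theorem tfdEntry_nonpos {m : ℕ} {a : ℝ} (ha : 0 ≤ a) (D : Bits m → ℝ) {x y : Bits m} (h : x ≠ y) :
    tfdEntry a D x y ≤ 0 := by
  unfold tfdEntry
  rw [if_neg h]
  have := mul_nonneg ha (cube_nonneg x y)
  linarith

theorem sum_tfdEntry_mul {m : ℕ} (a : ℝ) (D : Bits m → ℝ) (x : Bits m) (f : Bits m → ℝ) :
    ∑ y, tfdEntry a D x y * f y = D x * f x - a * ∑ y, cube x y * f y := by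
  simp only [tfdEntry, add_mul, Finset.sum_add_distrib, ite_mul, zero_mul, Finset.mul_sum,
    Finset.sum_ite_eq, Finset.mem_univ, if_true]
  rw [add_comm, sub_eq_add_neg, ← Finset.sum_neg_distrib]
  congr 1
  refine Finset.sum_congr rfl fun y _ => by ring

theorem isStoquastic_tfd {m : ℕ} {a : ℝ} (ha : 0 ≤ a) (D : Bits m → ℝ) :
    IsStoquastic (tfd a D) := by
  refine ⟨?_, ?_, ?_⟩
  · ext x y
    rw [Matrix.conjTranspose_apply, tfd_apply, tfd_apply, tfdEntry_comm]
    simp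
  · intro x y
    rw [tfd_apply, Complex.ofReal_im]
  · intro x y h
    rw [tfd_apply, Complex.ofReal_re]
    exact tfdEntry_nonpos ha D h

theorem opNorm_tfd_le {m : ℕ} {a : ℝ} (ha : 0 ≤ a) {D : Bits m → ℝ} {c : ℝ} (hc : 0 ≤ c)
    (hD : ∀ x, |D x| ≤ c) : opNorm (tfd a D) ≤ a * m + c := by
  have hrow : ∀ x, ∑ y, ‖tfd a D x y‖ ≤ a * m + c := by
    intro x
    calc ∑ y, ‖tfd a D x y‖ ≤ ∑ y, (a * cube x y + if x = y then |D x| else 0) := by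
          refine Finset.sum_le_sum fun y _ => ?_
          rw [tfd_apply, Complex.norm_real, Real.norm_eq_abs]
          refine (abs_add_le _ _).trans (add_le_add ?_ ?_)
          · rw [abs_mul, abs_neg, abs_of_nonneg ha, abs_of_nonneg (cube_nonneg x y)]
          · split_ifs <;> simp
      _ = a * m + |D x| := by
          rw [Finset.sum_add_distrib, ← Finset.mul_sum, sum_cube]; simp
      _ ≤ _ := by linarith [hD x]
  refine norm_matCLM_le _ (by positivity) hrow fun y => ?_
  refine le_trans (le_of_eq ?_) (hrow y)
  refine Finset.sum_congr rfl fun x _ => ?_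
  rw [tfd_apply, tfd_apply, tfdEntry_comm]

/-- The matrix of the copy encoding. -/
def encMatrix (n s : ℕ) : Matrix (Bits (6 * n + 4 * s)) (Bits n) ℂ :=
  Matrix.of fun z x => if z = encString s x then 1 else 0

theorem encoding_eq_matCLM (n s : ℕ) :
    (encoding n s).toContinuousLinearMap = matCLM (encMatrix n s) := by
  have h : (encoding n s).toLinearMap = (matCLM (encMatrix n s)).toLinearMap := by
    apply (EuclideanSpace.basisFun (Bits n) ℂ).toBasis.ext
    intro x
    simp only [OrthonormalBasis.coe_toBasis, EuclideanSpace.basisFun_apply]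
    have h1 : (encoding n s).toLinearMap (EuclideanSpace.single x 1) =
      EuclideanSpace.single (encString s x) 1 := encoding_single s x
    rw [h1]
    ext z
    simp [matCLM_apply, encMatrix]
  ext1 u
  exact congrArg (fun A : Hilb n →ₗ[ℂ] Hilb (6 * n + 4 * s) => A u) h

end StoqTFD
end

noncomputable section
namespace StoqTFD

/-! ### The sites of the simulator -/

/-- The qubits of the simulator. Each half `h` carries two data registers, an `out` and an `inn`
flag register, and a tally register. -/
inductive Site (n s : ℕ) where
  | data (h c : Bool) (b : Fin n)
  | out (h : Bool) (r : Fin s)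
  | inn (h : Bool) (r : Fin s)
  | tally (h : Bool) (b : Fin n)

namespace Site

variable {n s : ℕ}

/-- One half of the simulator, as a sum of its registers. -/
abbrev HalfSum (n s : ℕ) : Type := (((Fin n ⊕ Fin n) ⊕ Fin s) ⊕ Fin s) ⊕ Fin n

/-- The place of a half within the sum of the two halves. -/
def half (h : Bool) (q : HalfSum n s) : HalfSum n s ⊕ HalfSum n s :=
  if h then Sum.inr q else Sum.inl q

/-- The sites as a sum of registers. -/
def toSum : Site n s → HalfSum n s ⊕ HalfSum n s
  | data h c b => half h (.inl (.inl (.inl (if c then .inr b else .inl b))))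
  | out h r => half h (.inl (.inl (.inr r)))
  | inn h r => half h (.inl (.inr r))
  | tally h b => half h (.inr b)

/-- The site at a place in one of the halves. -/
def ofHalf (h : Bool) : HalfSum n s → Site n s
  | .inl (.inl (.inl (.inl b))) => data h false b
  | .inl (.inl (.inl (.inr b))) => data h true b
  | .inl (.inl (.inr r)) => out h r
  | .inl (.inr r) => inn h r
  | .inr b => tally h b

/-- The sites are the sum of the registers. -/
def sumEquiv : Site n s ≃ HalfSum n s ⊕ HalfSum n s where
  toFun := toSum
  invFun := Sum.elim (ofHalf false) (ofHalf true)
  left_inv q := by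
    rcases q with ⟨h, c, b⟩ | ⟨h, r⟩ | ⟨h, r⟩ | ⟨h, b⟩ <;> cases h <;> try cases c
    all_goals rfl
  right_inv q := by
    rcases q with ((((b | b) | r) | r) | b) | ((((b | b) | r) | r) | b) <;> rfl

/-- The position of a site in one of the halves. -/
def halfEquiv : HalfSum n s ≃ Fin (n + n + s + s + n) :=
  (Equiv.sumCongr ((Equiv.sumCongr ((Equiv.sumCongr finSumFinEquiv (Equiv.refl _)).trans
    finSumFinEquiv) (Equiv.refl _)).trans finSumFinEquiv) (Equiv.refl _)).trans finSumFinEquiv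

/-- The position of a site. -/
def equiv : Site n s ≃ Fin (6 * n + 4 * s) :=
  sumEquiv.trans ((Equiv.sumCongr halfEquiv halfEquiv).trans
    (finSumFinEquiv.trans (finCongr (by ring))))

/-- The contents of the sites in the encoding of `x`. -/
def base (x : Bits n) : Site n s → Bool
  | data _ _ b => x b
  | _ => false

theorem encString_equiv (x : Bits n) (q : Site n s) : encString s x (equiv q) = base x q := by
  rcases q with ⟨h, c, b⟩ | ⟨h, r⟩ | ⟨h, r⟩ | ⟨h, b⟩ <;> cases h <;> try cases c
  all_goals
    simp [encString, equiv, sumEquiv, toSum, half, halfEquiv, base, halfString,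
      -Fin.natAdd_eq_addNat]

instance : Fintype (Site n s) := Fintype.ofEquiv _ equiv.symm

theorem card_site : Fintype.card (Site n s) = 6 * n + 4 * s := by
  rw [Fintype.card_congr equiv, Fintype.card_fin]

/-- The last step before which the content of a site is its initial one. -/
def lo : Site n s → ℕ
  | data h c b => 2 + (if h then 0 else 2 * n + 4) + (if c then n else 0) + b
  | out h _ => if h then 1 else 0
  | inn h _ => 2 * n + 2 + (if h then 1 else 0)
  | tally h b => 2 + (if h then n else 0) + b

/-- The last step before which the content of a site is changed for the last time. -/
def hi : Site n s → ℕ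
  | data _ _ _ => 4 * n + 8
  | out h _ => (if h then 1 else 0) + (2 * n + 4)
  | inn h _ => 2 * n + 2 + (if h then 1 else 0) + (2 * n + 4)
  | tally h b => 2 + (if h then n else 0) + b + (2 * n + 4)

/-- The sites which change on the path from `x` to `y` with labels `i` and `j`. -/
def mask (x y : Bits n) (i j : ℕ) : Site n s → Bool
  | data _ _ b => xor (x b) (y b)
  | out _ r => decide ((r : ℕ) = i)
  | inn _ r => decide ((r : ℕ) = j)
  | tally _ b => !(xor (x b) (y b))

/-- The contents of the sites after `p` steps on the path from `x` to `y` with labels `i`, `j`. -/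
def state (x y : Bits n) (i j p : ℕ) (q : Site n s) : Bool :=
  xor (base x q) (mask x y i j q && (decide (lo q < p) && decide (p ≤ hi q)))

variable {x y x' y' : Bits n} {i j i' j' p p' : ℕ}

theorem state_zero : state x y i j 0 = (base x : Site n s → Bool) := by
  funext q; simp [state]

theorem state_last : state x y i j (4 * n + 8) = (base y : Site n s → Bool) := by
  funext q
  rcases q with ⟨h, c, b⟩ | ⟨h, r⟩ | ⟨h, r⟩ | ⟨h, b⟩
  · have h1 : lo (data h c b : Site n s) < 4 * n + 8 := by
      have := b.2
      simp only [lo]; split_ifs <;> omega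
    simp [state, h1, hi, mask, base]
  · have h1 : ¬ (4 * n + 8 ≤ hi (out h r : Site n s)) := by simp only [hi]; split_ifs <;> omega
    simp [state, h1, base]
  · have h1 : ¬ (4 * n + 8 ≤ hi (inn h r : Site n s)) := by simp only [hi]; split_ifs <;> omega
    simp [state, h1, base]
  · have h1 : ¬ (4 * n + 8 ≤ hi (tally h b : Site n s)) := by
      have := b.2
      simp only [hi]; split_ifs <;> omega
    simp [state, h1, base]

theorem state_out (h : Bool) (r : Fin s) :
    state x y i j p (out h r) = true ↔
      (r : ℕ) = i ∧ lo (out h r : Site n s) < p ∧ p ≤ hi (out h r : Site n s) := by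
  simp [state, base, mask]

theorem state_inn (h : Bool) (r : Fin s) :
    state x y i j p (inn h r) = true ↔
      (r : ℕ) = j ∧ lo (inn h r : Site n s) < p ∧ p ≤ hi (inn h r : Site n s) := by
  simp [state, base, mask]

theorem state_data_of_le {h c : Bool} {b : Fin n} (hp : p ≤ lo (data h c b : Site n s)) :
    state x y i j p (data h c b : Site n s) = x b := by
  simp [state, base, not_lt.mpr hp]

theorem state_data_of_lt {h c : Bool} {b : Fin n} (hp : lo (data h c b : Site n s) < p)
    (hp2 : p ≤ 4 * n + 8) : state x y i j p (data h c b : Site n s) = y b := by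
  simp [state, base, mask, hp, hi, hp2]

/-! ### The steps of a path -/

/-- The timetable of a path. Steps 0 and 1 raise the two outgoing flags, steps 2 to 2n+1 rewrite the
second half, steps 2n+2 and 2n+3 raise the incoming flags, steps 2n+4 and 2n+5 lower the outgoing
ones, steps 2n+6 to 4n+5 rewrite the first half, and the last two lower the incoming flags. Where x
and y agree, a tally bit is flipped instead of a data bit, in the first rewriting phase, and flipped
back in the second. A site that flips back does so exactly 2n+4 steps after its first flip. -/
theorem exists_step (hi : i < s) (hj : j < s) {t : ℕ} (ht : t < 4 * n + 8) :
    ∃ q : Site n s, mask x y i j q = true ∧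
      (lo q = t ∨ (q.hi = t ∧ q.hi = lo q + (2 * n + 4))) := by
  rcases Nat.lt_or_ge t 2 with h2 | h2
  · rcases (by omega : t = 0 ∨ t = 1) with rfl | rfl
    · exact ⟨out false ⟨i, hi⟩, by simp [mask], Or.inl (by simp [lo])⟩
    · exact ⟨out true ⟨i, hi⟩, by simp [mask], Or.inl (by simp [lo])⟩
  rcases Nat.lt_or_ge t (2 * n + 2) with h3 | h3
  · obtain ⟨c, b, hcb⟩ : ∃ (c : Bool) (b : Fin n), t = 2 + (if c then n else 0) + b := by
      by_cases hc : t < n + 2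
      · exact ⟨false, ⟨t - 2, by omega⟩, by simp; omega⟩
      · exact ⟨true, ⟨t - n - 2, by omega⟩, by simp; omega⟩
    by_cases hb : x b = y b
    · exact ⟨tally c b, by simp [mask, hb], Or.inl (by simp [lo, hcb])⟩
    · exact ⟨data true c b, by simpa [mask] using hb, Or.inl (by simp [lo, hcb])⟩
  rcases Nat.lt_or_ge t (2 * n + 4) with h4 | h4
  · rcases (by omega : t = 2 * n + 2 ∨ t = 2 * n + 3) with rfl | rfl
    · exact ⟨inn false ⟨j, hj⟩, by simp [mask], Or.inl (by simp [lo])⟩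
    · exact ⟨inn true ⟨j, hj⟩, by simp [mask], Or.inl (by simp [lo])⟩
  rcases Nat.lt_or_ge t (2 * n + 6) with h5 | h5
  · rcases (by omega : t = 2 * n + 4 ∨ t = 2 * n + 5) with rfl | rfl
    · exact ⟨out false ⟨i, hi⟩, by simp [mask], Or.inr (by simp [lo, Site.hi])⟩
    · exact ⟨out true ⟨i, hi⟩, by simp [mask], Or.inr (by simp [lo, Site.hi]; omega)⟩
  rcases Nat.lt_or_ge t (4 * n + 6) with h6 | h6
  · obtain ⟨c, b, hcb⟩ : ∃ (c : Bool) (b : Fin n), t = 2 * n + 6 + (if c then n else 0) + b := by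
      by_cases hc : t < 3 * n + 6
      · exact ⟨false, ⟨t - (2 * n + 6), by omega⟩, by simp; omega⟩
      · exact ⟨true, ⟨t - (3 * n + 6), by omega⟩, by simp; omega⟩
    by_cases hb : x b = y b
    · exact ⟨tally c b, by simp [mask, hb], Or.inr (by simp [lo, Site.hi, hcb]; omega)⟩
    · exact ⟨data false c b, by simpa [mask] using hb, Or.inl (by simp [lo, hcb]; omega)⟩
  · rcases (by omega : t = 4 * n + 6 ∨ t = 4 * n + 7) with rfl | rfl
    · exact ⟨inn false ⟨j, hj⟩, by simp [mask], Or.inr (by simp [lo, Site.hi]; omega)⟩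
    · exact ⟨inn true ⟨j, hj⟩, by simp [mask], Or.inr (by simp [lo, Site.hi]; omega)⟩

/-- Sites that share a step are a data bit and a tally bit, whose masks are complementary, or flags
with different labels, of which the mask keeps one. The formal flip of the data bits at 4n+8 lies
beyond the path. -/
theorem step_unique {q q' : Site n s} (hq : mask x y i j q = true) (hq' : mask x y i j q' = true)
    {t : ℕ} (ht : t < 4 * n + 8) (h : lo q = t ∨ hi q = t) (h' : lo q' = t ∨ hi q' = t) :
    q = q' := by
  rcases q with ⟨u, c, b⟩ | ⟨u, r⟩ | ⟨u, r⟩ | ⟨u, b⟩ <;>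
  rcases q' with ⟨u', c', b'⟩ | ⟨u', r'⟩ | ⟨u', r'⟩ | ⟨u', b'⟩ <;>
  simp only [mask, decide_eq_true_eq] at hq hq' <;>
  simp only [lo, Site.hi] at h h' <;>
  cases u <;> cases u' <;> (try cases c) <;> (try cases c') <;>
  simp only [Bool.false_eq_true, if_true, if_false] at h h' <;>
  first
  | (exfalso; omega)
  | (obtain rfl : b = b' := Fin.ext (by omega)
     simp_all)
  | (obtain rfl : r = r' := Fin.ext (by omega)
     rfl)

/-- Consecutive states of a path differ at exactly one site. -/
theorem existsUnique_state_ne (hi : i < s) (hj : j < s) (hp : p < 4 * n + 8) :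
    ∃! q : Site n s, state x y i j p q ≠ state x y i j (p + 1) q := by
  obtain ⟨q, hq, ht⟩ := exists_step (x := x) (y := y) hi hj hp
  refine ⟨q, ?_, fun q' hq' => ?_⟩
  · have h1 : (decide (lo q < p) && decide (p ≤ q.hi)) ≠
        (decide (lo q < p + 1) && decide (p + 1 ≤ q.hi)) := by
      have h2 : q.hi ≥ lo q + (2 * n + 4) ∨ q.hi = 4 * n + 8 := by
        rcases q with ⟨h, c, b⟩ | ⟨h, r⟩ | ⟨h, r⟩ | ⟨h, b⟩ <;> simp [lo, Site.hi]
      have h3 : (lo q < p ∧ p ≤ q.hi) ↔ ¬ (lo q < p + 1 ∧ p + 1 ≤ q.hi) := by omega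
      intro h4
      rw [← Bool.decide_and, ← Bool.decide_and, decide_eq_decide] at h4
      tauto
    simp only [state, hq, Bool.true_and]
    exact fun h2 => h1 (Bool.xor_right_inj.mp h2)
  · have h1 : mask x y i j q' = true := by
      by_contra h
      exact hq' (by simp [state, h])
    have h2 : lo q' = p ∨ Site.hi q' = p := by
      by_contra! h
      apply hq'
      have h3 : lo q' < p ↔ lo q' < p + 1 := by omega
      have h4 : p ≤ q'.hi ↔ p + 1 ≤ q'.hi := by omega
      simp [state, h3, h4]
    exact step_unique h1 hq hp h2 (ht.imp id And.left)

theorem state_ne_of_lo {q : Site n s} (hq : mask x y i j q = true) (h1 : p ≤ lo q)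
    (h2 : lo q < p') (h3 : p' ≤ hi q) : state x y i j p q ≠ state x y i j p' q := by
  simp [state, hq, not_lt.mpr h1, h2, h3]

theorem state_ne_of_hi {q : Site n s} (hq : mask x y i j q = true) (h1 : lo q < p)
    (h2 : p ≤ hi q) (h3 : hi q < p') : state x y i j p q ≠ state x y i j p' q := by
  simp [state, hq, not_le.mpr h3, h1, h2]

/-- States of a path which are not consecutive are not close. -/
theorem not_close_state (hi : i < s) (hj : j < s) (hp : 1 ≤ p) (hpp : p + 2 ≤ p')
    (hp' : p' ≤ 4 * n + 7) :
    ¬ Close (state x y i j p : Site n s → Bool) (state x y i j p') := by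
  intro hclose
  -- More than 2n+4 steps apart, p ≤ 2n+2 and p' ≥ 2n+6: the first outgoing flag has been lowered
  -- and the second incoming flag raised in between.
  rcases Nat.lt_or_ge (p + (2 * n + 4)) p' with h | h
  · have h1 : (state x y i j p (out false ⟨i, hi⟩ : Site n s)) ≠ state x y i j p' (out false ⟨i, hi⟩) :=
      state_ne_of_hi (by simp [mask]) (by simp [lo]; omega) (by simp [Site.hi]; omega)
        (by simp [Site.hi]; omega)
    have h2 : (state x y i j p (inn true ⟨j, hj⟩ : Site n s)) ≠ state x y i j p' (inn true ⟨j, hj⟩) :=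
      state_ne_of_lo (by simp [mask]) (by simp [lo]; omega) (by simp [lo]; omega)
        (by simp [Site.hi]; omega)
    rcases hclose (out false ⟨i, hi⟩) (inn true ⟨j, hj⟩) (by simp) with h3 | h3
    · exact h1 h3
    · exact h2 h3
  -- At most 2n+4 steps apart, no site has had time to flip twice. Steps p and p' - 1 therefore
  -- leave two different sites changed.
  · have key : ∀ t, p ≤ t → t < p' → ∃ q : Site n s, (lo q = t ∨ q.hi = t ∧ q.hi = lo q + (2 * n + 4)) ∧
        state x y i j p q ≠ state x y i j p' q := by
      intro t ht ht'
      obtain ⟨q, hq, hqt⟩ := exists_step (x := x) (y := y) hi hj (t := t) (by omega)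
      refine ⟨q, hqt, ?_⟩
      rcases hqt with h1 | ⟨h1, h2⟩
      · have h2 : q.hi = lo q + (2 * n + 4) ∨ q.hi = 4 * n + 8 := by
          rcases q with ⟨h, c, b⟩ | ⟨h, r⟩ | ⟨h, r⟩ | ⟨h, b⟩ <;> simp [lo, Site.hi]
        exact state_ne_of_lo hq (by omega) (by omega) (by omega)
      · exact state_ne_of_hi hq (by omega) (by omega) (by omega)
    obtain ⟨q, hq, hne⟩ := key p le_rfl (by omega)
    obtain ⟨q', hq', hne'⟩ := key (p' - 1) (by omega) (by omega)
    have hqq : q ≠ q' := by rintro rfl; omega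
    rcases hclose q q' hqq with h3 | h3
    · exact hne h3
    · exact hne' h3

theorem close_symm {ι : Type*} {u v : ι → Bool} (h : Close u v) : Close v u :=
  fun a b hab => (h a b hab).imp Eq.symm Eq.symm

/-- A half stores its string twice, so a difference in one bit of the string would show at two
sites. -/
theorem data_eq_of_close {u v : Site n s → Bool} (h : Close u v) {k : Bool} {x x' : Bits n}
    (hu : ∀ c b, u (data k c b) = x b) (hv : ∀ c b, v (data k c b) = x' b) : x = x' := by
  funext b
  rcases h (data k false b) (data k true b) (by simp) with h1 | h1
  · rwa [hu, hv] at h1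
  · rwa [hu, hv] at h1

/-- The first half is intact up to place 2n+6 and the second is complete from place 2n+2 on, so at
every place at least one half displays an end of the edge. -/
theorem state_data_false (hp : p ≤ 2 * n + 6) (c : Bool) (b : Fin n) :
    state x y i j p (data false c b : Site n s) = x b :=
  state_data_of_le (by simp only [lo]; split_ifs <;> simp_all <;> omega)

theorem state_data_true (hp : 2 * n + 2 ≤ p) (hp' : p ≤ 4 * n + 8) (c : Bool) (b : Fin n) :
    state x y i j p (data true c b : Site n s) = y b :=
  state_data_of_lt (by have := b.2; simp only [lo]; split_ifs <;> simp_all <;> omega) hp'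

/-- Close interior states belong to edges with the same start and outgoing label, or with the same
end and incoming label. -/
theorem label_eq_of_close (hi : i < s) (hj : j < s) (hi' : i' < s) (hj' : j' < s)
    (hp : 1 ≤ p) (hpL : p ≤ 4 * n + 7) (hp' : 1 ≤ p') (hpL' : p' ≤ 4 * n + 7)
    (h : Close (state x y i j p : Site n s → Bool) (state x' y' i' j' p')) :
    (x = x' ∧ i = i') ∨ (y = y' ∧ j = j') := by
  have hout : ∀ (k k' : Bool) (r r' : Fin s), (k ≠ k' ∨ r ≠ r') → 
      (((r : ℕ) = i ∧ lo (out k r : Site n s) < p ∧ p ≤ Site.hi (out k r : Site n s)) ↔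
        ((r : ℕ) = i' ∧ lo (out k r : Site n s) < p' ∧ p' ≤ Site.hi (out k r : Site n s))) ∨
      (((r' : ℕ) = i ∧ lo (out k' r' : Site n s) < p ∧ p ≤ Site.hi (out k' r' : Site n s)) ↔
        ((r' : ℕ) = i' ∧ lo (out k' r' : Site n s) < p' ∧ p' ≤ Site.hi (out k' r' : Site n s))) := by
    intro k k' r r' hne
    rw [← state_out (x := x) (y := y) (j := j), ← state_out (x := x') (y := y') (j := j'),
      ← state_out (x := x) (y := y) (j := j), ← state_out (x := x') (y := y') (j := j'),
      ← Bool.eq_iff_iff, ← Bool.eq_iff_iff]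
    exact h _ _ (by simpa [-not_and, Classical.not_and_iff_not_or_not] using hne)
  have hinn : ∀ (k k' : Bool) (r r' : Fin s), (k ≠ k' ∨ r ≠ r') → 
      (((r : ℕ) = j ∧ lo (inn k r : Site n s) < p ∧ p ≤ Site.hi (inn k r : Site n s)) ↔
        ((r : ℕ) = j' ∧ lo (inn k r : Site n s) < p' ∧ p' ≤ Site.hi (inn k r : Site n s))) ∨
      (((r' : ℕ) = j ∧ lo (inn k' r' : Site n s) < p ∧ p ≤ Site.hi (inn k' r' : Site n s)) ↔
        ((r' : ℕ) = j' ∧ lo (inn k' r' : Site n s) < p' ∧ p' ≤ Site.hi (inn k' r' : Site n s))) := by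
    intro k k' r r' hne
    rw [← state_inn (x := x) (y := y) (i := i), ← state_inn (x := x') (y := y') (i := i'),
      ← state_inn (x := x) (y := y) (i := i), ← state_inn (x := x') (y := y') (i := i'),
      ← Bool.eq_iff_iff, ← Bool.eq_iff_iff]
    exact h _ _ (by simpa [-not_and, Classical.not_and_iff_not_or_not] using hne)
  have hmix : ∀ (k k' : Bool) (r r' : Fin s),
      (((r : ℕ) = i ∧ lo (out k r : Site n s) < p ∧ p ≤ Site.hi (out k r : Site n s)) ↔
        ((r : ℕ) = i' ∧ lo (out k r : Site n s) < p' ∧ p' ≤ Site.hi (out k r : Site n s))) ∨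
      (((r' : ℕ) = j ∧ lo (inn k' r' : Site n s) < p ∧ p ≤ Site.hi (inn k' r' : Site n s)) ↔
        ((r' : ℕ) = j' ∧ lo (inn k' r' : Site n s) < p' ∧ p' ≤ Site.hi (inn k' r' : Site n s))) := by
    intro k k' r r'
    rw [← state_inn (x := x) (y := y) (i := i), ← state_inn (x := x') (y := y') (i := i'),
      ← state_out (x := x) (y := y) (j := j), ← state_out (x := x') (y := y') (j := j'),
      ← Bool.eq_iff_iff, ← Bool.eq_iff_iff]
    exact h _ _ (by simp)
  simp only [lo, Site.hi] at hout hinn hmix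
  -- Both places early: the first halves show x and x'. Up to place 2n+5 at least one of the two
  -- outgoing flags is raised, so different labels would make one flag of each label differ.
  by_cases hA : p ≤ 2 * n + 5 ∧ p' ≤ 2 * n + 5
  · left
    refine ⟨data_eq_of_close h (state_data_false (by omega)) (state_data_false (by omega)), ?_⟩
    by_contra hne
    have a1 := hout false false ⟨i, hi⟩ ⟨i', hi'⟩ (Or.inr (by simpa using hne))
    have a2 := hout true true ⟨i, hi⟩ ⟨i', hi'⟩ (Or.inr (by simpa using hne))
    have a3 := hout false true ⟨i, hi⟩ ⟨i', hi'⟩ (Or.inl (by simp))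
    have a4 := hout false true ⟨i', hi'⟩ ⟨i, hi⟩ (Or.inl (by simp))
    simp only [Bool.false_eq_true, if_true, if_false, hne, Ne.symm hne, true_and, false_and,
      iff_false, false_iff] at a1 a2 a3 a4
    omega
  -- Both places late: the same argument with the second halves and the incoming flags, of which at
  -- least one is raised from place 2n+3 on.
  by_cases hB : 2 * n + 3 ≤ p ∧ 2 * n + 3 ≤ p'
  · right
    refine ⟨data_eq_of_close h (state_data_true (by omega) (by omega))
      (state_data_true (by omega) (by omega)), ?_⟩
    by_contra hne
    have a1 := hinn false false ⟨j, hj⟩ ⟨j', hj'⟩ (Or.inr (by simpa using hne))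
    have a2 := hinn true true ⟨j, hj⟩ ⟨j', hj'⟩ (Or.inr (by simpa using hne))
    have a3 := hinn false true ⟨j, hj⟩ ⟨j', hj'⟩ (Or.inl (by simp))
    have a4 := hinn false true ⟨j', hj'⟩ ⟨j, hj⟩ (Or.inl (by simp))
    simp only [Bool.false_eq_true, if_true, if_false, hne, Ne.symm hne, true_and, false_and,
      iff_false, false_iff] at a1 a2 a3 a4
    omega
  -- One place is at most 2n+2 and the other at least 2n+6. The first outgoing flag is raised only
  -- in the former and the second incoming flag only in the latter.
  exfalso
  have a1 := hmix false true ⟨i, hi⟩ ⟨j', hj'⟩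
  have a2 := hmix false true ⟨i', hi'⟩ ⟨j, hj⟩
  simp only [Bool.false_eq_true, if_true, if_false, true_and] at a1 a2
  have hn := n.zero_le
  omega

/-- An interior state is close to an encoded string only next to an end of its path. -/
theorem eq_of_close_base (hi : i < s) (hj : j < s) (hp : 1 ≤ p) (hpL : p ≤ 4 * n + 7)
    {v : Bits n} (h : Close (base v : Site n s → Bool) (state x y i j p)) :
    (p = 1 ∧ v = x) ∨ (p = 4 * n + 7 ∧ v = y) := by
  have e1 : state x y i j p (out false ⟨i, hi⟩ : Site n s) = decide (p ≤ 2 * n + 4) := by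
    rw [Bool.eq_iff_iff, state_out]; simp [lo, Site.hi]; omega
  have e2 : state x y i j p (out true ⟨i, hi⟩ : Site n s) = decide (2 ≤ p ∧ p ≤ 2 * n + 5) := by
    rw [Bool.eq_iff_iff, state_out]; simp [lo, Site.hi]; omega
  have e3 : state x y i j p (inn false ⟨j, hj⟩ : Site n s) =
      decide (2 * n + 3 ≤ p ∧ p ≤ 4 * n + 6) := by
    rw [Bool.eq_iff_iff, state_inn]; simp [lo, Site.hi]; omega
  have e4 : state x y i j p (inn true ⟨j, hj⟩ : Site n s) = decide (2 * n + 4 ≤ p) := by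
    rw [Bool.eq_iff_iff, state_inn]; simp [lo, Site.hi]; omega
  -- A codeword has no flags raised, so at most one of these four may be; that happens only at
  -- places 1 and 4n+7.
  have h12 := h (out false ⟨i, hi⟩) (out true ⟨i, hi⟩) (by simp)
  have h23 := h (out true ⟨i, hi⟩) (inn false ⟨j, hj⟩) (by simp)
  have h34 := h (inn false ⟨j, hj⟩) (inn true ⟨j, hj⟩) (by simp)
  rw [e1, e2] at h12
  rw [e2, e3] at h23
  rw [e3, e4] at h34
  simp only [base, eq_comm (a := false), decide_eq_false_iff_not] at h12 h23 h34
  rcases (by omega : p = 1 ∨ p = 4 * n + 7) with rfl | rfl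
  · left
    exact ⟨rfl, data_eq_of_close (k := false) h (fun _ _ => rfl) (state_data_false (by omega))⟩
  · right
    exact ⟨rfl, data_eq_of_close (k := true) h (fun _ _ => rfl)
      (state_data_true (by omega) (by omega))⟩

theorem eq_of_close_base_base {v w : Bits n}
    (h : Close (base v : Site n s → Bool) (base w : Site n s → Bool)) : v = w :=
  data_eq_of_close (k := false) h (fun _ _ => rfl) (fun _ _ => rfl)

end Site
end StoqTFD
end

noncomputable section
namespace StoqTFD
open Site Finset

/-! ### The edges of the interaction graph and their labels -/

section Edges

variable {n : ℕ}

/-- The number of which `y` is the binary expansion. -/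
def binVal (y : Bits n) : ℝ := ∑ b : Fin n, if y b then (2 : ℝ) ^ (b : ℕ) else 0

theorem binVal_injective : Function.Injective (binVal : Bits n → ℝ) := by
  intro y z hyz
  have key : ∀ y : Bits n, binVal y =
      ((∑ k ∈ (univ.filter fun b => y b = true).map Fin.valEmbedding, 2 ^ k : ℕ) : ℝ) := by
    intro y
    rw [sum_map, sum_filter]
    push_cast
    rfl
  rw [key, key, Nat.cast_inj] at hyz
  have h1 := Finset.geomSum_injective (n := 2) le_rfl hyz
  have h2 := map_injective _ h1
  funext b
  have h3 : b ∈ univ.filter (fun b => y b = true) ↔ b ∈ univ.filter (fun b => z b = true) := by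
    rw [h2]
  simpa [← Bool.eq_iff_iff] using h3

variable (h : Bits n → Bits n → ℝ) (θ : ℝ)

/-- The pairs of strings with a non-negligible matrix element. -/
def Edge (x y : Bits n) : Prop := x ≠ y ∧ θ < -h x y

open Classical in
/-- The rank of `y` among the neighbours of `x`. -/
def rank (x y : Bits n) : ℕ :=
  (univ.filter fun y' => Edge h θ x y' ∧ binVal y' < binVal y).card

variable {h θ}

theorem Edge.symm (hs : ∀ x y, h x y = h y x) {x y : Bits n} (e : Edge h θ x y) :
    Edge h θ y x := ⟨e.1.symm, by rw [hs]; exact e.2⟩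

theorem edge_comm (hs : ∀ x y, h x y = h y x) {x y : Bits n} :
    Edge h θ x y ↔ Edge h θ y x := ⟨Edge.symm hs, Edge.symm hs⟩

open Classical in
theorem card_edges_le {s : ℕ} (hθ : 0 ≤ θ) (hcard : ∀ x, {y | h x y ≠ 0}.ncard ≤ s) (x : Bits n) :
    (univ.filter fun y => Edge h θ x y).card ≤ s := by
  refine le_trans ?_ (hcard x)
  rw [← Set.ncard_coe_finset]
  refine Set.ncard_le_ncard (fun y hy => ?_) (Set.toFinite _)
  have h1 : Edge h θ x y := by simpa using hy
  have h2 := h1.2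
  intro h3
  rw [h3] at h2
  linarith

theorem rank_lt_rank {x y y' : Bits n} (e : Edge h θ x y) (hlt : binVal y < binVal y') :
    rank h θ x y < rank h θ x y' := by
  classical
  unfold rank
  apply card_lt_card
  rw [ssubset_iff_of_subset]
  · exact ⟨y, by simpa using ⟨e, hlt⟩, by simp⟩
  · intro z hz
    simp only [mem_filter, mem_univ, true_and] at hz ⊢
    exact ⟨hz.1, hz.2.trans hlt⟩

theorem rank_injOn {x y y' : Bits n} (e : Edge h θ x y) (e' : Edge h θ x y')
    (hr : rank h θ x y = rank h θ x y') : y = y' := by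
  rcases lt_trichotomy (binVal y) (binVal y') with hlt | heq | hlt
  · exact absurd hr (rank_lt_rank e hlt).ne
  · exact binVal_injective heq
  · exact absurd hr (rank_lt_rank e' hlt).ne'

theorem rank_lt {s : ℕ} (hθ : 0 ≤ θ) (hcard : ∀ x, {y | h x y ≠ 0}.ncard ≤ s) {x y : Bits n}
    (e : Edge h θ x y) : rank h θ x y < s := by
  classical
  refine lt_of_lt_of_le ?_ (card_edges_le hθ hcard x)
  unfold rank
  apply card_lt_card
  rw [ssubset_iff_of_subset]
  · exact ⟨y, by simpa using e, by simp⟩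
  · intro z hz
    simp only [mem_filter, mem_univ, true_and] at hz ⊢
    exact hz.1

end Edges

/-! ### The paths in the hypercube -/

section Paths

variable {n s : ℕ} (h : Bits n → Bits n → ℝ) (θ : ℝ)

/-- The string after `p` steps of the path from `x` to `y`. -/
def path (s : ℕ) (x y : Bits n) (p : ℕ) : Bits (6 * n + 4 * s) :=
  fun k => state x y (rank h θ x y) (rank h θ y x) p (Site.equiv.symm k)

open Classical in
/-- The function which is `f x y p` at the interior place `p` of the path of the edge `(x, y)`, and
zero elsewhere. -/
def pathSum (f : Bits n → Bits n → ℕ → ℝ) (z : Bits (6 * n + 4 * s)) : ℝ :=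
  ∑ x, ∑ y, ∑ p ∈ Icc 1 (4 * n + 7), if Edge h θ x y ∧ z = path h θ s x y p then f x y p else 0

/-- The string `z` is on the path of an edge. -/
def OnPath (z : Bits (6 * n + 4 * s)) : Prop :=
  ∃ x y p, Edge h θ x y ∧ p ∈ Icc 1 (4 * n + 7) ∧ z = path h θ s x y p

/-- The string `z` is an encoded string or on the path of an edge. -/
def Good (z : Bits (6 * n + 4 * s)) : Prop := (∃ x, z = encString s x) ∨ OnPath h θ z

variable {h θ}

theorem close_comp_equiv {u v : Site n s → Bool} :
    Close (fun k => u (Site.equiv.symm k)) (fun k => v (Site.equiv.symm k)) ↔ Close u v := by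
  constructor
  · intro hc i j hij
    simpa using hc (Site.equiv i) (Site.equiv j) (by simpa using hij)
  · intro hc i j hij
    exact hc _ _ (by simpa using hij)

theorem encString_eq (s : ℕ) (x : Bits n) :
    encString s x = fun k => base x (Site.equiv.symm k) := by
  funext k
  rw [← encString_equiv, Equiv.apply_symm_apply]

theorem path_zero (x y : Bits n) : path h θ s x y 0 = encString s x := by
  rw [encString_eq]; unfold path; rw [state_zero]

theorem path_last (x y : Bits n) : path h θ s x y (4 * n + 8) = encString s y := by
  rw [encString_eq]; unfold path; rw [state_last]

variable (hs : ∀ x y, h x y = h y x) (hθ : 0 ≤ θ) (hcard : ∀ x, {y | h x y ≠ 0}.ncard ≤ s)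
include hs hθ hcard

theorem cube_path_succ {x y : Bits n} (e : Edge h θ x y) {p : ℕ} (hp : p < 4 * n + 8) :
    cube (path h θ s x y p) (path h θ s x y (p + 1)) = 1 := by
  apply cube_eq_one
  obtain ⟨q, hq, hu⟩ := existsUnique_state_ne (x := x) (y := y) (rank_lt hθ hcard e)
    (rank_lt hθ hcard (e.symm hs)) hp
  refine ⟨Site.equiv q, by simpa [path] using hq, fun k hk => ?_⟩
  rw [← hu (Site.equiv.symm k) hk, Equiv.apply_symm_apply]

/-- One end and its label determine the edge, as ranks are injective on the neighbours of a string.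
-/
theorem edge_eq_of_close {x y x' y' : Bits n} (e : Edge h θ x y) (e' : Edge h θ x' y') {p p' : ℕ}
    (hp : p ∈ Icc 1 (4 * n + 7)) (hp' : p' ∈ Icc 1 (4 * n + 7))
    (hc : Close (path h θ s x y p) (path h θ s x' y' p')) : x = x' ∧ y = y' := by
  rw [mem_Icc] at hp hp'
  rcases label_eq_of_close (rank_lt hθ hcard e) (rank_lt hθ hcard (e.symm hs))
    (rank_lt hθ hcard e') (rank_lt hθ hcard (e'.symm hs)) hp.1 hp.2 hp'.1 hp'.2
    (close_comp_equiv.mp hc) with ⟨h1, h2⟩ | ⟨h1, h2⟩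
  · subst h1; exact ⟨rfl, rank_injOn e e' h2⟩
  · subst h1; exact ⟨rank_injOn (e.symm hs) (e'.symm hs) h2, rfl⟩

theorem not_close_path {x y : Bits n} (e : Edge h θ x y) {p p' : ℕ} (hp : 1 ≤ p)
    (hpp : p + 2 ≤ p') (hp' : p' ≤ 4 * n + 7) :
    ¬ Close (path h θ s x y p) (path h θ s x y p') := fun hc =>
  not_close_state (rank_lt hθ hcard e) (rank_lt hθ hcard (e.symm hs)) hp hpp hp'
    (close_comp_equiv.mp hc)

/-- With `cube_enc_path` and `cube_enc_enc` this determines the subgraph that the hypercube induces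
on the codewords and paths: a subdivision of the interaction graph with two paths, one per
orientation, for each edge. -/
theorem cube_path_path {x y x' y' : Bits n} (e : Edge h θ x y) (e' : Edge h θ x' y') {p p' : ℕ}
    (hp : p ∈ Icc 1 (4 * n + 7)) (hp' : p' ∈ Icc 1 (4 * n + 7)) :
    cube (path h θ s x y p) (path h θ s x' y' p') =
      if (x' = x ∧ y' = y) ∧ (p' + 1 = p ∨ p' = p + 1) then 1 else 0 := by
  by_cases he : x' = x ∧ y' = y
  · obtain ⟨rfl, rfl⟩ := he
    rw [mem_Icc] at hp hp'
    rcases (by omega : p' + 1 = p ∨ p' = p + 1 ∨ p = p' ∨ p + 2 ≤ p' ∨ p' + 2 ≤ p) with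
      h1 | h1 | h1 | h1 | h1
    · subst h1
      rw [cube_comm, cube_path_succ hs hθ hcard e (by omega)]; simp
    · subst h1
      rw [cube_path_succ hs hθ hcard e (by omega)]; simp
    · subst h1
      rw [cube_self, if_neg]; omega
    · rw [cube_eq_zero (not_close_path hs hθ hcard e hp.1 h1 hp'.2), if_neg]; omega
    · rw [cube_comm, cube_eq_zero (not_close_path hs hθ hcard e hp'.1 h1 hp.2), if_neg]; omega
  · rw [if_neg fun h1 => he h1.1]
    apply cube_eq_zero
    intro hc
    obtain ⟨h1, h2⟩ := edge_eq_of_close hs hθ hcard e e' hp hp' hc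
    exact he ⟨h1.symm, h2.symm⟩

theorem cube_enc_path {v x y : Bits n} (e : Edge h θ x y) {p : ℕ}
    (hp : p ∈ Icc 1 (4 * n + 7)) :
    cube (encString s v) (path h θ s x y p) =
      if (p = 1 ∧ v = x) ∨ (p = 4 * n + 7 ∧ v = y) then 1 else 0 := by
  split_ifs with hv
  · rcases hv with ⟨rfl, rfl⟩ | ⟨rfl, rfl⟩
    · rw [← path_zero (h := h) (θ := θ) v y]
      exact cube_path_succ hs hθ hcard e (by omega)
    · rw [← path_last (h := h) (θ := θ) x v, cube_comm]
      exact cube_path_succ hs hθ hcard e (by omega)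
  · apply cube_eq_zero
    intro hc
    rw [encString_eq] at hc
    rw [mem_Icc] at hp
    exact hv (eq_of_close_base (rank_lt hθ hcard e) (rank_lt hθ hcard (e.symm hs)) hp.1 hp.2
      (close_comp_equiv.mp hc))

omit hs hθ hcard in
theorem cube_enc_enc (v w : Bits n) : cube (encString s v) (encString s w) = 0 := by
  by_cases hvw : v = w
  · rw [hvw, cube_self]
  · apply cube_eq_zero
    intro hc
    rw [encString_eq, encString_eq] at hc
    exact hvw (eq_of_close_base_base (close_comp_equiv.mp hc))

theorem path_ne_enc {v x y : Bits n} (e : Edge h θ x y) {p : ℕ} (hp : p ∈ Icc 1 (4 * n + 7)) :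
    encString s v ≠ path h θ s x y p := by
  intro heq
  have h1 := cube_enc_path hs hθ hcard (v := v) e hp
  have h2 : Close (encString s v) (path h θ s x y p) := by rw [heq]; exact fun _ _ _ => Or.inl rfl
  rw [← heq, cube_self] at h1
  rw [encString_eq] at h2
  rw [mem_Icc] at hp
  rw [if_pos (eq_of_close_base (rank_lt hθ hcard e) (rank_lt hθ hcard (e.symm hs)) hp.1 hp.2
      (close_comp_equiv.mp h2))] at h1
  norm_num at h1

theorem path_injective {x y x' y' : Bits n} (e : Edge h θ x y) (e' : Edge h θ x' y') {p p' : ℕ}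
    (hp : p ∈ Icc 1 (4 * n + 7)) (hp' : p' ∈ Icc 1 (4 * n + 7))
    (heq : path h θ s x y p = path h θ s x' y' p') : x' = x ∧ y' = y ∧ p' = p := by
  have h1 : Close (path h θ s x y p) (path h θ s x' y' p') := by
    rw [heq]; exact fun _ _ _ => Or.inl rfl
  obtain ⟨rfl, rfl⟩ := edge_eq_of_close hs hθ hcard e e' hp hp' h1
  have h2 := cube_path_path hs hθ hcard e e hp hp'
  refine ⟨rfl, rfl, ?_⟩
  rw [mem_Icc] at hp hp'
  rcases (by omega : p' + 1 = p ∨ p' = p + 1 ∨ p' = p ∨ p + 2 ≤ p' ∨ p' + 2 ≤ p) with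
    h3 | h3 | h3 | h3 | h3
  · rw [← heq, cube_self, if_pos ⟨⟨rfl, rfl⟩, by omega⟩] at h2; norm_num at h2
  · rw [← heq, cube_self, if_pos ⟨⟨rfl, rfl⟩, by omega⟩] at h2; norm_num at h2
  · exact h3
  · exact absurd h1 (not_close_path hs hθ hcard e hp.1 h3 hp'.2)
  · exact absurd (close_symm h1) (not_close_path hs hθ hcard e hp'.1 h3 hp.2)

theorem pathSum_path (f : Bits n → Bits n → ℕ → ℝ) {x y : Bits n} (e : Edge h θ x y) {p : ℕ}
    (hp : p ∈ Icc 1 (4 * n + 7)) : pathSum h θ f (path h θ s x y p) = f x y p := by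
  classical
  unfold pathSum
  rw [sum_eq_single x, sum_eq_single y, sum_eq_single p]
  · rw [if_pos ⟨e, rfl⟩]
  · intro p' hp' hne
    exact if_neg fun h1 => hne (path_injective hs hθ hcard e h1.1 hp hp' h1.2).2.2
  · exact fun h1 => absurd hp h1
  · intro y' _ hne
    refine sum_eq_zero fun p' hp' => if_neg fun h1 => hne ?_
    exact (path_injective hs hθ hcard e h1.1 hp hp' h1.2).2.1
  · simp
  · intro x' _ hne
    refine sum_eq_zero fun y' _ => sum_eq_zero fun p' hp' => if_neg fun h1 => hne ?_
    exact (path_injective hs hθ hcard e h1.1 hp hp' h1.2).1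
  · simp

omit hs hθ hcard in
theorem pathSum_of_not_onPath (f : Bits n → Bits n → ℕ → ℝ) {z : Bits (6 * n + 4 * s)}
    (hz : ¬ OnPath h θ z) : pathSum h θ f z = 0 :=
  sum_eq_zero fun x _ => sum_eq_zero fun y _ => sum_eq_zero fun p hp =>
    if_neg fun h1 => hz ⟨x, y, p, h1.1, hp, h1.2⟩

theorem not_onPath_enc (v : Bits n) : ¬ OnPath h θ (encString s v) := by
  rintro ⟨x, y, p, e, hp, hz⟩
  exact path_ne_enc hs hθ hcard e hp hz

theorem pathSum_enc (f : Bits n → Bits n → ℕ → ℝ) (v : Bits n) :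
    pathSum h θ f (encString s v) = 0 := pathSum_of_not_onPath f (not_onPath_enc hs hθ hcard v)

omit hs hθ hcard in
open Classical in
theorem sum_mul_pathSum (f : Bits n → Bits n → ℕ → ℝ) (g : Bits (6 * n + 4 * s) → ℝ) :
    ∑ z, g z * pathSum h θ f z = ∑ x, ∑ y, ∑ p ∈ Icc 1 (4 * n + 7),
      if Edge h θ x y then g (path h θ s x y p) * f x y p else 0 := by
  unfold pathSum
  simp only [mul_sum]
  rw [sum_comm]
  refine sum_congr rfl fun x _ => ?_
  rw [sum_comm]
  refine sum_congr rfl fun y _ => ?_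
  rw [sum_comm]
  refine sum_congr rfl fun p _ => ?_
  by_cases e : Edge h θ x y
  · simp [e]
  · simp [e]

/-- Only the neighbours on the same path contribute. Beyond the ends lie codewords, where `pathSum`
vanishes; hence the zeros at places 1 and 4n+7. -/
theorem sum_cube_pathSum_path (f : Bits n → Bits n → ℕ → ℝ) {x y : Bits n} (e : Edge h θ x y)
    {p : ℕ} (hp : p ∈ Icc 1 (4 * n + 7)) :
    ∑ z, cube (path h θ s x y p) z * pathSum h θ f z =
      (if p = 1 then 0 else f x y (p - 1)) + (if p = 4 * n + 7 then 0 else f x y (p + 1)) := by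
  classical
  rw [sum_mul_pathSum, sum_eq_single x, sum_eq_single y]
  · have h1 : ∀ p' ∈ Icc 1 (4 * n + 7),
        (if Edge h θ x y then cube (path h θ s x y p) (path h θ s x y p') * f x y p' else 0) =
          (if p' + 1 = p then f x y p' else 0) + (if p' = p + 1 then f x y p' else 0) := by
      intro p' hp'
      rw [if_pos e, cube_path_path hs hθ hcard e e hp hp']
      rcases (by omega : p' + 1 = p ∨ p' = p + 1 ∨ (p' + 1 ≠ p ∧ p' ≠ p + 1)) with h2 | h2 | h2
      · rw [if_pos ⟨⟨rfl, rfl⟩, Or.inl h2⟩, if_pos h2, if_neg (by omega)]; ring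
      · rw [if_pos ⟨⟨rfl, rfl⟩, Or.inr h2⟩, if_neg (by omega), if_pos h2]; ring
      · rw [if_neg (by omega), if_neg h2.1, if_neg h2.2]; ring
    rw [sum_congr rfl h1, sum_add_distrib]
    rw [mem_Icc] at hp
    congr 1
    · split_ifs with h2
      · refine sum_eq_zero fun p' hp' => if_neg ?_
        rw [mem_Icc] at hp'; omega
      · rw [sum_eq_single (p - 1), if_pos (by omega)]
        · intro p' _ hne; exact if_neg (by omega)
        · intro h3; rw [mem_Icc] at h3; omega
    · split_ifs with h2
      · refine sum_eq_zero fun p' hp' => if_neg ?_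
        rw [mem_Icc] at hp'; omega
      · rw [sum_eq_single (p + 1), if_pos rfl]
        · intro p' _ hne; exact if_neg (by omega)
        · intro h3; rw [mem_Icc] at h3; omega
  · intro y' _ hne
    refine sum_eq_zero fun p' hp' => ?_
    split_ifs with e'
    · rw [cube_path_path hs hθ hcard e e' hp hp', if_neg (fun h1 => hne h1.1.2), zero_mul]
    · rfl
  · simp
  · intro x' _ hne
    refine sum_eq_zero fun y' _ => sum_eq_zero fun p' hp' => ?_
    split_ifs with e'
    · rw [cube_path_path hs hθ hcard e e' hp hp', if_neg (fun h1 => hne h1.1.1), zero_mul]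
    · rfl
  · simp

open Classical in
-- An edge at v carries two paths that meet the codeword of v: one starts there, at place 1, and the
-- other ends there, at place 4n+7.
theorem sum_cube_pathSum_enc (f : Bits n → Bits n → ℕ → ℝ) (v : Bits n) :
    ∑ z, cube (encString s v) z * pathSum h θ f z =
      ∑ y, if Edge h θ v y then f v y 1 + f y v (4 * n + 7) else 0 := by
  rw [sum_mul_pathSum]
  have h1 : ∀ x y, (∑ p ∈ Icc 1 (4 * n + 7),
      if Edge h θ x y then cube (encString s v) (path h θ s x y p) * f x y p else 0) =
      (if x = v then (if Edge h θ v y then f v y 1 else 0) else 0) +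
      (if y = v then (if Edge h θ x v then f x v (4 * n + 7) else 0) else 0) := by
    intro x y
    by_cases e : Edge h θ x y
    · have h2 : ∀ p ∈ Icc 1 (4 * n + 7),
          (if Edge h θ x y then cube (encString s v) (path h θ s x y p) * f x y p else 0) =
          (if p = 1 then (if x = v then f x y 1 else 0) else 0) +
          (if p = 4 * n + 7 then (if y = v then f x y (4 * n + 7) else 0) else 0) := by
        intro p hp
        rw [if_pos e, cube_enc_path hs hθ hcard e hp]
        by_cases hp1 : p = 1
        · subst hp1
          simp [eq_comm]
        · by_cases hp2 : p = 4 * n + 7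
          · subst hp2; simp [eq_comm]
          · simp [hp1, hp2]
      rw [sum_congr rfl h2, sum_add_distrib, sum_ite_eq', sum_ite_eq',
        if_pos (mem_Icc.mpr ⟨le_rfl, by omega⟩), if_pos (mem_Icc.mpr ⟨by omega, le_rfl⟩)]
      congr 1
      · by_cases h3 : x = v
        · subst h3; simp only [if_true, if_pos e]
        · simp only [if_neg h3]
      · by_cases h3 : y = v
        · subst h3; simp only [if_true, if_pos e]
        · simp only [if_neg h3]
    · simp only [if_neg e, sum_const_zero]
      symm
      convert add_zero (0 : ℝ) using 2
      · split_ifs with h3 h4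
        · subst h3; exact absurd h4 e
        · rfl
        · rfl
      · split_ifs with h3 h4
        · subst h3; exact absurd h4 e
        · rfl
        · rfl
  simp only [h1, sum_add_distrib]
  have h2 : ∀ y, (if Edge h θ v y then f v y 1 + f y v (4 * n + 7) else 0) =
      (if Edge h θ v y then f v y 1 else 0) + (if Edge h θ y v then f y v (4 * n + 7) else 0) := by
    intro y
    rw [← edge_comm hs (x := v) (y := y)]
    split_ifs <;> simp
  simp only [h2, sum_add_distrib]
  congr 1
  · rw [sum_comm]
    refine sum_congr rfl fun y _ => ?_
    simp
  · refine sum_congr rfl fun y _ => ?_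
    simp

end Paths

end StoqTFD
end

noncomputable section
namespace StoqTFD
open Site Finset

/-! ### The energies -/

/-- The decay rate of the amplitudes away from the start of a path. -/
def slope (n : ℕ) (a b g : ℝ) : ℝ := (-(2 * a) * g⁻¹ - b) * (1 + (4 * n + 6) * b)⁻¹

/-- The energy at place `p` of the path of an edge with matrix element `g`. -/
def siteEnergy (n : ℕ) (a b g : ℝ) (p : ℕ) : ℝ :=
  if p = 1 then a * (1 + b) else if p = 4 * n + 7 then a * (1 + slope n a b g) else 2 * a

open Classical in
/-- The energy of an encoded string. -/
def codeEnergy {n : ℕ} (h : Bits n → Bits n → ℝ) (θ a b : ℝ) (x : Bits n) : ℝ :=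
  h x x + ∑ y, if Edge h θ x y then
    -h x y / 2 * (2 + (4 * n + 6) * (b + slope n a b (h x y))) else 0

/-- The diagonal part of the simulator. -/
def energy {n : ℕ} (s : ℕ) (h : Bits n → Bits n → ℝ) (θ a b Δ : ℝ) (z : Bits (6 * n + 4 * s)) : ℝ :=
  Δ + (∑ x, if z = encString s x then codeEnergy h θ a b x - Δ else 0) +
    pathSum h θ (fun x y p => siteEnergy n a b (h x y) p - Δ) z

/-- The relations between the parameters of the simulator. -/
structure Regime {n : ℕ} (s : ℕ) (h : Bits n → Bits n → ℝ) (θ M a b Δ : ℝ) : Prop where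
  symm : ∀ x y, h x y = h y x
  card : ∀ x, {y | h x y ≠ 0}.ncard ≤ s
  bound : ∀ x y, |h x y| ≤ M
  nonpos : ∀ x y, x ≠ y → h x y ≤ 0
  pos : 1 ≤ s
  θ_pos : 0 < θ
  one_le_M : 1 ≤ M
  one_le_b : 1 ≤ b
  a_eq : a = M * (4 * n + 7) * b ^ 2
  le_Δ : a + a * (6 * n + 4 * s) * (1 + (6 * n + 4 * s) * (4 * n + 7) ^ 2) ≤ Δ

section Slope

variable {n : ℕ} {M a b g : ℝ} (hM : 1 ≤ M) (hb : 1 ≤ b) (ha : a = M * (4 * n + 7) * b ^ 2)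
  (hg : 0 < -g) (hgM : -g ≤ M)
include hM hb ha hg

/-- The matching condition between a unit amplitude on a codeword and the profile at the adjacent
path vertex. It is symmetric in b and the slope, so one slope serves both ends. For fixed b it is
linear in the slope, which is therefore a rational function of g and within reach of the arithmetic
gates; equal slopes would require solving a quadratic equation. -/
theorem slope_relation :
    -g / (2 * a) * (b + slope n a b g + (4 * n + 6) * b * slope n a b g) = 1 := by
  have ha0 : 0 < a := by rw [ha]; positivity
  have hc : 0 < 1 + (4 * (n : ℝ) + 6) * b := by positivity
  have hg0 : g ≠ 0 := by rintro rfl; simp at hg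
  unfold slope
  field_simp
  ring

include hgM

omit hg in
theorem omega_le : 2 * (4 * n + 7) * b ^ 2 * (-g / (2 * a)) ≤ 1 := by
  have ha0 : 0 < a := by rw [ha]; positivity
  rw [← mul_div_assoc, div_le_one (by positivity)]
  have : 2 * a = 2 * (4 * n + 7) * b ^ 2 * M := by rw [ha]; ring
  rw [this]
  gcongr

/-- Otherwise the left side of `slope_relation` would be below the quantity that `omega_le` bounds
by 1. It follows that no energy on a path is below 2a. -/
theorem le_slope : b ≤ slope n a b g := by
  have ha0 : 0 < a := by rw [ha]; positivity
  have h1 := slope_relation hM hb ha hg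
  have h2 := omega_le hM hb ha hgM
  set ω := -g / (2 * a) with hω
  have hω0 : 0 < ω := by positivity
  set d := slope n a b g
  have hn : (0 : ℝ) ≤ n := n.cast_nonneg
  by_contra! hlt
  have h3 : b + d + (4 * n + 6) * b * d < b + b + (4 * n + 6) * b * b := by
    have : (4 * (n : ℝ) + 6) * b * d ≤ (4 * n + 6) * b * b := by gcongr
    linarith
  have h4 : b + b + (4 * n + 6) * b * b ≤ 2 * (4 * n + 7) * b ^ 2 := by nlinarith
  have h5 : ω * (b + d + (4 * n + 6) * b * d) < ω * (2 * (4 * n + 7) * b ^ 2) :=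
    mul_lt_mul_of_pos_left (h3.trans_le h4) hω0
  linarith

theorem omega_mul_slope_le : -g / (2 * a) * ((4 * n + 6) * b * slope n a b g) ≤ 1 := by
  have ha0 : 0 < a := by rw [ha]; positivity
  have h1 := slope_relation hM hb ha hg
  have h3 := le_slope hM hb ha hg hgM
  set ω := -g / (2 * a) with hω
  have hω0 : 0 < ω := by positivity
  have : 0 ≤ ω * (b + slope n a b g) := mul_nonneg hω0.le (by linarith)
  nlinarith

theorem amplitude_in_le : -g / (2 * a) * (1 + (4 * n + 7) * b) ≤ 3 / b := by
  have h2 := omega_le hM hb ha hgM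
  have ha0 : 0 < a := by rw [ha]; positivity
  set ω := -g / (2 * a) with hω
  have hω0 : 0 < ω := by positivity
  have hn : (0 : ℝ) ≤ n := n.cast_nonneg
  rw [le_div_iff₀ (by linarith)]
  have h3 : (1 + (4 * n + 7) * b) * b ≤ 2 * (4 * n + 7) * b ^ 2 := by nlinarith
  have h4 : ω * ((1 + (4 * n + 7) * b) * b) ≤ ω * (2 * (4 * n + 7) * b ^ 2) := by gcongr
  linarith

/-- The slope is unbounded as g tends to zero, but the matching condition bounds the product of ω,
(4n+6)b and the slope by 1, whatever g is. -/
theorem amplitude_out_le : -g / (2 * a) * (1 + (4 * n + 7) * slope n a b g) ≤ 3 / b := by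
  have h2 := omega_le hM hb ha hgM
  have h1 := omega_mul_slope_le hM hb ha hg hgM
  have h3 := le_slope hM hb ha hg hgM
  have ha0 : 0 < a := by rw [ha]; positivity
  set ω := -g / (2 * a) with hω
  have hω0 : 0 < ω := by positivity
  set d := slope n a b g
  have hn : (0 : ℝ) ≤ n := n.cast_nonneg
  rw [le_div_iff₀ (by linarith)]
  have h4 : b ≤ 2 * (4 * n + 7) * b ^ 2 := by nlinarith
  have h5 : ω * b ≤ ω * (2 * (4 * n + 7) * b ^ 2) := by gcongr
  have h6 : ω * ((4 * n + 7) * d * b) ≤ ω * (2 * ((4 * n + 6) * b * d)) := by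
    have : 0 ≤ b * d := by nlinarith
    refine mul_le_mul_of_nonneg_left ?_ hω0.le
    nlinarith [mul_nonneg hn this]
  nlinarith

/-- The purpose of the cutoff: the energy at the last place of a path grows like the inverse of the
matrix element. -/
theorem slope_le {θ : ℝ} (hθ : 0 < θ) (hθg : θ ≤ -g) : slope n a b g ≤ 2 * a / θ := by
  have h1 := slope_relation hM hb ha hg
  have h3 := le_slope hM hb ha hg hgM
  have ha0 : 0 < a := by rw [ha]; positivity
  have h4 : 2 * a / -g ≤ 2 * a / θ := by gcongr
  refine le_trans ?_ h4
  rw [le_div_iff₀ hg]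
  set d := slope n a b g
  have hn : (0 : ℝ) ≤ n := n.cast_nonneg
  rw [div_mul_eq_mul_div, div_eq_one_iff_eq (by positivity)] at h1
  rw [← h1, mul_comm]
  have hd : 0 ≤ d := by linarith
  have : 0 ≤ (4 * n + 6) * b * d := by positivity
  gcongr
  linarith

theorem code_term_le :
    -g / 2 * (2 + (4 * n + 6) * (b + slope n a b g)) ≤ M * (1 + (4 * n + 7) * b) + a := by
  have h1 := omega_mul_slope_le hM hb ha hg hgM
  have h3 := le_slope hM hb ha hg hgM
  have ha0 : 0 < a := by rw [ha]; positivity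
  have hn : (0 : ℝ) ≤ n := n.cast_nonneg
  set d := slope n a b g
  have h4 : -g / 2 = a * (-g / (2 * a)) := by field_simp
  have h5 : -g / 2 * ((4 * n + 6) * d) ≤ a := by
    rw [h4, mul_assoc]
    refine mul_le_of_le_one_right ha0.le (le_trans ?_ h1)
    gcongr
    · linarith
    · exact le_mul_of_one_le_right (by positivity) hb
  have h6 : -g / 2 * (2 + (4 * n + 6) * b) ≤ M / 2 * (2 + (4 * n + 6) * b) := by gcongr
  have h7 : M / 2 * (2 + (4 * n + 6) * b) ≤ M * (1 + (4 * n + 7) * b) := by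
    have : 0 ≤ (n : ℝ) * b := by positivity
    nlinarith
  linarith

end Slope

/-! ### Schur bounds -/

/-- A common bound on the absolute row sums and column sums. -/
def SchurLe {I J : Type*} [Fintype I] [Fintype J] (A : Matrix I J ℝ) (r : ℝ) : Prop :=
  (∀ i, ∑ j, |A i j| ≤ r) ∧ ∀ j, ∑ i, |A i j| ≤ r

/-- The continuous linear map of a real rectangular matrix. -/
def realCLM {I J : Type*} [Fintype I] [Fintype J] [DecidableEq J] (A : Matrix I J ℝ) :
    EuclideanSpace ℂ J →L[ℂ] EuclideanSpace ℂ I := matCLM (A.map Complex.ofRealHom)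

section Schur

variable {I J L : Type*} [Fintype I] [Fintype J] [Fintype L]

theorem SchurLe.norm_le [DecidableEq J] {A : Matrix I J ℝ} {r : ℝ} (hr : 0 ≤ r)
    (h : SchurLe A r) : ‖realCLM A‖ ≤ r :=
  norm_matCLM_le _ hr (fun i => by simpa using h.1 i) (fun j => by simpa using h.2 j)

theorem SchurLe.add {A B : Matrix I J ℝ} {r r' : ℝ} (h : SchurLe A r) (h' : SchurLe B r') :
    SchurLe (A + B) (r + r') := by
  constructor
  · intro i
    refine (sum_le_sum fun j _ => abs_add_le (A i j) (B i j)).trans ?_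
    rw [sum_add_distrib]; exact add_le_add (h.1 i) (h'.1 i)
  · intro j
    refine (sum_le_sum fun i _ => abs_add_le (A i j) (B i j)).trans ?_
    rw [sum_add_distrib]; exact add_le_add (h.2 j) (h'.2 j)

theorem SchurLe.of_abs_le {A B : Matrix I J ℝ} {r : ℝ} (h : SchurLe B r)
    (hAB : ∀ i j, |A i j| ≤ |B i j|) : SchurLe A r :=
  ⟨fun i => (sum_le_sum fun j _ => hAB i j).trans (h.1 i),
    fun j => (sum_le_sum fun i _ => hAB i j).trans (h.2 j)⟩

theorem SchurLe.mono {A : Matrix I J ℝ} {r r' : ℝ} (h : SchurLe A r) (hr : r ≤ r') :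
    SchurLe A r' := ⟨fun i => (h.1 i).trans hr, fun j => (h.2 j).trans hr⟩

theorem SchurLe.smul {A : Matrix I J ℝ} {r c : ℝ} (h : SchurLe A r) (hc : 0 ≤ c) :
    SchurLe (c • A) (c * r) := by
  constructor
  · intro i
    simp only [Matrix.smul_apply, smul_eq_mul, abs_mul, ← mul_sum, abs_of_nonneg hc]
    gcongr; exact h.1 i
  · intro j
    simp only [Matrix.smul_apply, smul_eq_mul, abs_mul, ← mul_sum, abs_of_nonneg hc]
    gcongr; exact h.2 j

theorem SchurLe.mul {A : Matrix I J ℝ} {B : Matrix J L ℝ} {r r' : ℝ} (hr : 0 ≤ r) (hr' : 0 ≤ r')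
    (h : SchurLe A r) (h' : SchurLe B r') : SchurLe (A * B) (r * r') := by
  have h0 : ∀ i l, |(A * B) i l| ≤ ∑ j, |A i j| * |B j l| := fun i l => by
    rw [Matrix.mul_apply]
    exact (abs_sum_le_sum_abs _ _).trans (le_of_eq (by simp only [abs_mul]))
  constructor
  · intro i
    calc ∑ l, |(A * B) i l| ≤ ∑ l, ∑ j, |A i j| * |B j l| := sum_le_sum fun l _ => h0 i l
      _ = ∑ j, |A i j| * ∑ l, |B j l| := by rw [sum_comm]; simp only [mul_sum]
      _ ≤ ∑ j, |A i j| * r' := by gcongr with j; exact h'.1 j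
      _ = (∑ j, |A i j|) * r' := by rw [sum_mul]
      _ ≤ r * r' := by gcongr; exact h.1 i
  · intro l
    calc ∑ i, |(A * B) i l| ≤ ∑ i, ∑ j, |A i j| * |B j l| := sum_le_sum fun i _ => h0 i l
      _ = ∑ j, (∑ i, |A i j|) * |B j l| := by rw [sum_comm]; simp only [sum_mul]
      _ ≤ ∑ j, r * |B j l| := by gcongr with j; exact h.2 j
      _ = r * ∑ j, |B j l| := by rw [mul_sum]
      _ ≤ r * r' := by gcongr; exact h'.2 l

theorem realCLM_mul [DecidableEq J] [DecidableEq L] (A : Matrix I J ℝ) (B : Matrix J L ℝ) :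
    realCLM (A * B) = (realCLM A).comp (realCLM B) := by
  unfold realCLM
  rw [Matrix.map_mul, matCLM_mul]

theorem realCLM_sub [DecidableEq J] (A B : Matrix I J ℝ) :
    realCLM (A - B) = realCLM A - realCLM B := by
  unfold realCLM
  rw [← matCLM_sub]
  congr 1
  ext i j
  simp

end Schur

/-- The adjacency matrix of the hypercube, as a matrix. -/
def cubeMatrix (m : ℕ) : Matrix (Bits m) (Bits m) ℝ := Matrix.of cube

theorem schurLe_cube (m : ℕ) : SchurLe (cubeMatrix m) m := by
  have h1 : ∀ x : Bits m, ∑ y, |cube x y| = m := fun x => by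
    rw [← sum_cube x]
    exact sum_congr rfl fun y _ => abs_of_nonneg (cube_nonneg x y)
  refine ⟨fun x => (h1 x).le, fun y => le_trans (le_of_eq ?_) (h1 y).le⟩
  exact sum_congr rfl fun x _ => by rw [cubeMatrix, Matrix.of_apply, cube_comm]

end StoqTFD
end

noncomputable section
namespace StoqTFD
open Site Finset

/-! ### The approximate eigenspace -/

/-- The copy encoding as a real matrix. -/
def encReal (n s : ℕ) : Matrix (Bits (6 * n + 4 * s)) (Bits n) ℝ :=
  Matrix.of fun z x => if z = encString s x then 1 else 0

section Simulator

variable {n : ℕ} (s : ℕ) (h : Bits n → Bits n → ℝ) (θ a b Δ : ℝ)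

/-- The amplitude of the image of `v` at place `p` of the path from `x` to `y`. -/
def amplitude (v x y : Bits n) (p : ℕ) : ℝ :=
  (if v = x then -h x y / (2 * a) * (1 + (4 * n + 7 - p) * slope n a b (h x y)) else 0) +
  (if v = y then -h x y / (2 * a) * (1 + (p - 1) * b) else 0)

/-- The amplitudes of the images of the basis states on the paths. -/
def pathMatrix : Matrix (Bits (6 * n + 4 * s)) (Bits n) ℝ :=
  Matrix.of fun z v => pathSum h θ (amplitude h a b v) z

/-- The copy encoding, dressed with the amplitudes on the paths. -/
def dressed : Matrix (Bits (6 * n + 4 * s)) (Bits n) ℝ := encReal n s + pathMatrix s h θ a b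

open Classical in
/-- The projection on the strings which are neither encoded strings nor on a path, applied to the
image under the transverse field of a dressed encoding. -/
def leakMatrix : Matrix (Bits (6 * n + 4 * s)) (Bits n) ℝ :=
  Matrix.of fun z v => if Good h θ z then 0 else
    a / Δ * (cubeMatrix (6 * n + 4 * s) * dressed s h θ a b) z v

open Classical in
/-- The matrix elements which the paths generate. -/
def effective : Matrix (Bits n) (Bits n) ℝ :=
  Matrix.of fun x v => if x = v then h x x else if Edge h θ x v then h x v else 0

variable {s h θ a b Δ} {M : ℝ} (R : Regime s h θ M a b Δ)
include R

theorem Regime.a_pos : 0 < a := by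
  have h1 := R.one_le_M
  have h2 := R.one_le_b
  rw [R.a_eq]; positivity

theorem Regime.Δ_pos : 0 < Δ := by
  have h1 := R.a_pos
  have h2 : 0 ≤ a * (6 * n + 4 * s) * (1 + (6 * n + 4 * s) * (4 * (n : ℝ) + 7) ^ 2) := by positivity
  linarith [R.le_Δ]

theorem Regime.neg_le {x y : Bits n} : -h x y ≤ M := (neg_le_abs _).trans (R.bound x y)

theorem Regime.neg_pos {x y : Bits n} (e : Edge h θ x y) : 0 < -h x y := R.θ_pos.trans e.2

theorem Regime.relation {x y : Bits n} (e : Edge h θ x y) :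
    -h x y / (2 * a) * (b + slope n a b (h x y) + (4 * n + 6) * b * slope n a b (h x y)) = 1 :=
  slope_relation R.one_le_M R.one_le_b R.a_eq (R.neg_pos e)

theorem Regime.b_le_slope {x y : Bits n} (e : Edge h θ x y) : b ≤ slope n a b (h x y) :=
  le_slope R.one_le_M R.one_le_b R.a_eq (R.neg_pos e) R.neg_le

omit R in
open Classical in
theorem sum_encString_ite (f : Bits n → ℝ) (x : Bits n) :
    (∑ y, if encString s x = encString s y then f y else 0) = f x := by
  simp [(encString_injective s).eq_iff]

theorem energy_enc (x : Bits n) : energy s h θ a b Δ (encString s x) = codeEnergy h θ a b x := by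
  unfold energy
  rw [pathSum_enc R.symm R.θ_pos.le R.card, sum_encString_ite]
  ring

theorem energy_path {x y : Bits n} (e : Edge h θ x y) {p : ℕ} (hp : p ∈ Icc 1 (4 * n + 7)) :
    energy s h θ a b Δ (path h θ s x y p) = siteEnergy n a b (h x y) p := by
  unfold energy
  rw [pathSum_path R.symm R.θ_pos.le R.card _ e hp, sum_eq_zero]
  · ring
  · intro v _
    exact if_neg (path_ne_enc R.symm R.θ_pos.le R.card e hp).symm

omit R in
theorem energy_bad {z : Bits (6 * n + 4 * s)} (hz : ¬ Good h θ z) :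
    energy s h θ a b Δ z = Δ := by
  unfold energy
  rw [pathSum_of_not_onPath _ fun h1 => hz (Or.inr h1), sum_eq_zero]
  · ring
  · intro v _
    exact if_neg fun h1 => hz (Or.inl ⟨v, h1⟩)

omit R in
theorem cube_mul_apply (z : Bits (6 * n + 4 * s)) (v : Bits n) :
    (cubeMatrix (6 * n + 4 * s) * dressed s h θ a b) z v =
      cube z (encString s v) + ∑ z', cube z z' * pathSum h θ (amplitude h a b v) z' := by
  rw [Matrix.mul_apply]
  simp only [cubeMatrix, dressed, encReal, pathMatrix, Matrix.of_apply, Matrix.add_apply, mul_add,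
    sum_add_distrib]
  simp

/-- The dressed encoding solves the eigenvalue equation on the paths. -/
theorem path_equation (v : Bits n) {x y : Bits n} (e : Edge h θ x y) {p : ℕ}
    (hp : p ∈ Icc 1 (4 * n + 7)) :
    siteEnergy n a b (h x y) p * amplitude h a b v x y p =
      a * (cubeMatrix (6 * n + 4 * s) * dressed s h θ a b)
        (path h θ s x y p) v := by
  have hrel := R.relation e
  rw [cube_mul_apply, sum_cube_pathSum_path R.symm R.θ_pos.le R.card _ e hp, cube_comm,
    cube_enc_path R.symm R.θ_pos.le R.card e hp]
  have hxy := e.1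
  set ω := -h x y / (2 * a) with hω
  set d := slope n a b (h x y) with hd
  rw [mem_Icc] at hp
  unfold siteEnergy amplitude
  rw [← hd, ← hω]
  by_cases hp1 : p = 1
  · subst hp1
    have h2 : ¬ (1 = 4 * n + 7) := by omega
    simp only [if_true, h2, if_false, true_and, false_and, or_false]
    by_cases hvx : v = x
    · have hvy : v ≠ y := by rw [hvx]; exact hxy
      simp only [hvx, hxy, if_true, if_false]
      push_cast
      -- The codeword next to place 1 enters with amplitude 1, the right side of the matching
      -- condition.
      linear_combination a * hrel
    · by_cases hvy : v = y
      · simp only [hvy, Ne.symm hxy, if_true, if_false]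
        push_cast
        ring
      · simp [hvx, hvy]
  · by_cases hp2 : p = 4 * n + 7
    · subst hp2
      simp only [hp1, if_true, if_false, true_and, false_and, false_or]
      have hc : ((4 * n + 7 - 1 : ℕ) : ℝ) = 4 * n + 6 := by
        rw [show 4 * n + 7 - 1 = 4 * n + 6 by omega]; push_cast; ring
      rw [hc]
      by_cases hvx : v = x
      · simp only [hvx, hxy, if_true, if_false]
        push_cast
        ring
      · by_cases hvy : v = y
        · simp only [hvy, Ne.symm hxy, if_true, if_false]
          push_cast
          linear_combination a * hrel
        · simp [hvx, hvy]
    · have hc : ((p - 1 : ℕ) : ℝ) = p - 1 := by rw [Nat.cast_sub hp.1]; simp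
      simp only [hp1, hp2, if_false, false_and, false_or]
      rw [hc]
      push_cast
      -- An affine profile has zero second difference.
      split_ifs <;> ring

/-- The dressed encoding generates the effective Hamiltonian on the encoded strings. -/
theorem code_equation (x v : Bits n) :
    (if x = v then codeEnergy h θ a b x else 0) -
      a * (cubeMatrix (6 * n + 4 * s) * dressed s h θ a b) (encString s x) v =
      effective h θ x v := by
  classical
  rw [cube_mul_apply, cube_enc_enc, zero_add, sum_cube_pathSum_enc R.symm R.θ_pos.le R.card]
  have ha0 := R.a_pos
  unfold effective
  rw [Matrix.of_apply]
  by_cases hxv : x = v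
  · subst hxv
    simp only [if_true]
    unfold codeEnergy
    -- The near ends of both paths of each edge return amplitude to x; each summand of `codeEnergy`
    -- cancels this return.
    rw [mul_sum, add_sub_assoc, ← sum_sub_distrib, sum_eq_zero, add_zero]
    intro y _
    split_ifs with e
    · unfold amplitude
      rw [R.symm y x]
      simp only [if_true, if_neg e.1]
      push_cast
      field_simp
      ring
    · simp
  · simp only [if_neg hxv]
    rw [sum_eq_single v]
    -- The far ends of the paths (x, v) and (v, x) carry -h x v / (2a) each.
    · by_cases e : Edge h θ x v
      · simp only [if_pos e]
        unfold amplitude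
        rw [R.symm v x]
        simp only [if_true, if_neg (Ne.symm hxv)]
        push_cast
        field_simp
        ring
      · simp [e]
    · intro y _ hy
      unfold amplitude
      simp [Ne.symm hxv, Ne.symm hy]
    · simp

/-- The simulator, as a real matrix. -/
def simReal (s : ℕ) (h : Bits n → Bits n → ℝ) (θ a b Δ : ℝ) :
    Matrix (Bits (6 * n + 4 * s)) (Bits (6 * n + 4 * s)) ℝ :=
  Matrix.of (tfdEntry a (energy s h θ a b Δ))

omit R in
theorem simReal_mul_apply (A : Matrix (Bits (6 * n + 4 * s)) (Bits n) ℝ)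
    (z : Bits (6 * n + 4 * s)) (v : Bits n) :
    (simReal s h θ a b Δ * A) z v =
      energy s h θ a b Δ z * A z v - a * (cubeMatrix (6 * n + 4 * s) * A) z v := by
  rw [Matrix.mul_apply, Matrix.mul_apply]
  exact sum_tfdEntry_mul a _ z fun z' => A z' v

omit R in
theorem encReal_mul_apply (A : Matrix (Bits n) (Bits n) ℝ) (z : Bits (6 * n + 4 * s))
    (v : Bits n) : (encReal n s * A) z v = ∑ x, if z = encString s x then A x v else 0 := by
  rw [Matrix.mul_apply]
  simp [encReal]

/-- On the codewords and paths the dressed encoding solves the equation exactly. Elsewhere Δ times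
the leak cancels the field acting on the dressed encoding, so the residue is one further action of
the field, on the leak alone. -/
theorem simReal_mul_dressed :
    simReal s h θ a b Δ * (dressed s h θ a b + leakMatrix s h θ a b Δ) -
      encReal n s * effective h θ =
      -(a • (cubeMatrix (6 * n + 4 * s) * leakMatrix s h θ a b Δ)) := by
  classical
  ext z v
  rw [Matrix.mul_add, Matrix.sub_apply, Matrix.add_apply, simReal_mul_apply, simReal_mul_apply,
    encReal_mul_apply, Matrix.neg_apply, Matrix.smul_apply, smul_eq_mul]
  have key : energy s h θ a b Δ z * (dressed s h θ a b) z v -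
      a * (cubeMatrix (6 * n + 4 * s) * dressed s h θ a b) z v +
      energy s h θ a b Δ z * leakMatrix s h θ a b Δ z v =
      ∑ x, if z = encString s x then effective h θ x v else 0 := by
    by_cases hz : Good h θ z
    · have hleak : leakMatrix s h θ a b Δ z v = 0 := by simp [leakMatrix, hz]
      rw [hleak, mul_zero, add_zero]
      rcases hz with ⟨x, rfl⟩ | ⟨x, y, p, e, hp, rfl⟩
      · have h1 : dressed s h θ a b (encString s x) v =
            if x = v then 1 else 0 := by
          simp [dressed, encReal, pathMatrix, pathSum_enc R.symm R.θ_pos.le R.card,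
            (encString_injective s).eq_iff]
        rw [h1, energy_enc R, sum_encString_ite, ← code_equation R]
        split_ifs <;> simp
      · have h1 : dressed s h θ a b (path h θ s x y p) v =
            amplitude h a b v x y p := by
          simp only [dressed, encReal, pathMatrix, Matrix.add_apply, Matrix.of_apply]
          rw [pathSum_path R.symm R.θ_pos.le R.card _ e hp,
            if_neg (path_ne_enc R.symm R.θ_pos.le R.card e hp).symm, zero_add]
        rw [h1, energy_path R e hp, path_equation R v e hp, sub_self, sum_eq_zero]
        intro w _
        exact if_neg (path_ne_enc R.symm R.θ_pos.le R.card e hp).symm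
    · have h1 : (dressed s h θ a b) z v = 0 := by
        simp only [dressed, encReal, pathMatrix, Matrix.add_apply, Matrix.of_apply]
        rw [pathSum_of_not_onPath _ fun h1 => hz (Or.inr h1),
          if_neg fun h1 => hz (Or.inl ⟨v, h1⟩), zero_add]
      have h2 : leakMatrix s h θ a b Δ z v =
          a / Δ * (cubeMatrix (6 * n + 4 * s) * dressed s h θ a b) z v := by
        simp [leakMatrix, hz]
      rw [h1, h2, energy_bad hz, sum_eq_zero]
      · have := R.Δ_pos.ne'
        field_simp
        ring
      · intro w _
        exact if_neg fun h1 => hz (Or.inl ⟨w, h1⟩)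
  linarith

/-! ### Bounds -/

theorem amplitude_bounds {v x y : Bits n} (e : Edge h θ x y) {p : ℕ}
    (hp : p ∈ Icc 1 (4 * n + 7)) :
    |amplitude h a b v x y p| ≤ (if v = x then 3 / b else 0) + (if v = y then 3 / b else 0) := by
  rw [mem_Icc] at hp
  have hb := R.one_le_b
  have ha := R.a_pos
  have hω : 0 < -h x y / (2 * a) := div_pos (R.neg_pos e) (by linarith)
  have hd := R.b_le_slope e
  have h1 := amplitude_in_le R.one_le_M R.one_le_b R.a_eq (R.neg_pos e) R.neg_le
  have h2 := amplitude_out_le R.one_le_M R.one_le_b R.a_eq (R.neg_pos e) R.neg_le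
  have hp1 : (1 : ℝ) ≤ p := by exact_mod_cast hp.1
  have hp2 : (p : ℝ) ≤ 4 * n + 7 := by exact_mod_cast hp.2
  have hn : (0 : ℝ) ≤ n := n.cast_nonneg
  unfold amplitude
  refine (abs_add_le _ _).trans (add_le_add ?_ ?_)
  · split_ifs
    · rw [abs_of_nonneg]
      · refine le_trans ?_ h2
        gcongr
        · linarith
        · linarith
      · have : 0 ≤ (4 * (n : ℝ) + 7 - p) * slope n a b (h x y) :=
          mul_nonneg (by linarith) (by linarith)
        positivity
    · simp
  · split_ifs
    · rw [abs_of_nonneg]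
      · refine le_trans ?_ h1
        gcongr
        linarith
      · have : 0 ≤ ((p : ℝ) - 1) * b := mul_nonneg (by linarith) (by linarith)
        positivity
    · simp

/-- A path vertex is reached from only the two ends of its edge, and a codeword is an end of at most
2s paths with 4n+7 vertices each; every amplitude is at most 3/b. -/
theorem schurLe_path : SchurLe (pathMatrix s h θ a b) (6 * s * (4 * n + 7) / b) := by
  classical
  have hb := R.one_le_b
  have hs1 : (1 : ℝ) ≤ s := by exact_mod_cast R.pos
  have hn : (0 : ℝ) ≤ n := n.cast_nonneg
  constructor
  · intro z
    simp only [pathMatrix, Matrix.of_apply]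
    by_cases hz : OnPath h θ z
    · obtain ⟨x, y, p, e, hp, rfl⟩ := hz
      have h1 : ∀ v, |pathSum h θ (amplitude h a b v) (path h θ s x y p)| ≤
          (if v = x then 3 / b else 0) + (if v = y then 3 / b else 0) := fun v => by
        rw [pathSum_path R.symm R.θ_pos.le R.card _ e hp]
        exact amplitude_bounds R e hp
      refine (sum_le_sum fun v _ => h1 v).trans ?_
      rw [sum_add_distrib, sum_ite_eq', sum_ite_eq', if_pos (mem_univ _), if_pos (mem_univ _),
        ← add_div]
      gcongr
      nlinarith
    · simp only [pathSum_of_not_onPath _ hz, abs_zero, sum_const_zero]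
      positivity
  · intro v
    simp only [pathMatrix, Matrix.of_apply]
    have h1 : ∀ z : Bits (6 * n + 4 * s), |pathSum h θ (amplitude h a b v) z| ≤
        -- The factor 1 puts the sum over z in the form of `sum_mul_pathSum`.
        1 * pathSum h θ (fun x y _ => (if v = x then 3 / b else 0) + (if v = y then 3 / b else 0))
          z := by
      intro z
      rw [one_mul]
      by_cases hz : OnPath h θ z
      · obtain ⟨x, y, p, e, hp, rfl⟩ := hz
        rw [pathSum_path R.symm R.θ_pos.le R.card _ e hp,
          pathSum_path R.symm R.θ_pos.le R.card _ e hp]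
        exact amplitude_bounds R e hp
      · rw [pathSum_of_not_onPath _ hz, pathSum_of_not_onPath _ hz, abs_zero]
    refine (sum_le_sum fun z _ => h1 z).trans ?_
    rw [sum_mul_pathSum]
    have h2 : ∀ x y, (∑ p ∈ Icc 1 (4 * n + 7), if Edge h θ x y then
        1 * ((if v = x then 3 / b else 0) + (if v = y then 3 / b else 0)) else 0) =
        (if v = x then (if Edge h θ v y then (4 * n + 7) * (3 / b) else 0) else 0) +
        (if v = y then (if Edge h θ v x then (4 * n + 7) * (3 / b) else 0) else 0) := by
      intro x y
      rw [sum_const, Nat.card_Icc, nsmul_eq_mul]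
      push_cast
      by_cases hvx : v = x
      · subst hvx
        by_cases e : Edge h θ v y
        · simp [e, e.1]
        · simp only [if_neg e, if_true]
          by_cases hvy : v = y
          · subst hvy; simp [e]
          · simp [hvy]
      · by_cases hvy : v = y
        · subst hvy
          rw [edge_comm R.symm]
          by_cases e : Edge h θ v x
          · simp [e, e.1]
          · simp [e, hvx]
        · simp [hvx, hvy]
    simp only [h2, sum_add_distrib]
    have h3 : (∑ y, if Edge h θ v y then (4 * (n : ℝ) + 7) * (3 / b) else 0) ≤
        s * ((4 * n + 7) * (3 / b)) := by
      rw [← sum_filter, sum_const, nsmul_eq_mul]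
      gcongr
      exact card_edges_le R.θ_pos.le R.card v
    have h4 : (∑ x, ∑ y, if v = x then
        (if Edge h θ v y then (4 * (n : ℝ) + 7) * (3 / b) else 0) else 0) =
        ∑ y, if Edge h θ v y then (4 * (n : ℝ) + 7) * (3 / b) else 0 := by
      rw [sum_comm]; simp
    have h5 : (∑ x, ∑ y, if v = y then
        (if Edge h θ v x then (4 * (n : ℝ) + 7) * (3 / b) else 0) else 0) =
        ∑ y, if Edge h θ v y then (4 * (n : ℝ) + 7) * (3 / b) else 0 := by
      simp
    rw [h4, h5]
    refine (add_le_add h3 h3).trans (le_of_eq ?_)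
    field_simp
    ring

omit R in
theorem schurLe_enc : SchurLe (encReal n s) 1 := by
  constructor
  · intro z
    simp only [encReal, Matrix.of_apply]
    by_cases hz : ∃ x, z = encString s x
    · obtain ⟨x, rfl⟩ := hz
      simp [(encString_injective s).eq_iff, apply_ite abs]
    · simp only [not_exists] at hz
      simp [hz]
  · intro v
    simp [encReal, apply_ite abs]

theorem schurLe_leak {r : ℝ} (hr : 0 ≤ r)
    (hA : SchurLe (dressed s h θ a b) r) :
    SchurLe (leakMatrix s h θ a b Δ) (a / Δ * ((6 * n + 4 * s) * r)) := by
  classical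
  have h1 : SchurLe ((a / Δ) • (cubeMatrix (6 * n + 4 * s) *
      dressed s h θ a b)) (a / Δ * (((6 * n + 4 * s : ℕ) : ℝ) * r)) :=
    ((schurLe_cube _).mul (by positivity) hr hA).smul (div_nonneg R.a_pos.le R.Δ_pos.le)
  push_cast at h1
  refine h1.of_abs_le fun z v => ?_
  unfold leakMatrix
  rw [Matrix.of_apply]
  split_ifs
  · rw [abs_zero]; exact abs_nonneg _
  · rfl

/-- A row has at most s nonzero entries. As off-diagonal entries are nonpositive, those that fail
the one-sided test in `Edge` have modulus at most θ. -/
theorem schurLe_effective_sub :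
    SchurLe (effective h θ - Matrix.of h) (s * θ) := by
  classical
  have hrow : ∀ x, ∑ v, |(effective h θ - Matrix.of h) x v| ≤ s * θ := by
    intro x
    have h1 : ∀ v, |(effective h θ - Matrix.of h) x v| ≤ if h x v ≠ 0 then θ else 0 := by
      intro v
      simp only [Matrix.sub_apply, effective, Matrix.of_apply]
      by_cases hxv : x = v
      · subst hxv
        simp only [if_true, sub_self, abs_zero]
        split_ifs
        · exact R.θ_pos.le
        · rfl
      · simp only [if_neg hxv]
        by_cases e : Edge h θ x v
        · simp only [if_pos e, sub_self, abs_zero]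
          split_ifs
          · exact R.θ_pos.le
          · rfl
        · simp only [if_neg e, zero_sub, abs_neg]
          split_ifs with h0
          · rw [abs_of_nonpos (R.nonpos x v hxv)]
            by_contra! hlt
            exact e ⟨hxv, hlt⟩
          · rw [not_not.mp h0, abs_zero]
    refine (sum_le_sum fun v _ => h1 v).trans ?_
    rw [← sum_filter, sum_const, nsmul_eq_mul]
    have h2 : (univ.filter fun v => h x v ≠ 0).card ≤ s := by
      rw [← Set.ncard_coe_finset]
      convert R.card x using 2
      ext v; simp
    have h3 := R.θ_pos
    gcongr
  refine ⟨hrow, fun v => le_trans (le_of_eq ?_) (hrow v)⟩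
  refine sum_congr rfl fun x _ => ?_
  congr 1
  simp only [Matrix.sub_apply, effective, Matrix.of_apply]
  rw [R.symm v x]
  by_cases hxv : x = v
  · subst hxv; simp
  · simp only [if_neg hxv, if_neg (Ne.symm hxv), edge_comm R.symm (x := v)]

end Simulator

end StoqTFD
end

/-! ### The gap and the simulation error -/

noncomputable section
namespace StoqTFD
open Site Finset

section Bounds

variable {n s : ℕ} {h : Bits n → Bits n → ℝ} {θ M a b Δ : ℝ} (R : Regime s h θ M a b Δ)
include R

theorem Regime.one_le_sites : (1 : ℝ) ≤ 6 * n + 4 * s := by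
  have h1 : (1 : ℝ) ≤ s := by exact_mod_cast R.pos
  have h2 : (0 : ℝ) ≤ n := n.cast_nonneg
  linarith

theorem two_mul_le_siteEnergy {x y : Bits n} (e : Edge h θ x y) (p : ℕ) :
    2 * a ≤ siteEnergy n a b (h x y) p := by
  have ha := R.a_pos
  have hb := R.one_le_b
  have hd := R.b_le_slope e
  unfold siteEnergy
  split_ifs <;> nlinarith

/-- The quadratic form of the simulator is large on the complement of the encoded strings. -/
theorem simulator_gap {ψ : Hilb (6 * n + 4 * s)}
    (hψ : ∀ u, inner ℂ (encoding n s u) ψ = 0) :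
    a / (2 * (4 * n + 7) ^ 2) * ‖ψ‖ ^ 2 ≤
      (inner ℂ ψ (Matrix.toEuclideanCLM (n := Bits (6 * n + 4 * s)) (𝕜 := ℂ)
        (tfd a (energy s h θ a b Δ)) ψ) : ℂ).re := by
  have ha := R.a_pos
  have hm := R.one_le_sites
  have hΔ := R.le_Δ
  have hn : (0 : ℝ) ≤ n := n.cast_nonneg
  set m : ℝ := 6 * n + 4 * s with hmdef
  set L : ℝ := 4 * n + 7 with hL
  have hL7 : 7 ≤ L := by linarith
  -- A parabola that vanishes at both codewords, at places 0 and L + 1, and has second difference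
  -- -2.
  let c : ℕ → ℝ := fun p => p * (L + 1 - p)
  have hc : ∀ p ∈ Icc 1 (4 * n + 7), 0 ≤ c p ∧ c p ≤ L ^ 2 := by
    intro p hp
    rw [mem_Icc] at hp
    have hp1 : (1 : ℝ) ≤ p := by exact_mod_cast hp.1
    have hp2 : (p : ℝ) ≤ L := by rw [hL]; exact_mod_cast hp.2
    simp only [c]
    constructor <;> nlinarith
  -- The constant 1/m keeps v positive everywhere, and its sum over the m neighbours is 1. On a path
  -- the second difference of the parabola yields 2a, of which this constant uses up only a.
  let v : Bits (6 * n + 4 * s) → ℝ := fun z => 1 / m + pathSum h θ (fun _ _ p => c p) z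
  have hps : ∀ z : Bits (6 * n + 4 * s), 0 ≤ pathSum h θ (fun _ _ p => c p) z ∧
      pathSum h θ (fun _ _ p => c p) z ≤ L ^ 2 := by
    intro z
    by_cases hz : OnPath h θ z
    · obtain ⟨x, y, p, e, hp, rfl⟩ := hz
      rw [pathSum_path R.symm R.θ_pos.le R.card _ e hp]
      exact hc p hp
    · rw [pathSum_of_not_onPath _ hz]
      exact ⟨le_rfl, by positivity⟩
  rw [toEuclideanCLM_eq_matCLM, tfd_eq]
  refine gap_of_supersolution (v := v) (Q := fun z => ∀ x, z ≠ encString s x)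
    (tfdEntry_comm a _) (fun x y hxy => tfdEntry_nonpos ha.le _ hxy) (fun z => ?_) ?_ ?_
  · have := (hps z).1
    simp only [v]
    positivity
  · intro z hz
    rw [sum_tfdEntry_mul]
    have hsum : ∑ y, cube z y * v y = 1 + ∑ y, cube z y * pathSum h θ (fun _ _ p => c p) y := by
      simp only [v, mul_add, sum_add_distrib, ← sum_mul, sum_cube]
      congr 1
      push_cast
      rw [← hmdef]
      field_simp
    rw [hsum]
    by_cases hp : OnPath h θ z
    · obtain ⟨x, y, p, e, hp, rfl⟩ := hp
      rw [energy_path R e hp, sum_cube_pathSum_path R.symm R.θ_pos.le R.card _ e hp]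
      simp only [v]
      rw [pathSum_path R.symm R.θ_pos.le R.card _ e hp]
      have h1 := two_mul_le_siteEnergy R e p
      have hcp := hc p hp
      rw [mem_Icc] at hp
      have h2 : (if p = 1 then 0 else c (p - 1)) = ((p : ℝ) - 1) * (L + 1 - (p - 1)) := by
        split_ifs with hp1
        · subst hp1; simp
        · simp only [c]
          rw [Nat.cast_sub hp.1]; simp
      have h3 : (if p = 4 * n + 7 then 0 else c (p + 1)) = ((p : ℝ) + 1) * (L + 1 - (p + 1)) := by
        split_ifs with hp1
        · subst hp1; push_cast; rw [hL]; ring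
        · simp only [c]; push_cast; ring
      rw [h2, h3]
      have h4 : 1 / m ≤ 1 := by rw [div_le_one (by linarith)]; exact hm
      have h5 : 0 < 1 / m := by positivity
      have h6 : a / (2 * L ^ 2) * (1 / m + c p) ≤ a := by
        rw [div_mul_eq_mul_div, div_le_iff₀ (by positivity)]
        gcongr
        nlinarith
      have h7 : 2 * a * (1 / m + c p) ≤ siteEnergy n a b (h x y) p * (1 / m + c p) := by
        have := hcp.1
        gcongr
      have h8 : 2 * a * c p = a * (((p : ℝ) - 1) * (L + 1 - (p - 1)) +
          ((p : ℝ) + 1) * (L + 1 - (p + 1)) + 2) := by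
        simp only [c]; ring
      have h9 : 0 ≤ 2 * a * (1 / m) := by positivity
      linarith
    · have hbad : ¬ Good h θ z := by
        rintro (⟨x, hx⟩ | h1)
        · exact hz x hx
        · exact hp h1
      rw [energy_bad hbad]
      simp only [v]
      rw [pathSum_of_not_onPath _ hp, add_zero]
      have h1 : ∑ y, cube z y * pathSum h θ (fun _ _ p => c p) y ≤ m * L ^ 2 := by
        calc _ ≤ ∑ y, cube z y * L ^ 2 :=
              sum_le_sum fun y _ => mul_le_mul_of_nonneg_left (hps y).2 (cube_nonneg z y)
          _ = m * L ^ 2 := by rw [← sum_mul, sum_cube]; push_cast; rw [hmdef]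
      have h2 : a / (2 * L ^ 2) ≤ a := div_le_self ha.le (by nlinarith)
      have h3 : a * (1 + ∑ y, cube z y * pathSum h θ (fun _ _ p => c p) y) ≤
          a * (1 + m * L ^ 2) := by gcongr
      -- The bound `le_Δ` in `Regime` is this inequality multiplied by m: the penalty must outweigh
      -- m neighbours with values up to L².
      have h4 : a * (1 / m) + a * (1 + m * L ^ 2) ≤ Δ * (1 / m) := by
        have h5 : (a + a * m * (1 + m * L ^ 2)) * (1 / m) =
            a * (1 / m) + a * (1 + m * L ^ 2) := by field_simp
        rw [← h5]
        gcongr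
      have h6 : a / (2 * L ^ 2) * (1 / m) ≤ a * (1 / m) := by gcongr
      linarith
  · intro z hz
    push Not at hz
    obtain ⟨x, rfl⟩ := hz
    have h1 := hψ (EuclideanSpace.single x 1)
    rw [encoding_single, EuclideanSpace.inner_single_left] at h1
    simpa using h1

theorem abs_energy_le (z : Bits (6 * n + 4 * s)) :
    |energy s h θ a b Δ z| ≤ Δ + (M + s * (M * (1 + (4 * n + 7) * b) + a)) +
      a * (1 + b) + 2 * a + a * (1 + 2 * a / θ) := by
  classical
  have ha := R.a_pos
  have hb := R.one_le_b
  have hM := R.one_le_M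
  have hΔ := R.Δ_pos
  have hθ := R.θ_pos
  have hn : (0 : ℝ) ≤ n := n.cast_nonneg
  have c1 : 0 ≤ M + s * (M * (1 + (4 * n + 7) * b) + a) := by positivity
  have c2 : 0 ≤ a * (1 + b) := by positivity
  have c3 : 0 ≤ a * (1 + 2 * a / θ) := by positivity
  by_cases hz : Good h θ z
  · rcases hz with ⟨x, rfl⟩ | ⟨x, y, p, e, hp, rfl⟩
    · rw [energy_enc R]
      have h1 : |codeEnergy h θ a b x| ≤ M + s * (M * (1 + (4 * n + 7) * b) + a) := by
        unfold codeEnergy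
        refine (abs_add_le _ _).trans (add_le_add (R.bound x x) ?_)
        rw [← sum_filter]
        refine (abs_sum_le_sum_abs _ _).trans ?_
        refine (sum_le_card_nsmul _ _ (M * (1 + (4 * n + 7) * b) + a) fun y hy => ?_).trans ?_
        · have e : Edge h θ x y := by simpa using hy
          have hd := R.b_le_slope e
          have hg := R.neg_pos e
          rw [abs_of_nonneg]
          · exact code_term_le hM hb R.a_eq hg R.neg_le
          · have : 0 ≤ b + slope n a b (h x y) := by linarith
            positivity
        · rw [nsmul_eq_mul]
          gcongr
          exact card_edges_le R.θ_pos.le R.card x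
      linarith
    · rw [energy_path R e hp]
      have h1 := two_mul_le_siteEnergy R e p
      rw [abs_of_nonneg (by linarith)]
      have h2 : slope n a b (h x y) ≤ 2 * a / θ :=
        slope_le hM hb R.a_eq (R.neg_pos e) R.neg_le hθ e.2.le
      have h3 : a * (1 + slope n a b (h x y)) ≤ a * (1 + 2 * a / θ) := by gcongr
      unfold siteEnergy
      split_ifs <;> linarith
  · rw [energy_bad hz, abs_of_pos hΔ]
    linarith

/-- In the distance r from the encoding one counts the path amplitudes and the leak; in the residue
t, the field acting on the leak and the neglected matrix elements. The bound `hr1` gives the dressed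
encoding the Schur bound 1 + 1 = 2. -/
theorem simulates_of_regime {H : Op n} (hH : ∀ x y, H x y = (h x y : ℂ)) (hHM : opNorm H ≤ M)
    {r t δ η ε : ℝ} (hr1 : 6 * s * (4 * n + 7) / b ≤ 1)
    (hr : 6 * s * (4 * n + 7) / b + a / Δ * ((6 * n + 4 * s) * 2) ≤ r)
    (ht : a * ((6 * n + 4 * s) * (a / Δ * ((6 * n + 4 * s) * 2))) + s * θ ≤ t)
    (hδ : (M + t) / (a / (2 * (4 * n + 7) ^ 2)) + r ≤ δ) (hδ16 : δ ≤ 1 / 16) (hη : 5 * δ ≤ η)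
    (hε : 13 * δ * M + 2 * t ≤ ε) :
    Simulates (tfd a (energy s h θ a b Δ)) (encoding n s) H η ε := by
  have ha := R.a_pos
  have hb := R.one_le_b
  have hΔ := R.Δ_pos
  have hθ := R.θ_pos
  have hpath := schurLe_path R
  have hdressed : SchurLe (dressed s h θ a b) 2 := (schurLe_enc.add hpath).mono (by linarith)
  have hleak := schurLe_leak R zero_le_two hdressed
  have henc : (encoding n s).toContinuousLinearMap = realCLM (encReal n s) := by
    rw [encoding_eq_matCLM]
    unfold realCLM
    congr 1
    ext z x
    simp [encMatrix, encReal]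
  have hK : Matrix.toEuclideanCLM (n := Bits (6 * n + 4 * s)) (𝕜 := ℂ)
      (tfd a (energy s h θ a b Δ)) = realCLM (simReal s h θ a b Δ) := by
    rw [toEuclideanCLM_eq_matCLM, tfd_eq]
    rfl
  have hHc : Matrix.toEuclideanCLM (n := Bits n) (𝕜 := ℂ) H = realCLM (Matrix.of h) := by
    rw [toEuclideanCLM_eq_matCLM]
    unfold realCLM
    congr 1
    ext x y
    simp [hH]
  have hleak0 : 0 ≤ a / Δ * ((6 * n + 4 * s) * 2) := by positivity
  refine simulates_of_approx (W := realCLM (dressed s h θ a b + leakMatrix s h θ a b Δ)) (r := r)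
    (t := t) (Γ := a / (2 * (4 * n + 7) ^ 2)) (δ := δ) (isStoquastic_tfd ha.le _).1 hHM ?_ ?_
    (by positivity) (fun ψ hψ => simulator_gap R hψ) hδ hδ16 hη hε
  · rw [henc, ← realCLM_sub]
    have h1 : dressed s h θ a b + leakMatrix s h θ a b Δ - encReal n s =
        pathMatrix s h θ a b + leakMatrix s h θ a b Δ := by unfold dressed; abel
    rw [h1]
    exact ((hpath.add hleak).norm_le (by positivity)).trans hr
  · rw [henc, hK, hHc, ← realCLM_mul, ← realCLM_mul, ← realCLM_sub]
    have h1 : simReal s h θ a b Δ * (dressed s h θ a b + leakMatrix s h θ a b Δ) -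
        encReal n s * Matrix.of h =
        -(a • (cubeMatrix (6 * n + 4 * s) * leakMatrix s h θ a b Δ)) +
          encReal n s * (effective h θ - Matrix.of h) := by
      rw [← simReal_mul_dressed R, Matrix.mul_sub]
      abel
    rw [h1]
    have h2 : SchurLe (a • (cubeMatrix (6 * n + 4 * s) * leakMatrix s h θ a b Δ))
        (a * (((6 * n + 4 * s : ℕ) : ℝ) * (a / Δ * ((6 * n + 4 * s) * 2)))) :=
      ((schurLe_cube _).mul (by positivity) hleak0 hleak).smul ha.le
    push_cast at h2
    have h3 : SchurLe (-(a • (cubeMatrix (6 * n + 4 * s) * leakMatrix s h θ a b Δ)))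
        (a * ((6 * n + 4 * s) * (a / Δ * ((6 * n + 4 * s) * 2)))) :=
      h2.of_abs_le fun z v => by rw [Matrix.neg_apply, abs_neg]
    have h4 : SchurLe (encReal n s * (effective h θ - Matrix.of h)) (1 * (s * θ)) :=
      schurLe_enc.mul zero_le_one (by positivity) (schurLe_effective_sub R)
    rw [one_mul] at h4
    exact ((h3.add h4).norm_le (by positivity)).trans ht

end Bounds

/-! ### The choice of the parameters -/

/-- The inverse of the tolerated relative leakage. -/
def accuracy (M η ε : ℝ) : ℝ := 30 * (1 / η + M * (1 / ε))

/-- The ratio of the first and last amplitude on a path to that on its end. -/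
def damping (n s : ℕ) (M η ε : ℝ) : ℝ := 11 * s * (4 * n + 7) * accuracy M η ε

/-- The strength of the transverse field. -/
def field (n s : ℕ) (M η ε : ℝ) : ℝ := M * (4 * n + 7) * damping n s M η ε ^ 2

/-- The energy penalty off the paths. -/
def penalty (n s : ℕ) (M η ε : ℝ) : ℝ :=
  16 * field n s M η ε ^ 2 * (6 * n + 4 * s) ^ 2 * (1 / ε) + field n s M η ε +
    2 * field n s M η ε * (6 * n + 4 * s) ^ 2 * (4 * n + 7) ^ 2

/-- The size below which matrix elements are neglected. -/
def cutoff (s : ℕ) (ε : ℝ) : ℝ := ε / (8 * s)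

/-- The diagonal part of the simulator of `H`. -/
def simulatorEnergy (n s : ℕ) (M η ε : ℝ) (H : Op n) : Bits (6 * n + 4 * s) → ℝ :=
  energy s (fun x y => (H x y).re) (cutoff s ε) (field n s M η ε) (damping n s M η ε)
    (penalty n s M η ε)

theorem stoquastic_apply {n : ℕ} {H : Op n} (hH : IsStoquastic H) (x y : Bits n) :
    H x y = ((H x y).re : ℂ) := by
  apply Complex.ext
  · simp
  · simp [hH.2.1 x y]

section Choice

variable {n s : ℕ} {M η ε : ℝ} (hs : 1 ≤ s) (hM : 1 ≤ M) (hη : 0 < η) (hη1 : η ≤ 1) (hε : 0 < ε)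
  {H : Op n} (hH : IsStoquastic H) (hHs : IsSparse s H) (hHM : opNorm H ≤ M)
include hM hη hη1 hε

theorem accuracy_ge : 30 ≤ accuracy M η ε := by
  have h1 : 1 ≤ 1 / η := by rw [le_div_iff₀ hη]; linarith
  have h2 : 0 ≤ M * (1 / ε) := by positivity
  unfold accuracy
  linarith

include hs

theorem damping_ge : 1 ≤ damping n s M η ε := by
  have h1 := accuracy_ge hM hη hη1 hε
  have h2 : (1 : ℝ) ≤ s := by exact_mod_cast hs
  have hn : (0 : ℝ) ≤ n := n.cast_nonneg
  unfold damping
  have h3 : 1 ≤ 11 * (s : ℝ) * (4 * n + 7) := by nlinarith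
  nlinarith

theorem field_pos : 0 < field n s M η ε := by
  have h1 := damping_ge (n := n) hs hM hη hη1 hε
  unfold field
  positivity

include hH hHs hHM

theorem regime_of_choice : Regime s (fun x y => (H x y).re) (cutoff s ε) M (field n s M η ε)
    (damping n s M η ε) (penalty n s M η ε) where
  symm x y := by
    have := hH.1.apply y x
    rw [← this]; simp
  card x := by
    refine le_trans (Set.ncard_le_ncard (fun y hy => ?_) (Set.toFinite _)) (hHs.1 x)
    intro h0
    apply hy
    rw [h0, Complex.zero_re]
  bound x y := (Complex.abs_re_le_norm _).trans ((norm_entry_le_matCLM H x y).trans hHM)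
  nonpos := hH.2.2
  pos := hs
  θ_pos := by
    have h2 : (0 : ℝ) < s := by exact_mod_cast hs
    unfold cutoff
    positivity
  one_le_M := hM
  one_le_b := damping_ge hs hM hη hη1 hε
  a_eq := rfl
  le_Δ := by
    have ha := field_pos (n := n) hs hM hη hη1 hε
    have h2 : (1 : ℝ) ≤ s := by exact_mod_cast hs
    have hn : (0 : ℝ) ≤ n := n.cast_nonneg
    unfold penalty
    set a := field n s M η ε
    set m : ℝ := 6 * n + 4 * s with hm
    set L : ℝ := 4 * n + 7 with hL
    have hm1 : 1 ≤ m := by linarith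
    have hL1 : 1 ≤ L := by linarith
    have h3 : 0 ≤ 16 * a ^ 2 * m ^ 2 * (1 / ε) := by positivity
    have h4 : m * 1 ≤ m ^ 2 * L ^ 2 := by
      have : 1 ≤ m * L ^ 2 := by nlinarith [one_le_pow₀ hL1 (n := 2)]
      nlinarith
    have h5 : a * m * (1 + m * L ^ 2) = a * (m * 1 + m ^ 2 * L ^ 2) := by ring
    have h6 : a * (m * 1 + m ^ 2 * L ^ 2) ≤ a * (m ^ 2 * L ^ 2 + m ^ 2 * L ^ 2) := by gcongr
    linarith

/-- With Y = `accuracy`, the budget is δ = 1/Y: 6/(11Y) for the path amplitudes, 1/(11Y) for the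
leak and 4/(11Y) for the projection on the low-energy space. The residue t = ε/4 is half leak and
half cutoff. The choice of Y makes 5δ ≤ η and 13δM ≤ ε/2. -/
theorem simulates_of_choice (hε1 : ε ≤ 1) :
    Simulates (tfd (field n s M η ε) (simulatorEnergy n s M η ε H)) (encoding n s) H η ε := by
  have R := regime_of_choice hs hM hη hη1 hε hH hHs hHM
  have hY := accuracy_ge hM hη hη1 hε
  have hb := damping_ge (n := n) hs hM hη hη1 hε
  have ha := field_pos (n := n) hs hM hη hη1 hε
  have hΔ0 := R.Δ_pos
  have hs1 : (1 : ℝ) ≤ s := by exact_mod_cast hs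
  have hn : (0 : ℝ) ≤ n := n.cast_nonneg
  have hm1 := R.one_le_sites
  have hbdef : damping n s M η ε = 11 * s * (4 * n + 7) * accuracy M η ε := rfl
  have hadef : field n s M η ε = M * (4 * n + 7) * damping n s M η ε ^ 2 := rfl
  have hYdef : accuracy M η ε = 30 * (1 / η + M * (1 / ε)) := rfl
  have hΔdef : 16 * field n s M η ε ^ 2 * (6 * n + 4 * s) ^ 2 / ε ≤ penalty n s M η ε := by
    unfold penalty
    have h1 : 0 ≤ 2 * field n s M η ε * (6 * n + 4 * s) ^ 2 * (4 * n + 7) ^ 2 := by positivity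
    rw [mul_one_div]
    linarith
  set Y := accuracy M η ε
  set b := damping n s M η ε
  set a := field n s M η ε
  set Δ := penalty n s M η ε
  have h6 : 6 * s * (4 * n + 7) / b = 6 / (11 * Y) := by rw [hbdef]; field_simp
  have hq : (s : ℝ) * (4 * n + 7) / b = 1 / (11 * Y) := by rw [hbdef]; field_simp
  have hab : b ≤ a := by
    have h1 : 1 ≤ M * (4 * (n : ℝ) + 7) * b :=
      one_le_mul_of_one_le_of_one_le (one_le_mul_of_one_le_of_one_le hM (by linarith)) hb
    have h2 := le_mul_of_one_le_left (zero_le_one.trans hb) h1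
    rw [hadef]; linarith
  have hleak : a * ((6 * n + 4 * s) * (a / Δ * ((6 * n + 4 * s) * 2))) ≤ ε / 8 := by
    have h1 : a * ((6 * n + 4 * s) * (a / Δ * ((6 * n + 4 * s) * 2))) =
        2 * a ^ 2 * (6 * n + 4 * s) ^ 2 / Δ := by ring
    rw [h1, div_le_iff₀ hΔ0]
    rw [div_le_iff₀ hε] at hΔdef
    linarith
  have hleak2 : a / Δ * ((6 * n + 4 * s) * 2) ≤ 1 / (11 * Y) := by
    have h0 : 0 ≤ a / Δ * ((6 * n + 4 * s) * 2) := by positivity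
    have h1 : a * (a / Δ * ((6 * n + 4 * s) * 2)) ≤ 1 := by
      have : a * (a / Δ * ((6 * n + 4 * s) * 2)) ≤
          a * ((6 * n + 4 * s) * (a / Δ * ((6 * n + 4 * s) * 2))) := by
        exact mul_le_mul_of_nonneg_left (le_mul_of_one_le_left h0 hm1) ha.le
      linarith
    rw [le_div_iff₀ (by positivity)]
    have h2 : 11 * Y ≤ b := by
      have h3 : (1 : ℝ) ≤ s * (4 * n + 7) :=
        one_le_mul_of_one_le_of_one_le hs1 (by linarith)
      have h4 := le_mul_of_one_le_left (by linarith : 0 ≤ 11 * Y) h3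
      rw [hbdef]; linarith
    calc a / Δ * ((6 * n + 4 * s) * 2) * (11 * Y) ≤ a / Δ * ((6 * n + 4 * s) * 2) * a := by
          gcongr; linarith
      _ ≤ 1 := by linarith
  have hcut : s * cutoff s ε = ε / 8 := by unfold cutoff; field_simp
  refine simulates_of_regime R (stoquastic_apply hH) hHM (r := 7 / (11 * Y)) (t := ε / 4)
    (δ := 1 / Y) ?_ ?_ ?_ ?_ ?_ ?_ ?_
  · rw [h6, div_le_one (by positivity)]; linarith
  · rw [h6]
    have : 7 / (11 * Y) = 6 / (11 * Y) + 1 / (11 * Y) := by ring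
    linarith
  · linarith
  · have h1 : (M + ε / 4) / (a / (2 * (4 * n + 7) ^ 2)) ≤ 4 / (11 * Y) := by
      have h2 : 4 / (11 * Y) = 4 * (s * (4 * n + 7) / b) := by rw [hq]; ring
      rw [h2, div_le_iff₀ (by positivity), hadef]
      have h3 : 4 * ((s : ℝ) * (4 * n + 7) / b) * (M * (4 * n + 7) * b ^ 2 / (2 * (4 * n + 7) ^ 2))
          = 2 * s * b * M := by field_simp; ring
      rw [h3]
      have h4 : 2 * M * 1 ≤ 2 * M * (s * b) := by
        gcongr
        exact one_le_mul_of_one_le_of_one_le hs1 hb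
      linarith
    have h2 : 1 / Y = 4 / (11 * Y) + 7 / (11 * Y) := by field_simp; norm_num
    linarith
  · rw [div_le_div_iff₀ (by positivity) (by norm_num)]; linarith
  · rw [mul_one_div, div_le_iff₀ (by positivity), hYdef]
    have h1 : η * (30 * (1 / η + M * (1 / ε))) = 30 + 30 * η * M * (1 / ε) := by field_simp
    have h2 : 0 ≤ 30 * η * M * (1 / ε) := by positivity
    linarith
  · have h1 : 13 * (1 / Y) * M ≤ ε / 2 := by
      rw [mul_one_div, div_mul_eq_mul_div, div_le_iff₀ (by positivity), hYdef]
      have h1 : ε / 2 * (30 * (1 / η + M * (1 / ε))) = 15 * ε / η + 15 * M := by field_simp; ring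
      have h2 : 0 ≤ 15 * ε / η := by positivity
      linarith
    linarith

/-- The bound is kept as a polynomial expression in 1/η, 1/ε, n, s and M. -/
theorem opNorm_of_choice :
    opNorm (tfd (field n s M η ε) (simulatorEnergy n s M η ε H)) ≤
      field n s M η ε * (6 * n + 4 * s) + (penalty n s M η ε +
      (M + s * (M * (1 + (4 * n + 7) * damping n s M η ε) + field n s M η ε)) +
      field n s M η ε * (1 + damping n s M η ε) + 2 * field n s M η ε +
      field n s M η ε * (1 + 2 * field n s M η ε * (8 * s * (1 / ε)))) := by
  have R := regime_of_choice hs hM hη hη1 hε hH hHs hHM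
  have hb := damping_ge (n := n) hs hM hη hη1 hε
  have ha := field_pos (n := n) hs hM hη hη1 hε
  have hΔ0 := R.Δ_pos
  have hcut : 2 * field n s M η ε / cutoff s ε = 2 * field n s M η ε * (8 * s * (1 / ε)) := by
    unfold cutoff; field_simp
  have h1 := opNorm_tfd_le (m := 6 * n + 4 * s) ha.le
    ((abs_nonneg _).trans (abs_energy_le R fun _ => false)) (abs_energy_le R)
  rw [hcut] at h1
  push_cast at h1
  exact h1

end Choice

end StoqTFD
end

noncomputable section
namespace StoqTFD

/-! ### Reversing circuits -/

section Reverse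

variable {n s : ℕ} {β ρ : Type} [DecidableEq β] [DecidableEq ρ]

/-- The inverse gate. -/
def Gate.inverse : Gate n s β ρ → Gate n s β ρ
  | .not t => .not t
  | .toffoli i j t hi hj => .toffoli i j t hi hj
  | .const r t => .const (-r) t
  | .add neg i t hi => .add (!neg) i t hi
  | .mul neg i j t hi hj => .mul (!neg) i j t hi hj
  | .inv neg i t hi => .inv (!neg) i t hi
  | .ofBit neg i t => .ofBit (!neg) i t
  | .pos i t => .pos i t
  | .queryAdj x ans hx => .queryAdj x ans hx
  | .queryEntry neg x y t => .queryEntry (!neg) x y t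

theorem Config.xorBit_xorBit (c : Config β ρ) (t : β) (v w : Bool) :
    (c.xorBit t v).xorBit t w = c.xorBit t (xor v w) := by
  simp [Config.xorBit]

theorem Config.xorBit_false (c : Config β ρ) (t : β) : c.xorBit t false = c := by
  simp [Config.xorBit]

theorem Config.addReal_cancel (c : Config β ρ) (neg : Bool) (t : ρ) (v : ℝ) :
    (c.addReal neg t v).addReal (!neg) t v = c := by
  cases neg <;> simp [Config.addReal]

/-- A gate never changes a wire that it reads, by its side conditions or because it reads wires of
the other kind; the second application therefore sees the same value. -/
theorem Gate.step_inverse (O : Oracle n s) (g : Gate n s β ρ) (c : Config β ρ) :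
    g.inverse.step O (g.step O c) = c := by
  cases g with
  | not t => simp [Gate.inverse, Gate.step, Config.xorBit_xorBit, Config.xorBit_false]
  | toffoli i j t hi hj =>
    have h1 : ∀ v, (c.xorBit t v).bit i = c.bit i := fun v => by simp [Config.xorBit, hi]
    have h2 : ∀ v, (c.xorBit t v).bit j = c.bit j := fun v => by simp [Config.xorBit, hj]
    simp [Gate.inverse, Gate.step, h1, h2, Config.xorBit_xorBit, Config.xorBit_false]
  | const r t =>
    simp [Gate.inverse, Gate.step, Config.addReal]
  | add neg i t hi =>
    have h1 : ∀ v, (c.addReal neg t v).real i = c.real i := fun v => by simp [Config.addReal, hi]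
    simp [Gate.inverse, Gate.step, h1, Config.addReal_cancel]
  | mul neg i j t hi hj =>
    have h1 : ∀ v, (c.addReal neg t v).real i = c.real i := fun v => by simp [Config.addReal, hi]
    have h2 : ∀ v, (c.addReal neg t v).real j = c.real j := fun v => by simp [Config.addReal, hj]
    simp [Gate.inverse, Gate.step, h1, h2, Config.addReal_cancel]
  | inv neg i t hi =>
    have h1 : ∀ v, (c.addReal neg t v).real i = c.real i := fun v => by simp [Config.addReal, hi]
    simp [Gate.inverse, Gate.step, h1, Config.addReal_cancel]
  | ofBit neg i t =>
    have h1 : ∀ v, (c.addReal neg t v).bit i = c.bit i := fun v => by simp [Config.addReal]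
    simp [Gate.inverse, Gate.step, h1, Config.addReal_cancel]
  | pos i t =>
    have h1 : ∀ v, (c.xorBit t v).real i = c.real i := fun v => by simp [Config.xorBit]
    simp [Gate.inverse, Gate.step, h1, Config.xorBit_xorBit, Config.xorBit_false]
  | queryAdj x ans hx =>
    have h1 : ∀ (f : Fin s × Option (Fin n) → Bool) j,
        Function.extend ans f (fun _ => false) (x j) = false := fun f j => by
      rw [Function.extend_apply']
      rintro ⟨p, hp⟩
      exact hx j p hp.symm
    simp [Gate.inverse, Gate.step, h1]
  | queryEntry neg x y t =>
    have h1 : ∀ v w, (c.addReal neg t v).bit w = c.bit w := fun v w => by simp [Config.addReal]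
    simp [Gate.inverse, Gate.step, h1, Config.addReal_cancel]

theorem Gate.isQuery_inverse (g : Gate n s β ρ) : g.inverse.isQuery = g.isQuery := by
  cases g <;> rfl

theorem Circuit.run_append (O : Oracle n s) (P Q : Circuit n s β ρ) (c : Config β ρ) :
    Circuit.run O (P ++ Q) c = Circuit.run O Q (Circuit.run O P c) := List.foldl_append

theorem Circuit.run_cons (O : Oracle n s) (g : Gate n s β ρ) (Q : Circuit n s β ρ)
    (c : Config β ρ) : Circuit.run O (g :: Q) c = Circuit.run O Q (g.step O c) := rfl

theorem Circuit.queries_append (P Q : Circuit n s β ρ) :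
    Circuit.queries (P ++ Q) = Circuit.queries P + Circuit.queries Q := List.countP_append

/-- The inverse circuit. -/
def Circuit.reversed (P : Circuit n s β ρ) : Circuit n s β ρ := (P.map Gate.inverse).reverse

theorem Circuit.run_reversed (O : Oracle n s) (P : Circuit n s β ρ) (c : Config β ρ) :
    Circuit.run O (Circuit.reversed P) (Circuit.run O P c) = c := by
  induction P generalizing c with
  | nil => rfl
  | cons g P ih =>
    unfold Circuit.reversed at ih ⊢
    rw [List.map_cons, List.reverse_cons, Circuit.run_append, Circuit.run_cons O g P, ih]
    exact g.step_inverse O c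

theorem Circuit.length_reversed (P : Circuit n s β ρ) :
    (Circuit.reversed P).length = P.length := by
  simp [Circuit.reversed]

theorem Circuit.queries_reversed (P : Circuit n s β ρ) :
    Circuit.queries (Circuit.reversed P) = Circuit.queries P := by
  unfold Circuit.queries Circuit.reversed
  rw [List.countP_reverse, List.countP_map]
  congr 1
  funext g
  exact g.isQuery_inverse

/-- The gate does not involve the wire `t`. -/
def Gate.Avoids (t : ρ) : Gate n s β ρ → Prop
  | .not _ => True
  | .toffoli _ _ _ _ _ => True
  | .const _ u => u ≠ t
  | .add _ i u _ => i ≠ t ∧ u ≠ t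
  | .mul _ i j u _ _ => i ≠ t ∧ j ≠ t ∧ u ≠ t
  | .inv _ i u _ => i ≠ t ∧ u ≠ t
  | .ofBit _ _ u => u ≠ t
  | .pos i _ => i ≠ t
  | .queryAdj _ _ _ => True
  | .queryEntry _ _ _ u => u ≠ t

theorem Config.addReal_comm (c : Config β ρ) {t u : ρ} (h : u ≠ t) (neg : Bool) (v w : ℝ) :
    (c.addReal false t w).addReal neg u v = (c.addReal neg u v).addReal false t w := by
  simp only [Config.addReal, Config.mk.injEq, true_and]
  rw [Function.update_of_ne h, Function.update_of_ne h.symm, Function.update_comm h]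

theorem Gate.Avoids.step_addReal {t : ρ} {g : Gate n s β ρ} (h : g.Avoids t) (O : Oracle n s)
    (c : Config β ρ) (w : ℝ) :
    g.step O (c.addReal false t w) = (g.step O c).addReal false t w := by
  have hreal : ∀ i, i ≠ t → (c.addReal false t w).real i = c.real i := fun i hi => by
    simp [Config.addReal, hi]
  have hbit : (c.addReal false t w).bit = c.bit := rfl
  cases g with
  | not u => rfl
  | toffoli i j u hi hj => rfl
  | const r u => exact Config.addReal_comm c h false r w
  | add neg i u hi =>
    simp only [Gate.step]
    rw [hreal i h.1, Config.addReal_comm c h.2]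
  | mul neg i j u hi hj =>
    simp only [Gate.step]
    rw [hreal i h.1, hreal j h.2.1, Config.addReal_comm c h.2.2]
  | inv neg i u hi =>
    simp only [Gate.step]
    rw [hreal i h.1, Config.addReal_comm c h.2]
  | ofBit neg i u => exact Config.addReal_comm c h neg _ w
  | pos i u =>
    simp only [Gate.step]
    rw [hreal i h]
    rfl
  | queryAdj x ans hx => rfl
  | queryEntry neg x y u => exact Config.addReal_comm c h neg _ w

theorem Gate.Avoids.inverse {t : ρ} {g : Gate n s β ρ} (h : g.Avoids t) :
    g.inverse.Avoids t := by
  cases g <;> exact h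

/-- This lets a result added to t survive the undoing of the computation that produced it. -/
theorem Circuit.run_addReal {t : ρ} {P : Circuit n s β ρ} (hP : ∀ g ∈ P, g.Avoids t)
    (O : Oracle n s) (c : Config β ρ) (w : ℝ) :
    Circuit.run O P (c.addReal false t w) = (Circuit.run O P c).addReal false t w := by
  induction P generalizing c with
  | nil => rfl
  | cons g P ih =>
    rw [Circuit.run_cons, Circuit.run_cons,
      (hP g (List.mem_cons_self ..)).step_addReal,
      ih fun g' hg' => hP g' (List.mem_cons_of_mem _ hg')]

end Reverse

/-! ### Functions computed by circuits -/

section Derive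

variable {n s : ℕ} {β ρ : Type} [DecidableEq β] [DecidableEq ρ] {Ω : Type*}
  (O : Ω → Oracle n s) (c : Ω → Config β ρ)

/-- The bit functions and the real functions of the input. -/
abbrev Fn (Ω : Type*) : Type _ := (Ω → Bool) ⊕ (Ω → ℝ)

/-- The configuration after the circuit `P`. -/
def after (P : Circuit n s (β ⊕ ℕ) (ρ ⊕ ℕ)) (ω : Ω) : Config (β ⊕ ℕ) (ρ ⊕ ℕ) :=
  Circuit.run (O ω) P (c ω).withAncillas

/-- After the circuit `P`, which uses `nb` bit ancillas and `nr` real ancillas, the values of all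
functions in `A` are present on some wires. -/
structure RealizesAt (P : Circuit n s (β ⊕ ℕ) (ρ ⊕ ℕ)) (A : Set (Fn Ω)) (nb nr : ℕ) : Prop where
  avoids : ∀ g ∈ P, ∀ t : ρ, g.Avoids (Sum.inl t)
  bit_zero : ∀ ω k, nb ≤ k → (after O c P ω).bit (Sum.inr k) = false
  real_zero : ∀ ω k, nr ≤ k → (after O c P ω).real (Sum.inr k) = 0
  bit : ∀ f, Sum.inl f ∈ A → ∃ w : β ⊕ ℕ, (∀ k, nb ≤ k → w ≠ Sum.inr k) ∧
    ∀ ω, (after O c P ω).bit w = f ω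
  real : ∀ f, Sum.inr f ∈ A → ∃ w < nr, ∀ ω, (after O c P ω).real (Sum.inr w) = f ω

/-- After the circuit `P`, the values of all functions in `A` are present on some wires. -/
def Realizes (P : Circuit n s (β ⊕ ℕ) (ρ ⊕ ℕ)) (A : Set (Fn Ω)) : Prop :=
  ∃ nb nr, RealizesAt O c P A nb nr

/-- From the functions in `S`, those in `T` can be computed with `q` queries and `l` gates. -/
def Derives (S : Set (Fn Ω)) (q l : ℕ) (T : Set (Fn Ω)) : Prop :=
  ∀ P A, S ⊆ A → Realizes O c P A → ∃ Q : Circuit n s (β ⊕ ℕ) (ρ ⊕ ℕ),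
    Circuit.queries Q ≤ q ∧ Q.length ≤ l ∧ Realizes O c (P ++ Q) (A ∪ T)

/-- The bit function `f` can be computed from `S` with `l` gates and no queries. -/
def BitFrom (S : Set (Fn Ω)) (l : ℕ) (f : Ω → Bool) : Prop := Derives O c S 0 l {Sum.inl f}

/-- The real function `f` can be computed from `S` with `l` gates and no queries. -/
def RealFrom (S : Set (Fn Ω)) (l : ℕ) (f : Ω → ℝ) : Prop := Derives O c S 0 l {Sum.inr f}

variable {O c}

theorem RealizesAt.mono {P : Circuit n s (β ⊕ ℕ) (ρ ⊕ ℕ)} {A B : Set (Fn Ω)} {nb nr : ℕ}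
    (h : RealizesAt O c P A nb nr) (hB : B ⊆ A) : RealizesAt O c P B nb nr :=
  ⟨h.avoids, h.bit_zero, h.real_zero, fun f hf => h.bit f (hB hf), fun f hf => h.real f (hB hf)⟩

theorem Realizes.mono {P : Circuit n s (β ⊕ ℕ) (ρ ⊕ ℕ)} {A B : Set (Fn Ω)}
    (h : Realizes O c P A) (hB : B ⊆ A) : Realizes O c P B := by
  obtain ⟨nb, nr, h⟩ := h
  exact ⟨nb, nr, h.mono hB⟩

theorem after_append (P Q : Circuit n s (β ⊕ ℕ) (ρ ⊕ ℕ)) (ω : Ω) :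
    after O c (P ++ Q) ω = Circuit.run (O ω) Q (after O c P ω) := Circuit.run_append _ _ _ _

variable {S T U : Set (Fn Ω)} {q q' l l' : ℕ}

theorem Derives.mono (h : Derives O c S q l T) {S' T' : Set (Fn Ω)} (hS : S ⊆ S') (hT : T' ⊆ T)
    (hq : q ≤ q') (hl : l ≤ l') : Derives O c S' q' l' T' := by
  intro P A hA hP
  obtain ⟨Q, h1, h2, h3⟩ := h P A (hS.trans hA) hP
  exact ⟨Q, h1.trans hq, h2.trans hl, h3.mono (Set.union_subset_union_right _ hT)⟩

theorem derives_of_subset (h : T ⊆ S) : Derives O c S 0 0 T := by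
  intro P A hA hP
  refine ⟨[], le_rfl, le_rfl, ?_⟩
  rw [List.append_nil, Set.union_eq_left.mpr (h.trans hA)]
  exact hP

/-- Derivations chain without reference to wires because `Derives` quantifies over all circuits that
realize S or more, and keeps what they realize. -/
theorem Derives.bind_keep (h : Derives O c S q l T) (h' : Derives O c (S ∪ T) q' l' U) :
    Derives O c S (q + q') (l + l') (T ∪ U) := by
  intro P A hA hP
  obtain ⟨Q, h1, h2, h3⟩ := h P A hA hP
  obtain ⟨Q', h1', h2', h3'⟩ := h' (P ++ Q) (A ∪ T) (Set.union_subset_union_left _ hA) h3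
  refine ⟨Q ++ Q', ?_, ?_, ?_⟩
  · rw [Circuit.queries_append]; exact add_le_add h1 h1'
  · rw [List.length_append]; exact add_le_add h2 h2'
  · rw [← List.append_assoc, ← Set.union_assoc]
    exact h3'

theorem Derives.bind (h : Derives O c S q l T) (h' : Derives O c (S ∪ T) q' l' U) :
    Derives O c S (q + q') (l + l') U :=
  (h.bind_keep h').mono subset_rfl Set.subset_union_right le_rfl le_rfl

theorem Derives.union (h : Derives O c S q l T) (h' : Derives O c S q' l' U) :
    Derives O c S (q + q') (l + l') (T ∪ U) :=
  h.bind_keep (h'.mono Set.subset_union_left subset_rfl le_rfl le_rfl)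

theorem Derives.biUnion {ι : Type*} (t : Finset ι) {T : ι → Set (Fn Ω)}
    (h : ∀ i ∈ t, Derives O c S q l (T i)) :
    Derives O c S (t.card * q) (t.card * l) (⋃ i ∈ t, T i) := by
  classical
  induction t using Finset.induction_on with
  | empty => simpa using derives_of_subset (O := O) (c := c) (Set.empty_subset S)
  | insert i t hi ih =>
    have h1 := (h i (Finset.mem_insert_self i t)).union
      (ih fun j hj => h j (Finset.mem_insert_of_mem hj))
    rw [Finset.card_insert_of_notMem hi, Finset.set_biUnion_insert]
    exact h1.mono le_rfl le_rfl (by ring_nf; rfl) (by ring_nf; rfl)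

theorem Derives.iUnion {ι : Type*} [Fintype ι] {T : ι → Set (Fn Ω)}
    (h : ∀ i, Derives O c S q l (T i)) :
    Derives O c S (Fintype.card ι * q) (Fintype.card ι * l) (⋃ i, T i) := by
  have := Derives.biUnion Finset.univ fun i _ => h i
  simpa using this

/-! ### Primitive steps -/

/-- The new value goes to the first unused ancilla, which still holds zero, so everything realized
before stays in place. -/
theorem RealizesAt.append_bit {P : Circuit n s (β ⊕ ℕ) (ρ ⊕ ℕ)} {A : Set (Fn Ω)} {nb nr : ℕ}
    (h : RealizesAt O c P A nb nr) {Q : Circuit n s (β ⊕ ℕ) (ρ ⊕ ℕ)} {f : Ω → Bool}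
    (hQ : ∀ g ∈ Q, ∀ t : ρ, g.Avoids (Sum.inl t))
    (hf : ∀ ω, Circuit.run (O ω) Q (after O c P ω) =
      (after O c P ω).xorBit (Sum.inr nb) (f ω)) :
    RealizesAt O c (P ++ Q) (A ∪ {Sum.inl f}) (nb + 1) nr := by
  have hbit : ∀ ω w, w ≠ Sum.inr nb → (after O c (P ++ Q) ω).bit w = (after O c P ω).bit w := by
    intro ω w hw
    rw [after_append, hf]
    simp [Config.xorBit, hw]
  have hnew : ∀ ω, (after O c (P ++ Q) ω).bit (Sum.inr nb) = f ω := by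
    intro ω
    rw [after_append, hf]
    simp [Config.xorBit, h.bit_zero ω nb le_rfl]
  have hreal : ∀ ω, (after O c (P ++ Q) ω).real = (after O c P ω).real := by
    intro ω
    rw [after_append, hf]
    rfl
  refine ⟨fun g hg => ?_, fun ω k hk => ?_, fun ω k hk => ?_, fun f' hf' => ?_, fun f' hf' => ?_⟩
  · rcases List.mem_append.mp hg with hg | hg
    · exact h.avoids g hg
    · exact hQ g hg
  · rw [hbit ω _ (by simp; omega)]
    exact h.bit_zero ω k (by omega)
  · rw [hreal]; exact h.real_zero ω k hk
  · rcases hf' with hf' | hf'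
    · obtain ⟨w, hw, hwf⟩ := h.bit f' hf'
      exact ⟨w, fun k hk => hw k (by omega), fun ω => by rw [hbit ω w (hw nb le_rfl), hwf]⟩
    · have : f' = f := by simpa using hf'
      subst this
      exact ⟨Sum.inr nb, fun k hk => by simp; omega, hnew⟩
  · rcases hf' with hf' | hf'
    · obtain ⟨w, hw, hwf⟩ := h.real f' hf'
      exact ⟨w, hw, fun ω => by rw [hreal, hwf]⟩
    · simp at hf'

theorem RealizesAt.append_real {P : Circuit n s (β ⊕ ℕ) (ρ ⊕ ℕ)} {A : Set (Fn Ω)} {nb nr : ℕ}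
    (h : RealizesAt O c P A nb nr) {Q : Circuit n s (β ⊕ ℕ) (ρ ⊕ ℕ)} {f : Ω → ℝ}
    (hQ : ∀ g ∈ Q, ∀ t : ρ, g.Avoids (Sum.inl t))
    (hf : ∀ ω, Circuit.run (O ω) Q (after O c P ω) =
      (after O c P ω).addReal false (Sum.inr nr) (f ω)) :
    RealizesAt O c (P ++ Q) (A ∪ {Sum.inr f}) nb (nr + 1) := by
  have hreal : ∀ ω w, w ≠ Sum.inr nr →
      (after O c (P ++ Q) ω).real w = (after O c P ω).real w := by
    intro ω w hw
    rw [after_append, hf]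
    simp [Config.addReal, hw]
  have hnew : ∀ ω, (after O c (P ++ Q) ω).real (Sum.inr nr) = f ω := by
    intro ω
    rw [after_append, hf]
    simp [Config.addReal, h.real_zero ω nr le_rfl]
  have hbit : ∀ ω, (after O c (P ++ Q) ω).bit = (after O c P ω).bit := by
    intro ω
    rw [after_append, hf]
    rfl
  refine ⟨fun g hg => ?_, fun ω k hk => ?_, fun ω k hk => ?_, fun f' hf' => ?_, fun f' hf' => ?_⟩
  · rcases List.mem_append.mp hg with hg | hg
    · exact h.avoids g hg
    · exact hQ g hg
  · rw [hbit]; exact h.bit_zero ω k hk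
  · rw [hreal ω _ (by simp; omega)]
    exact h.real_zero ω k (by omega)
  · rcases hf' with hf' | hf'
    · obtain ⟨w, hw, hwf⟩ := h.bit f' hf'
      exact ⟨w, hw, fun ω => by rw [hbit, hwf]⟩
    · simp at hf'
  · rcases hf' with hf' | hf'
    · obtain ⟨w, hw, hwf⟩ := h.real f' hf'
      exact ⟨w, by omega, fun ω => by rw [hreal ω _ (by simp; omega), hwf]⟩
    · have : f' = f := by simpa using hf'
      subst this
      exact ⟨nr, by omega, hnew⟩

variable {f g : Ω → Bool} {u v : Ω → ℝ}

theorem bitFrom_mem (h : Sum.inl f ∈ S) : BitFrom O c S 0 f :=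
  derives_of_subset (Set.singleton_subset_iff.mpr h)

theorem realFrom_mem (h : Sum.inr u ∈ S) : RealFrom O c S 0 u :=
  derives_of_subset (Set.singleton_subset_iff.mpr h)

theorem bitFrom_and_mem (hf : Sum.inl f ∈ S) (hg : Sum.inl g ∈ S) :
    BitFrom O c S 1 (fun ω => f ω && g ω) := by
  rintro P A hA ⟨nb, nr, h⟩
  obtain ⟨i, hi, hif⟩ := h.bit f (hA hf)
  obtain ⟨j, hj, hjg⟩ := h.bit g (hA hg)
  refine ⟨[.toffoli i j (Sum.inr nb) (hi nb le_rfl) (hj nb le_rfl)], le_rfl, le_rfl, nb + 1, nr,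
    h.append_bit (by simp [Gate.Avoids]) fun ω => ?_⟩
  simp [Circuit.run, Gate.step, hif, hjg]

theorem bitFrom_not_mem (hf : Sum.inl f ∈ S) : BitFrom O c S 2 (fun ω => !f ω) := by
  rintro P A hA ⟨nb, nr, h⟩
  obtain ⟨i, hi, hif⟩ := h.bit f (hA hf)
  -- With equal controls the Toffoli gate copies a bit.
  refine ⟨[.toffoli i i (Sum.inr nb) (hi nb le_rfl) (hi nb le_rfl), .not (Sum.inr nb)], le_rfl,
    le_rfl, nb + 1, nr, h.append_bit (by simp [Gate.Avoids]) fun ω => ?_⟩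
  simp [Circuit.run, Gate.step, hif, Config.xorBit_xorBit]

theorem bitFrom_pos_mem (hu : Sum.inr u ∈ S) :
    BitFrom O c S 1 (fun ω => (@decide (0 < u ω) (Classical.propDecidable _))) := by
  rintro P A hA ⟨nb, nr, h⟩
  obtain ⟨i, hi, hiu⟩ := h.real u (hA hu)
  refine ⟨[.pos (Sum.inr i) (Sum.inr nb)], le_rfl, le_rfl, nb + 1, nr,
    h.append_bit (by simp [Gate.Avoids]) fun ω => ?_⟩
  simp [Circuit.run, Gate.step, hiu]

theorem realFrom_const (r : ℝ) : RealFrom O c S 1 (fun _ => r) := by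
  rintro P A hA ⟨nb, nr, h⟩
  refine ⟨[.const r (Sum.inr nr)], le_rfl, le_rfl, nb, nr + 1,
    h.append_real (by simp [Gate.Avoids]) fun ω => ?_⟩
  simp [Circuit.run, Gate.step]

theorem Config.addReal_addReal (d : Config β ρ) (t : ρ) (neg : Bool) (x y : ℝ) :
    (d.addReal false t x).addReal neg t y = d.addReal false t (x + if neg then -y else y) := by
  simp [Config.addReal, add_assoc]

theorem realFrom_add_mem (hu : Sum.inr u ∈ S) (hv : Sum.inr v ∈ S) :
    RealFrom O c S 2 (fun ω => u ω + v ω) := by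
  rintro P A hA ⟨nb, nr, h⟩
  obtain ⟨i, hi, hiu⟩ := h.real u (hA hu)
  obtain ⟨j, hj, hjv⟩ := h.real v (hA hv)
  have hi' : (Sum.inr i : ρ ⊕ ℕ) ≠ Sum.inr nr := by simp; omega
  have hj' : (Sum.inr j : ρ ⊕ ℕ) ≠ Sum.inr nr := by simp; omega
  refine ⟨[.add false (Sum.inr i) (Sum.inr nr) hi', .add false (Sum.inr j) (Sum.inr nr) hj'],
    le_rfl, le_rfl, nb, nr + 1, h.append_real (by simp [Gate.Avoids]) fun ω => ?_⟩
  have h1 : ((after O c P ω).addReal false (Sum.inr nr) (u ω)).real (Sum.inr j) = v ω := by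
    rw [← hjv]; simp [Config.addReal, hj']
  simp [Circuit.run, Gate.step, hiu, h1, Config.addReal_addReal]

theorem realFrom_sub_mem (hu : Sum.inr u ∈ S) (hv : Sum.inr v ∈ S) :
    RealFrom O c S 2 (fun ω => u ω - v ω) := by
  rintro P A hA ⟨nb, nr, h⟩
  obtain ⟨i, hi, hiu⟩ := h.real u (hA hu)
  obtain ⟨j, hj, hjv⟩ := h.real v (hA hv)
  have hi' : (Sum.inr i : ρ ⊕ ℕ) ≠ Sum.inr nr := by simp; omega
  have hj' : (Sum.inr j : ρ ⊕ ℕ) ≠ Sum.inr nr := by simp; omega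
  refine ⟨[.add false (Sum.inr i) (Sum.inr nr) hi', .add true (Sum.inr j) (Sum.inr nr) hj'],
    le_rfl, le_rfl, nb, nr + 1, h.append_real (by simp [Gate.Avoids]) fun ω => ?_⟩
  have h1 : ((after O c P ω).addReal false (Sum.inr nr) (u ω)).real (Sum.inr j) = v ω := by
    rw [← hjv]; simp [Config.addReal, hj']
  simp [Circuit.run, Gate.step, hiu, h1, Config.addReal_addReal, sub_eq_add_neg]

theorem realFrom_mul_mem (hu : Sum.inr u ∈ S) (hv : Sum.inr v ∈ S) :
    RealFrom O c S 1 (fun ω => u ω * v ω) := by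
  rintro P A hA ⟨nb, nr, h⟩
  obtain ⟨i, hi, hiu⟩ := h.real u (hA hu)
  obtain ⟨j, hj, hjv⟩ := h.real v (hA hv)
  refine ⟨[.mul false (Sum.inr i) (Sum.inr j) (Sum.inr nr) (by simp; omega) (by simp; omega)],
    le_rfl, le_rfl, nb, nr + 1, h.append_real (by simp [Gate.Avoids]) fun ω => ?_⟩
  simp [Circuit.run, Gate.step, hiu, hjv]

theorem realFrom_inv_mem (hu : Sum.inr u ∈ S) : RealFrom O c S 1 (fun ω => (u ω)⁻¹) := by
  rintro P A hA ⟨nb, nr, h⟩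
  obtain ⟨i, hi, hiu⟩ := h.real u (hA hu)
  refine ⟨[.inv false (Sum.inr i) (Sum.inr nr) (by simp; omega)],
    le_rfl, le_rfl, nb, nr + 1, h.append_real (by simp [Gate.Avoids]) fun ω => ?_⟩
  simp [Circuit.run, Gate.step, hiu]

theorem realFrom_ofBit_mem (hf : Sum.inl f ∈ S) :
    RealFrom O c S 1 (fun ω => if f ω then 1 else 0) := by
  rintro P A hA ⟨nb, nr, h⟩
  obtain ⟨i, hi, hif⟩ := h.bit f (hA hf)
  refine ⟨[.ofBit false i (Sum.inr nr)], le_rfl, le_rfl, nb, nr + 1,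
    h.append_real (by simp [Gate.Avoids]) fun ω => ?_⟩
  simp [Circuit.run, Gate.step, hif]

theorem derives_entry {x y : Ω → Bits n} (hx : ∀ j, Sum.inl (fun ω => x ω j) ∈ S)
    (hy : ∀ j, Sum.inl (fun ω => y ω j) ∈ S) :
    Derives O c S 1 1 {Sum.inr fun ω => (O ω).entry (x ω) (y ω)} := by
  rintro P A hA ⟨nb, nr, h⟩
  choose wx _ hwx using fun j => h.bit _ (hA (hx j))
  choose wy _ hwy using fun j => h.bit _ (hA (hy j))
  refine ⟨[.queryEntry false wx wy (Sum.inr nr)], le_rfl, le_rfl, nb, nr + 1,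
    h.append_real (by simp [Gate.Avoids]) fun ω => ?_⟩
  simp [Circuit.run, Gate.step, hwx, hwy]

theorem derives_adj {x : Ω → Bits n} (hx : ∀ j, Sum.inl (fun ω => x ω j) ∈ S) :
    Derives O c S 1 1 (Set.range fun p => Sum.inl fun ω => (O ω).adjBits (x ω) p) := by
  rintro P A hA ⟨nb, nr, h⟩
  choose wx hwx' hwx using fun j => h.bit _ (hA (hx j))
  -- The answer fills a block of fresh ancillas that starts at nb.
  let e := Fintype.equivFin (Fin s × Option (Fin n))
  let ans : Fin s × Option (Fin n) ↪ β ⊕ ℕ :=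
    ⟨fun p => Sum.inr (nb + e p), fun p p' hp => by
      simpa [Fin.val_inj] using hp⟩
  have hans : ∀ j p, wx j ≠ ans p := fun j p => hwx' j _ (Nat.le_add_right _ _)
  set Q : Circuit n s (β ⊕ ℕ) (ρ ⊕ ℕ) := [.queryAdj wx ans hans] with hQ
  have hrun : ∀ ω w, (after O c (P ++ Q) ω).bit w = xor ((after O c P ω).bit w)
      (Function.extend ans ((O ω).adjBits (x ω)) (fun _ => false) w) := by
    intro ω w
    rw [after_append]
    simp [hQ, Circuit.run, Gate.step, hwx]
  have hreal : ∀ ω, (after O c (P ++ Q) ω).real = (after O c P ω).real := by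
    intro ω
    rw [after_append]
    simp [hQ, Circuit.run, Gate.step]
  have hold : ∀ ω w, (∀ p, w ≠ ans p) → (after O c (P ++ Q) ω).bit w = (after O c P ω).bit w := by
    intro ω w hw
    rw [hrun, Function.extend_apply' _ _ _ (by rintro ⟨p, hp⟩; exact hw p hp.symm)]
    simp
  refine ⟨Q, le_rfl, le_rfl, nb + Fintype.card (Fin s × Option (Fin n)), nr, ⟨fun g hg => ?_,
    fun ω k hk => ?_, fun ω k hk => ?_, fun f' hf' => ?_, fun f' hf' => ?_⟩⟩
  · rcases List.mem_append.mp hg with hg | hg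
    · exact h.avoids g hg
    · intro t
      rw [hQ, List.mem_singleton] at hg
      subst hg
      trivial
  · rw [hold]
    · exact h.bit_zero ω k (by omega)
    · intro p hp
      have h1 := (e p).2
      have h2 : k = nb + e p :=
        Sum.inr_injective (show (Sum.inr k : β ⊕ ℕ) = Sum.inr (nb + e p) from hp)
      omega
  · rw [hreal]; exact h.real_zero ω k hk
  · rcases hf' with hf' | ⟨p, hp⟩
    · obtain ⟨w, hw, hwf⟩ := h.bit f' hf'
      refine ⟨w, fun k hk => hw k (by omega), fun ω => ?_⟩
      rw [hold ω w fun p => hw _ (Nat.le_add_right _ _), hwf]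
    · have hp' : (fun ω => (O ω).adjBits (x ω) p) = f' := by simpa using hp
      subst hp'
      refine ⟨ans p, fun k hk hk' => ?_, fun ω => ?_⟩
      · have h1 := (e p).2
        have h2 : nb + e p = k :=
          Sum.inr_injective (show (Sum.inr (nb + e p) : β ⊕ ℕ) = Sum.inr k from hk')
        omega
      · rw [hrun, ans.injective.extend_apply]
        have : (after O c P ω).bit (ans p) = false := h.bit_zero ω _ (Nat.le_add_right _ _)
        rw [this, Bool.false_xor]
  · rcases hf' with hf' | ⟨p, hp⟩
    · obtain ⟨w, hw, hwf⟩ := h.real f' hf'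
      exact ⟨w, hw, fun ω => by rw [hreal, hwf]⟩
    · simp at hp

end Derive

end StoqTFD
end

noncomputable section
namespace StoqTFD

/-! ### Composite steps -/

section Combine

variable {n s : ℕ} {β ρ : Type} [DecidableEq β] [DecidableEq ρ] {Ω : Type*}
  {O : Ω → Oracle n s} {c : Ω → Config β ρ} {S S' : Set (Fn Ω)} {l l' : ℕ}
  {f g : Ω → Bool} {u v : Ω → ℝ}

theorem BitFrom.congr (h : BitFrom O c S l f) (hfg : ∀ ω, f ω = g ω) : BitFrom O c S l g := by
  rwa [← funext hfg]

theorem RealFrom.congr (h : RealFrom O c S l u) (huv : ∀ ω, u ω = v ω) : RealFrom O c S l v := by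
  rwa [← funext huv]

theorem BitFrom.mono (h : BitFrom O c S l f) (hS : S ⊆ S') (hl : l ≤ l') : BitFrom O c S' l' f :=
  Derives.mono h hS le_rfl le_rfl hl

theorem RealFrom.mono (h : RealFrom O c S l u) (hS : S ⊆ S') (hl : l ≤ l') :
    RealFrom O c S' l' u :=
  Derives.mono h hS le_rfl le_rfl hl

theorem Derives.bind₂ {T T' U : Set (Fn Ω)} {l'' : ℕ} (h : Derives O c S 0 l T)
    (h' : Derives O c S 0 l' T') (h'' : Derives O c (S ∪ (T ∪ T')) 0 l'' U) :
    Derives O c S 0 (l + l' + l'') U :=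
  (Derives.union h h').bind h''

theorem bitFrom_const (b : Bool) : BitFrom O c S 1 (fun _ => b) := by
  rintro P A hA ⟨nb, nr, h⟩
  cases b
  · refine ⟨[], le_rfl, by simp, nb + 1, nr, h.append_bit (by simp) fun ω => ?_⟩
    simp [Circuit.run, Config.xorBit_false]
  · refine ⟨[.not (Sum.inr nb)], le_rfl, le_rfl, nb + 1, nr,
      h.append_bit (by simp [Gate.Avoids]) fun ω => ?_⟩
    simp [Circuit.run, Gate.step]

theorem bitFrom_xor_mem (hf : Sum.inl f ∈ S) (hg : Sum.inl g ∈ S) :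
    BitFrom O c S 2 (fun ω => xor (f ω) (g ω)) := by
  rintro P A hA ⟨nb, nr, h⟩
  obtain ⟨i, hi, hif⟩ := h.bit f (hA hf)
  obtain ⟨j, hj, hjg⟩ := h.bit g (hA hg)
  refine ⟨[.toffoli i i (Sum.inr nb) (hi nb le_rfl) (hi nb le_rfl),
    .toffoli j j (Sum.inr nb) (hj nb le_rfl) (hj nb le_rfl)], le_rfl,
    le_rfl, nb + 1, nr, h.append_bit (by simp [Gate.Avoids]) fun ω => ?_⟩
  have h1 : ∀ b, ((after O c P ω).xorBit (Sum.inr nb) b).bit j = g ω := by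
    intro b
    rw [← hjg]
    simp [Config.xorBit, hj nb le_rfl]
  simp [Circuit.run, Gate.step, hif, h1, Config.xorBit_xorBit]

theorem BitFrom.not (hf : BitFrom O c S l f) : BitFrom O c S (l + 2) (fun ω => !f ω) :=
  (hf.bind (bitFrom_not_mem (by simp))).mono le_rfl le_rfl le_rfl le_rfl

theorem BitFrom.and (hf : BitFrom O c S l f) (hg : BitFrom O c S l' g) :
    BitFrom O c S (l + l' + 1) (fun ω => f ω && g ω) :=
  Derives.bind₂ hf hg (bitFrom_and_mem (by simp) (by simp))

theorem BitFrom.xor (hf : BitFrom O c S l f) (hg : BitFrom O c S l' g) :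
    BitFrom O c S (l + l' + 2) (fun ω => Bool.xor (f ω) (g ω)) :=
  Derives.bind₂ hf hg (bitFrom_xor_mem (by simp) (by simp))

theorem BitFrom.beq (hf : BitFrom O c S l f) (hg : BitFrom O c S l' g) :
    BitFrom O c S (l + l' + 2 + 2) (fun ω => decide (f ω = g ω)) :=
  (hf.xor hg).not.congr fun ω => by cases f ω <;> cases g ω <;> rfl

theorem RealFrom.pos (hu : RealFrom O c S l u) :
    BitFrom O c S (l + 1) (fun ω => @decide (0 < u ω) (Classical.propDecidable _)) :=
  (hu.bind (bitFrom_pos_mem (by simp))).mono le_rfl le_rfl le_rfl le_rfl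

theorem RealFrom.add (hu : RealFrom O c S l u) (hv : RealFrom O c S l' v) :
    RealFrom O c S (l + l' + 2) (fun ω => u ω + v ω) :=
  Derives.bind₂ hu hv (realFrom_add_mem (by simp) (by simp))

theorem RealFrom.sub (hu : RealFrom O c S l u) (hv : RealFrom O c S l' v) :
    RealFrom O c S (l + l' + 2) (fun ω => u ω - v ω) :=
  Derives.bind₂ hu hv (realFrom_sub_mem (by simp) (by simp))

theorem RealFrom.mul (hu : RealFrom O c S l u) (hv : RealFrom O c S l' v) :
    RealFrom O c S (l + l' + 1) (fun ω => u ω * v ω) :=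
  Derives.bind₂ hu hv (realFrom_mul_mem (by simp) (by simp))

theorem RealFrom.inv (hu : RealFrom O c S l u) : RealFrom O c S (l + 1) (fun ω => (u ω)⁻¹) :=
  (hu.bind (realFrom_inv_mem (by simp))).mono le_rfl le_rfl le_rfl le_rfl

theorem BitFrom.toReal (hf : BitFrom O c S l f) :
    RealFrom O c S (l + 1) (fun ω => if f ω then 1 else 0) :=
  (hf.bind (realFrom_ofBit_mem (by simp))).mono le_rfl le_rfl le_rfl le_rfl

theorem RealFrom.ite (hf : BitFrom O c S l f) (hu : RealFrom O c S l' u) :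
    RealFrom O c S (l + l' + 2) (fun ω => if f ω then u ω else 0) :=
  ((hf.toReal.mul hu).mono le_rfl (by omega)).congr fun ω => by split <;> simp

theorem RealFrom.const_mul (r : ℝ) (hu : RealFrom O c S l u) :
    RealFrom O c S (l + 2) (fun ω => r * u ω) :=
  ((realFrom_const r).mul hu).mono le_rfl (by omega)

theorem RealFrom.const_add (r : ℝ) (hu : RealFrom O c S l u) :
    RealFrom O c S (l + 3) (fun ω => r + u ω) :=
  ((realFrom_const r).add hu).mono le_rfl (by omega)

theorem RealFrom.sub_const (hu : RealFrom O c S l u) (r : ℝ) :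
    RealFrom O c S (l + 3) (fun ω => u ω - r) :=
  (hu.sub (realFrom_const r)).mono le_rfl (by omega)

theorem RealFrom.finsetSum {ι : Type*} (t : Finset ι) {u : ι → Ω → ℝ}
    (h : ∀ i ∈ t, RealFrom O c S l (u i)) :
    RealFrom O c S (t.card * (l + 2) + 1) (fun ω => ∑ i ∈ t, u i ω) := by
  classical
  induction t using Finset.induction_on with
  | empty => exact ((realFrom_const 0).mono le_rfl (by simp)).congr fun ω => by simp
  | insert i t hi ih =>
    have h1 := (h i (Finset.mem_insert_self i t)).add
      (ih fun j hj => h j (Finset.mem_insert_of_mem hj))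
    refine (h1.mono le_rfl ?_).congr fun ω => by rw [Finset.sum_insert hi]
    rw [Finset.card_insert_of_notMem hi]
    ring_nf
    rfl

theorem RealFrom.sum {ι : Type*} [Fintype ι] {u : ι → Ω → ℝ} (h : ∀ i, RealFrom O c S l (u i)) :
    RealFrom O c S (Fintype.card ι * (l + 2) + 1) (fun ω => ∑ i, u i ω) :=
  RealFrom.finsetSum Finset.univ fun i _ => h i

/-- The failures are counted as a real number, and the conjunction holds if this number is not
positive. -/
theorem BitFrom.all {ι : Type*} [Fintype ι] {f : ι → Ω → Bool} (h : ∀ i, BitFrom O c S l (f i)) :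
    BitFrom O c S (Fintype.card ι * (l + 5) + 4)
      (fun ω => @decide (∀ i, f i ω = true) (Classical.propDecidable _)) := by
  refine ((RealFrom.sum fun i => (h i).not.toReal).pos.not.mono le_rfl (le_of_eq (by ring))).congr
    fun ω => ?_
  have h1 : (0 < ∑ i, if (!f i ω) = true then (1 : ℝ) else 0) ↔ ¬ ∀ i, f i ω = true := by
    rw [Finset.sum_pos_iff_of_nonneg fun i _ => by split <;> simp]
    simp only [Finset.mem_univ, true_and, not_forall]
    exact exists_congr fun i => by cases f i ω <;> simp
  rw [Bool.eq_iff_iff, Bool.not_eq_true', decide_eq_false_iff_not, h1, not_not]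
  exact (@decide_eq_true_iff _ (Classical.propDecidable _)).symm

/-- Two sign tests: neither difference is positive. -/
theorem BitFrom.eq_nat {i : Ω → ℕ} (r : ℕ) (h : RealFrom O c S l fun ω => (i ω : ℝ)) :
    BitFrom O c S (2 * l + 13) (fun ω => decide (r = i ω)) := by
  have h1 := (h.sub_const r).pos.not.and (((realFrom_const (r : ℝ)).sub h).pos.not)
  refine (h1.mono le_rfl (by omega)).congr fun ω => ?_
  rw [Bool.eq_iff_iff]
  simp only [Bool.and_eq_true, Bool.not_eq_true', decide_eq_false_iff_not, sub_pos, not_lt,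
    Nat.cast_le, decide_eq_true_eq]
  omega

end Combine

end StoqTFD
end

noncomputable section
namespace StoqTFD
open Finset

/-! ### The edges seen through an oracle -/

/-- The string in slot `l` of the adjacency list of `u`. -/
def Oracle.slot {n s : ℕ} (O : Oracle n s) (u : Bits n) (l : Fin s) : Bits n :=
  fun j => O.adjBits u (l, some j)

open Classical in
/-- Whether slot `l` of the adjacency list of `u` holds an edge. -/
def Oracle.hasEdge {n s : ℕ} (O : Oracle n s) (θ : ℝ) (u : Bits n) (l : Fin s) : Bool :=
  (O.adjBits u (l, none) && decide (0 < -θ - O.entry u (O.slot u l))) &&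
    !decide (∀ j, decide (u j = O.slot u l j) = true)

/-- The entries are symmetric, and those which do not vanish are listed once. -/
structure Oracle.Regular {n s : ℕ} (O : Oracle n s) : Prop where
  symm : ∀ x y, O.entry x y = O.entry y x
  listed : ∀ x y, O.entry x y ≠ 0 → ∃ l, O.adj x l = some y
  inj : ∀ x i j y, O.adj x i = some y → O.adj x j = some y → i = j

section Slots

variable {n s : ℕ} {O : Oracle n s} {θ : ℝ}

theorem Oracle.slot_eq {u y : Bits n} {l : Fin s} (h : O.adj u l = some y) : O.slot u l = y := by
  funext j
  simp [Oracle.slot, Oracle.adjBits, h]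

/-- An empty slot reads as the zero string; the flag tells it apart from a slot that holds that
string. -/
theorem Oracle.hasEdge_iff {u : Bits n} {l : Fin s} :
    O.hasEdge θ u l = true ↔ O.adj u l = some (O.slot u l) ∧ Edge O.entry θ u (O.slot u l) := by
  have h1 : O.adjBits u (l, none) = true ↔ O.adj u l = some (O.slot u l) := by
    constructor
    · intro h
      obtain ⟨y, hy⟩ := Option.isSome_iff_exists.mp (show (O.adj u l).isSome = true from h)
      rw [O.slot_eq hy, hy]
    · intro h
      simp [Oracle.adjBits, h]
  have h2 : (∀ j, u j = O.slot u l j) ↔ u = O.slot u l := funext_iff.symm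
  have h3 : 0 < -θ - O.entry u (O.slot u l) ↔ θ < -O.entry u (O.slot u l) := by
    constructor <;> intro h <;> linarith
  simp only [Oracle.hasEdge, Bool.and_eq_true, decide_eq_true_eq, Bool.not_eq_true',
    decide_eq_false_iff_not, h1, h2, h3, Edge]
  tauto

open Classical in
-- An edge has a nonzero entry, so its end is listed, and in one slot only. Sums over edges are thus
-- computed from any oracle, with a result that does not depend on the order of its lists.
theorem Oracle.Regular.sum_edge (hO : O.Regular) (hθ : 0 ≤ θ) (u : Bits n) (F : Bits n → ℝ) :
    (∑ y, if Edge O.entry θ u y then F y else 0) =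
      ∑ l, if O.hasEdge θ u l then F (O.slot u l) else 0 := by
  rw [← sum_filter, ← sum_filter]
  symm
  refine sum_nbij (O.slot u) (fun l hl => ?_) (fun l hl l' hl' hll => ?_) (fun y hy => ?_)
    fun _ _ => rfl
  · rw [mem_filter] at hl ⊢
    exact ⟨mem_univ _, (O.hasEdge_iff.mp hl.2).2⟩
  · have h1 := (O.hasEdge_iff.mp (mem_filter.mp hl).2).1
    have h2 := (O.hasEdge_iff.mp (mem_filter.mp hl').2).1
    rw [← hll] at h2
    exact hO.inj _ _ _ _ h1 h2
  · have h1 : Edge O.entry θ u y := (mem_filter.mp hy).2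
    have h2 : O.entry u y ≠ 0 := by
      intro h
      have := h1.2
      rw [h] at this
      linarith
    obtain ⟨l, hl⟩ := hO.listed u y h2
    have h3 := O.slot_eq hl
    refine ⟨l, ?_, h3⟩
    rw [mem_coe, mem_filter]
    refine ⟨mem_univ _, O.hasEdge_iff.mpr ?_⟩
    rw [h3]
    exact ⟨hl, h1⟩

open Classical in
theorem Oracle.Regular.rank_eq (hO : O.Regular) (hθ : 0 ≤ θ) (x y : Bits n) :
    (rank O.entry θ x y : ℝ) = ∑ l, if O.hasEdge θ x l then
      (if decide (0 < binVal y - binVal (O.slot x l)) = true then 1 else 0) else 0 := by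
  rw [← hO.sum_edge hθ x fun y' => if decide (0 < binVal y - binVal y') = true then 1 else 0]
  simp only [rank, decide_eq_true_eq, sub_pos, ← ite_and]
  rw [← sum_filter, sum_const, nsmul_one]

end Slots

/-! ### Tables of edges -/

section Tables

variable {n s : ℕ} {β ρ : Type} [DecidableEq β] [DecidableEq ρ] {Ω : Type*}
  {O : Ω → Oracle n s} {c : Ω → Config β ρ} {S : Set (Fn Ω)} {θ : ℝ}

/-- All bits of a string are available. -/
def HasBits {m : ℕ} (S : Set (Fn Ω)) (u : Ω → Bits m) : Prop :=
  ∀ j, Sum.inl (fun ω => u ω j) ∈ S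

theorem HasBits.mono {m : ℕ} {S S' : Set (Fn Ω)} {u : Ω → Bits m} (h : HasBits S u)
    (hS : S ⊆ S') : HasBits S' u := fun j => hS (h j)

/-- The strings in the adjacency list of `u`, the matrix elements, and the slots with edges. -/
def table (O : Ω → Oracle n s) (θ : ℝ) (u : Ω → Bits n) : Set (Fn Ω) :=
  (Set.range fun p => Sum.inl fun ω => (O ω).adjBits (u ω) p) ∪
    (⋃ l, {Sum.inr fun ω => (O ω).entry (u ω) ((O ω).slot (u ω) l)}) ∪
    ⋃ l, {Sum.inl fun ω => (O ω).hasEdge θ (u ω) l}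

theorem hasBits_slot {u : Ω → Bits n} (h : table O θ u ⊆ S) (l : Fin s) :
    HasBits S fun ω => (O ω).slot (u ω) l :=
  fun j => h (Or.inl (Or.inl ⟨(l, some j), rfl⟩))

theorem entry_mem {u : Ω → Bits n} (h : table O θ u ⊆ S) (l : Fin s) :
    Sum.inr (fun ω => (O ω).entry (u ω) ((O ω).slot (u ω) l)) ∈ S :=
  h (Or.inl (Or.inr (Set.mem_iUnion.mpr ⟨l, rfl⟩)))

theorem hasEdge_mem {u : Ω → Bits n} (h : table O θ u ⊆ S) (l : Fin s) :
    Sum.inl (fun ω => (O ω).hasEdge θ (u ω) l) ∈ S :=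
  h (Or.inr (Set.mem_iUnion.mpr ⟨l, rfl⟩))

theorem derives_table {u : Ω → Bits n} (hu : HasBits S u) :
    Derives O c S (1 + s) (1 + s * (9 * n + 13)) (table O θ u) := by
  set T₁ : Set (Fn Ω) := Set.range fun p => Sum.inl fun ω => (O ω).adjBits (u ω) p with hT₁
  set T₂ : Set (Fn Ω) := ⋃ l, {Sum.inr fun ω => (O ω).entry (u ω) ((O ω).slot (u ω) l)} with hT₂
  have h1 : Derives O c S 1 1 T₁ := derives_adj hu
  have hs : ∀ l, HasBits (S ∪ T₁) fun ω => (O ω).slot (u ω) l :=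
    fun l j => Or.inr ⟨(l, some j), rfl⟩
  have h2 : Derives O c (S ∪ T₁) s s T₂ := by
    have := Derives.iUnion (O := O) (c := c) fun l =>
      derives_entry (hu.mono Set.subset_union_left) (hs l)
    rwa [Fintype.card_fin, mul_one] at this
  have h3 : ∀ l, Derives O c (S ∪ (T₁ ∪ T₂)) 0 (9 * n + 12)
      {Sum.inl fun ω => (O ω).hasEdge θ (u ω) l} := by
    intro l
    have e1 : BitFrom O c (S ∪ (T₁ ∪ T₂)) 0 fun ω => (O ω).adjBits (u ω) (l, none) :=
      bitFrom_mem (Or.inr (Or.inl ⟨(l, none), rfl⟩))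
    have e2 : RealFrom O c (S ∪ (T₁ ∪ T₂)) 0 fun ω => (O ω).entry (u ω) ((O ω).slot (u ω) l) :=
      realFrom_mem (Or.inr (Or.inr (Set.mem_iUnion.mpr ⟨l, rfl⟩)))
    have e3 : ∀ j, BitFrom O c (S ∪ (T₁ ∪ T₂)) 4
        fun ω => decide (u ω j = (O ω).slot (u ω) l j) := fun j =>
      (bitFrom_mem (Or.inl (hu j))).beq (bitFrom_mem (Or.inr (Or.inl ⟨(l, some j), rfl⟩)))
    have e4 := (e1.and ((realFrom_const (-θ)).sub e2).pos).and (BitFrom.all e3).not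
    refine BitFrom.congr (e4.mono subset_rfl ?_) fun ω => ?_
    · rw [Fintype.card_fin]
      omega
    · rw [Bool.eq_iff_iff]
      simp [Oracle.hasEdge]
  have h4 : Derives O c (S ∪ T₁ ∪ T₂) 0 (s * (9 * n + 12))
      (⋃ l, {Sum.inl fun ω => (O ω).hasEdge θ (u ω) l}) := by
    have := Derives.iUnion h3
    rwa [Fintype.card_fin, mul_zero, ← Set.union_assoc] at this
  have h5 := h1.bind_keep (h2.bind_keep h4)
  rw [← Set.union_assoc] at h5
  exact h5.mono subset_rfl subset_rfl (by omega) (le_of_eq (by ring))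

theorem realFrom_binVal {y : Ω → Bits n} (hy : HasBits S y) :
    RealFrom O c S (5 * n + 1) fun ω => binVal (y ω) := by
  refine (RealFrom.sum fun b : Fin n =>
    RealFrom.ite (bitFrom_mem (hy b)) (realFrom_const ((2 : ℝ) ^ (b : ℕ)))).mono subset_rfl ?_
  rw [Fintype.card_fin]
  omega

theorem realFrom_rank (hO : ∀ ω, (O ω).Regular) (hθ : 0 ≤ θ) {x y : Ω → Bits n}
    (hx : table O θ x ⊆ S) (hy : HasBits S y) :
    RealFrom O c S (s * (10 * n + 10) + 1) fun ω => (rank (O ω).entry θ (x ω) (y ω) : ℝ) := by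
  refine RealFrom.congr ((RealFrom.sum fun l : Fin s => RealFrom.ite
    (bitFrom_mem (hasEdge_mem hx l)) ((realFrom_binVal hy).sub
      (realFrom_binVal (hasBits_slot hx l))).pos.toReal).mono subset_rfl ?_)
    fun ω => ((hO ω).rank_eq hθ _ _).symm
  rw [Fintype.card_fin]
  refine Nat.add_le_add_right (Nat.mul_le_mul_left _ ?_) 1
  omega

/-- The table of `u`, the tables of its neighbours, and the ranks of the edges at `u`. -/
def fullTable (O : Ω → Oracle n s) (θ : ℝ) (u : Ω → Bits n) : Set (Fn Ω) :=
  (table O θ u ∪ ⋃ l, table O θ fun ω => (O ω).slot (u ω) l) ∪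
    ⋃ l, ({Sum.inr fun ω => (rank (O ω).entry θ (u ω) ((O ω).slot (u ω) l) : ℝ)} ∪
      {Sum.inr fun ω => (rank (O ω).entry θ ((O ω).slot (u ω) l) (u ω) : ℝ)})

theorem table_subset_fullTable (u : Ω → Bits n) : table O θ u ⊆ fullTable O θ u :=
  Set.subset_union_left.trans Set.subset_union_left

theorem rank_mem {u : Ω → Bits n} (h : fullTable O θ u ⊆ S) (l : Fin s) :
    Sum.inr (fun ω => (rank (O ω).entry θ (u ω) ((O ω).slot (u ω) l) : ℝ)) ∈ S :=
  h (Or.inr (Set.mem_iUnion.mpr ⟨l, Or.inl rfl⟩))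

theorem rank_mem' {u : Ω → Bits n} (h : fullTable O θ u ⊆ S) (l : Fin s) :
    Sum.inr (fun ω => (rank (O ω).entry θ ((O ω).slot (u ω) l) (u ω) : ℝ)) ∈ S :=
  h (Or.inr (Set.mem_iUnion.mpr ⟨l, Or.inr rfl⟩))

/-- The incoming label of an edge is a rank among the neighbours of the other end, so the table of
every neighbour is needed: 1 + s tables with 1 + s queries each. Empty slots are processed alike,
since the circuit is fixed, and `hasEdge` discards them later. -/
theorem derives_fullTable (hO : ∀ ω, (O ω).Regular) (hθ : 0 ≤ θ) {u : Ω → Bits n}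
    (hu : HasBits S u) :
    Derives O c S ((1 + s) ^ 2) ((1 + s) * (1 + s * (9 * n + 13)) +
      s * (2 * (s * (10 * n + 10) + 1))) (fullTable O θ u) := by
  set T₁ : Set (Fn Ω) := table O θ u with hT₁
  set T₂ : Set (Fn Ω) := ⋃ l, table O θ fun ω => (O ω).slot (u ω) l with hT₂
  have h1 : Derives O c S (1 + s) (1 + s * (9 * n + 13)) T₁ := derives_table hu
  have h2 : Derives O c (S ∪ T₁) (s * (1 + s)) (s * (1 + s * (9 * n + 13))) T₂ := by
    have := Derives.iUnion (O := O) (c := c) fun l =>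
      derives_table (θ := θ) (hasBits_slot (S := S ∪ T₁) Set.subset_union_right l)
    rwa [Fintype.card_fin] at this
  have h3 : ∀ l, Derives O c (S ∪ T₁ ∪ T₂) 0 (2 * (s * (10 * n + 10) + 1))
      ({Sum.inr fun ω => (rank (O ω).entry θ (u ω) ((O ω).slot (u ω) l) : ℝ)} ∪
      {Sum.inr fun ω => (rank (O ω).entry θ ((O ω).slot (u ω) l) (u ω) : ℝ)}) := by
    intro l
    have s1 : table O θ u ⊆ S ∪ T₁ ∪ T₂ := Set.subset_union_right.trans Set.subset_union_left
    have s2 : (table O θ fun ω => (O ω).slot (u ω) l) ⊆ S ∪ T₁ ∪ T₂ :=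
      (Set.subset_iUnion (fun l => table O θ fun ω => (O ω).slot (u ω) l) l).trans
        Set.subset_union_right
    have e1 := realFrom_rank (c := c) hO hθ s1 (hasBits_slot s1 l)
    have e2 := realFrom_rank (c := c) hO hθ s2
      (hu.mono (Set.subset_union_left.trans Set.subset_union_left))
    exact (Derives.union e1 e2).mono subset_rfl subset_rfl le_rfl (le_of_eq (by ring))
  have h4 := Derives.iUnion h3
  rw [Fintype.card_fin, mul_zero] at h4
  have h5 := h1.bind_keep (h2.bind_keep h4)
  rw [← Set.union_assoc] at h5
  exact h5.mono subset_rfl subset_rfl (le_of_eq (by ring)) (le_of_eq (by ring))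

end Tables

end StoqTFD
end

noncomputable section
namespace StoqTFD
open Finset Site

/-! ### The energies seen through an oracle -/

section EnergyFormula

variable {n s : ℕ}

/-- The first data register of the first half. -/
def leftString (z : Bits (6 * n + 4 * s)) : Bits n :=
  fun b => z (Site.equiv (data false false b : Site n s))

/-- The first data register of the second half. -/
def rightString (z : Bits (6 * n + 4 * s)) : Bits n :=
  fun b => z (Site.equiv (data true false b : Site n s))

theorem leftString_encString (x : Bits n) : leftString (encString s x) = x := by
  funext b
  rw [leftString, encString_equiv, base]

variable {h : Bits n → Bits n → ℝ} {θ : ℝ} {x y : Bits n} {p : ℕ}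

theorem leftString_path (hp : p ≤ 2 * n + 6) : leftString (path h θ s x y p) = x := by
  funext b
  rw [leftString, path, Equiv.symm_apply_apply, state_data_false hp]

theorem rightString_path (hp : 2 * n + 2 ≤ p) (hp' : p ≤ 4 * n + 8) :
    rightString (path h θ s x y p) = y := by
  funext b
  rw [rightString, path, Equiv.symm_apply_apply, state_data_true hp hp']

theorem eq_encString_iff {z : Bits (6 * n + 4 * s)} :
    z = encString s x ↔ ∀ q : Site n s, z (Site.equiv q) = base x q := by
  constructor
  · rintro rfl q
    exact encString_equiv x q
  · intro hz
    funext k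
    obtain ⟨q, rfl⟩ := Site.equiv.surjective k
    rw [hz, encString_equiv]

theorem eq_path_iff {z : Bits (6 * n + 4 * s)} :
    z = path h θ s x y p ↔
      ∀ q : Site n s, z (Site.equiv q) = state x y (rank h θ x y) (rank h θ y x) p q := by
  constructor
  · rintro rfl q
    rw [path, Equiv.symm_apply_apply]
  · intro hz
    funext k
    obtain ⟨q, rfl⟩ := Site.equiv.surjective k
    rw [hz, path, Equiv.symm_apply_apply]

variable {O : Oracle n s}

open Classical in
-- Up to place 2n+6 the first half of a path vertex displays the start of its path, so the only
-- candidates are the edges at the string read off z. From place 2n+2 on, the second half displays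
-- the end in the same way.
theorem Oracle.Regular.sum_path_left (hO : O.Regular) (hθ : 0 ≤ θ) (z : Bits (6 * n + 4 * s))
    (hp : p ≤ 2 * n + 6) (f : Bits n → Bits n → ℝ) :
    (∑ x, ∑ y, if Edge O.entry θ x y ∧ z = path O.entry θ s x y p then f x y else 0) =
      ∑ l, if O.hasEdge θ (leftString z) l then
        (if z = path O.entry θ s (leftString z) (O.slot (leftString z) l) p then
          f (leftString z) (O.slot (leftString z) l) else 0) else 0 := by
  rw [sum_eq_single (leftString z)]
  · simp only [ite_and]
    exact hO.sum_edge hθ _ fun y =>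
      if z = path O.entry θ s (leftString z) y p then f (leftString z) y else 0
  · intro x _ hx
    refine sum_eq_zero fun y _ => if_neg ?_
    rintro ⟨-, h⟩
    exact hx (by rw [h, leftString_path hp])
  · exact fun h => absurd (mem_univ _) h

open Classical in
theorem Oracle.Regular.sum_path_right (hO : O.Regular) (hθ : 0 ≤ θ) (z : Bits (6 * n + 4 * s))
    (hp : 2 * n + 2 ≤ p) (hp' : p ≤ 4 * n + 8) (f : Bits n → Bits n → ℝ) :
    (∑ x, ∑ y, if Edge O.entry θ x y ∧ z = path O.entry θ s x y p then f x y else 0) =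
      ∑ l, if O.hasEdge θ (rightString z) l then
        (if z = path O.entry θ s (O.slot (rightString z) l) (rightString z) p then
          f (O.slot (rightString z) l) (rightString z) else 0) else 0 := by
  rw [sum_comm, sum_eq_single (rightString z)]
  · simp only [ite_and, edge_comm hO.symm (y := rightString z)]
    exact hO.sum_edge hθ _ fun y =>
      if z = path O.entry θ s y (rightString z) p then f y (rightString z) else 0
  · intro y _ hy
    refine sum_eq_zero fun x _ => if_neg ?_
    rintro ⟨-, h⟩
    exact hy (by rw [h, rightString_path hp hp'])
  · exact fun h => absurd (mem_univ _) h

open Classical in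
theorem Oracle.Regular.codeEnergy_eq (hO : O.Regular) (hθ : 0 ≤ θ) (a b : ℝ) (x : Bits n) :
    codeEnergy O.entry θ a b x = O.entry x x + ∑ l, if O.hasEdge θ x l then
      -2⁻¹ * O.entry x (O.slot x l) *
        (2 + (4 * n + 6) * (b + slope n a b (O.entry x (O.slot x l)))) else 0 := by
  unfold codeEnergy
  rw [hO.sum_edge hθ x fun y =>
    -O.entry x y / 2 * (2 + (4 * n + 6) * (b + slope n a b (O.entry x y)))]
  congr 1
  refine sum_congr rfl fun l _ => ?_
  split
  · ring
  · rfl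

open Classical in
-- The places are divided where both halves are legible, so every term involves only edges at one of
-- the two strings read off z. Symmetry of the entries lets the table of the end serve for paths
-- identified by their end.
theorem Oracle.Regular.energy_eq (hO : O.Regular) (hθ : 0 ≤ θ) (a b Δ : ℝ)
    (z : Bits (6 * n + 4 * s)) :
    energy s O.entry θ a b Δ z = (Δ + (if z = encString s (leftString z) then
        codeEnergy O.entry θ a b (leftString z) - Δ else 0)) +
      ((∑ p ∈ Icc 1 (2 * n + 6), ∑ l, if O.hasEdge θ (leftString z) l then
        (if z = path O.entry θ s (leftString z) (O.slot (leftString z) l) p then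
          siteEnergy n a b (O.entry (leftString z) (O.slot (leftString z) l)) p - Δ else 0)
        else 0) +
      ∑ p ∈ Icc (2 * n + 7) (4 * n + 7), ∑ l, if O.hasEdge θ (rightString z) l then
        (if z = path O.entry θ s (O.slot (rightString z) l) (rightString z) p then
          siteEnergy n a b (O.entry (rightString z) (O.slot (rightString z) l)) p - Δ else 0)
        else 0) := by
  have h1 : (∑ x, if z = encString s x then codeEnergy O.entry θ a b x - Δ else 0) =
      if z = encString s (leftString z) then codeEnergy O.entry θ a b (leftString z) - Δ
        else 0 := by
    refine sum_eq_single _ (fun x _ hx => if_neg ?_) fun h => absurd (mem_univ _) h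
    intro h
    exact hx (by rw [h, leftString_encString])
  have h2 : (Icc 1 (4 * n + 7)) = Icc 1 (2 * n + 6) ∪ Icc (2 * n + 7) (4 * n + 7) := by
    ext p
    simp only [mem_union, mem_Icc]
    omega
  have h3 : Disjoint (Icc 1 (2 * n + 6)) (Icc (2 * n + 7) (4 * n + 7)) := by
    rw [disjoint_left]
    intro p
    simp only [mem_Icc]
    omega
  unfold energy
  rw [h1]
  congr 1
  unfold pathSum
  have h4 : ∀ (F : Bits n → Bits n → ℕ → ℝ) (t : Finset ℕ),
      (∑ x, ∑ y, ∑ p ∈ t, F x y p) = ∑ p ∈ t, ∑ x, ∑ y, F x y p := by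
    intro F t
    rw [sum_comm (s := t)]
    exact sum_congr rfl fun x _ => sum_comm
  rw [h4, h2, sum_union h3]
  congr 1
  · refine sum_congr rfl fun p hp => ?_
    rw [mem_Icc] at hp
    exact hO.sum_path_left hθ z hp.2 fun x y => siteEnergy n a b (O.entry x y) p - Δ
  · refine sum_congr rfl fun p hp => ?_
    rw [mem_Icc] at hp
    rw [hO.sum_path_right hθ z (by omega) (by omega) fun x y =>
      siteEnergy n a b (O.entry x y) p - Δ]
    simp only [hO.symm (O.slot _ _)]

end EnergyFormula

/-! ### The circuit for the energies -/

section EnergyCircuit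

variable {n s : ℕ} {β ρ : Type} [DecidableEq β] [DecidableEq ρ] {Ω : Type*}
  {O : Ω → Oracle n s} {c : Ω → Config β ρ} {S : Set (Fn Ω)} {θ : ℝ}

theorem bitFrom_base {x : Ω → Bits n} (hx : HasBits S x) (q : Site n s) :
    BitFrom O c S 1 fun ω => base (x ω) q := by
  cases q
  case data h k b => exact (bitFrom_mem (hx b)).mono subset_rfl zero_le_one
  all_goals exact bitFrom_const false

theorem bitFrom_state {x y : Ω → Bits n} {i j : Ω → ℕ} (hx : HasBits S x) (hy : HasBits S y)
    (hi : Sum.inr (fun ω => (i ω : ℝ)) ∈ S) (hj : Sum.inr (fun ω => (j ω : ℝ)) ∈ S) (p : ℕ)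
    (q : Site n s) : BitFrom O c S 18 fun ω => state (x ω) (y ω) (i ω) (j ω) p q := by
  have h1 : BitFrom O c S 13 fun ω => mask (x ω) (y ω) (i ω) (j ω) q := by
    cases q
    case data h k b =>
      exact ((bitFrom_mem (hx b)).xor (bitFrom_mem (hy b))).mono subset_rfl (by omega)
    case out h r => exact BitFrom.eq_nat r (realFrom_mem hi)
    case inn h r => exact BitFrom.eq_nat r (realFrom_mem hj)
    case tally h b =>
      exact ((bitFrom_mem (hx b)).xor (bitFrom_mem (hy b))).not.mono subset_rfl (by omega)
  exact ((bitFrom_base hx q).xor (h1.and (bitFrom_const _))).mono subset_rfl (by omega)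

open Classical in
theorem bitFrom_eq_encString {z : Ω → Bits (6 * n + 4 * s)} {x : Ω → Bits n} (hz : HasBits S z)
    (hx : HasBits S x) : BitFrom O c S ((6 * n + 4 * s) * 10 + 4)
      fun ω => decide (z ω = encString s (x ω)) := by
  refine BitFrom.congr ((BitFrom.all fun q : Site n s =>
    (bitFrom_mem (hz (Site.equiv q))).beq (bitFrom_base hx q)).mono subset_rfl ?_) fun ω => ?_
  · rw [card_site]
  · rw [Bool.eq_iff_iff]
    simp [eq_encString_iff]

open Classical in
theorem bitFrom_eq_path {z : Ω → Bits (6 * n + 4 * s)} {x y : Ω → Bits n} (hz : HasBits S z)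
    (hx : HasBits S x) (hy : HasBits S y)
    (hi : Sum.inr (fun ω => (rank (O ω).entry θ (x ω) (y ω) : ℝ)) ∈ S)
    (hj : Sum.inr (fun ω => (rank (O ω).entry θ (y ω) (x ω) : ℝ)) ∈ S) (p : ℕ) :
    BitFrom O c S ((6 * n + 4 * s) * 27 + 4)
      fun ω => decide (z ω = path (O ω).entry θ s (x ω) (y ω) p) := by
  refine BitFrom.congr ((BitFrom.all fun q : Site n s =>
    (bitFrom_mem (hz (Site.equiv q))).beq (bitFrom_state hx hy hi hj p q)).mono subset_rfl ?_)
    fun ω => ?_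
  · rw [card_site]
  · rw [Bool.eq_iff_iff]
    simp [eq_path_iff]

/-- The inverse gate adds nothing at zero, in accordance with 0⁻¹ = 0, so the formula also holds in
slots whose entry vanishes. -/
theorem realFrom_slope {g : Ω → ℝ} (hg : Sum.inr g ∈ S) (a b : ℝ) :
    RealFrom O c S 8 fun ω => slope n a b (g ω) := by
  refine (((((realFrom_mem hg).inv.const_mul (-(2 * a))).sub_const b).const_mul
    (1 + (4 * n + 6) * b)⁻¹)).congr fun ω => ?_
  rw [slope, mul_comm]

theorem realFrom_siteEnergy {g : Ω → ℝ} (hg : Sum.inr g ∈ S) (a b : ℝ) (p : ℕ) :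
    RealFrom O c S 13 fun ω => siteEnergy n a b (g ω) p := by
  unfold siteEnergy
  split
  · exact (realFrom_const _).mono subset_rfl (by omega)
  split
  · exact ((realFrom_slope hg a b).const_add 1).const_mul a
  · exact (realFrom_const _).mono subset_rfl (by omega)

theorem realFrom_codeEnergy (hO : ∀ ω, (O ω).Regular) (hθ : 0 ≤ θ) {x : Ω → Bits n}
    (hx : table O θ x ⊆ S) (hd : Sum.inr (fun ω => (O ω).entry (x ω) (x ω)) ∈ S) (a b : ℝ) :
    RealFrom O c S (s * 23 + 3) fun ω => codeEnergy (O ω).entry θ a b (x ω) := by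
  have h1 : ∀ l : Fin s, RealFrom O c S 21 fun ω => if (O ω).hasEdge θ (x ω) l then
      -2⁻¹ * (O ω).entry (x ω) ((O ω).slot (x ω) l) *
        (2 + (4 * n + 6) * (b + slope n a b ((O ω).entry (x ω) ((O ω).slot (x ω) l)))) else 0 :=
    fun l => (RealFrom.ite (bitFrom_mem (hasEdge_mem hx l))
      (((realFrom_mem (entry_mem hx l)).const_mul (-2⁻¹)).mul
        ((((realFrom_slope (entry_mem hx l) a b).const_add b).const_mul
          (4 * n + 6)).const_add 2)))
  refine (((realFrom_mem hd).add (RealFrom.sum h1)).mono subset_rfl ?_).congr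
    fun ω => ((hO ω).codeEnergy_eq hθ a b (x ω)).symm
  rw [Fintype.card_fin]
  omega

/-- The number of gates for the terms of one place of the paths. -/
def placeCost (n s : ℕ) : ℕ := s * ((6 * n + 4 * s) * 27 + 26) + 1

open Classical in
theorem realFrom_energy (hO : ∀ ω, (O ω).Regular) (hθ : 0 ≤ θ) {z : Ω → Bits (6 * n + 4 * s)}
    (hz : HasBits S z) (hl : fullTable O θ (fun ω => leftString (z ω)) ⊆ S)
    (hr : fullTable O θ (fun ω => rightString (z ω)) ⊆ S)
    (hd : Sum.inr (fun ω => (O ω).entry (leftString (z ω)) (leftString (z ω))) ∈ S)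
    (a b Δ : ℝ) :
    RealFrom O c S ((6 * n + 4 * s) * 10 + s * 23 + 21 + (4 * n + 7) * (placeCost n s + 2))
      fun ω => energy s (O ω).entry θ a b Δ (z ω) := by
  have hlz : HasBits S fun ω => leftString (z ω) := fun b => hz _
  have hrz : HasBits S fun ω => rightString (z ω) := fun b => hz _
  have hlt := (table_subset_fullTable _).trans hl
  have hrt := (table_subset_fullTable _).trans hr
  have h1 : RealFrom O c S ((6 * n + 4 * s) * 10 + s * 23 + 12)
      fun ω => if z ω = encString s (leftString (z ω)) then
        codeEnergy (O ω).entry θ a b (leftString (z ω)) - Δ else 0 :=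
    ((RealFrom.ite (bitFrom_eq_encString hz hlz)
      ((realFrom_codeEnergy hO hθ hlt hd a b).sub_const Δ)).mono subset_rfl (by omega)).congr
        fun ω => by simp only [decide_eq_true_eq]
  have h2 : ∀ p ∈ Icc 1 (2 * n + 6), RealFrom O c S (placeCost n s)
      fun ω => ∑ l, if (O ω).hasEdge θ (leftString (z ω)) l then
        (if z ω = path (O ω).entry θ s (leftString (z ω)) ((O ω).slot (leftString (z ω)) l) p then
          siteEnergy n a b ((O ω).entry (leftString (z ω)) ((O ω).slot (leftString (z ω)) l)) p - Δ
        else 0) else 0 := fun p _ => by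
    refine ((RealFrom.sum fun l : Fin s => RealFrom.ite (bitFrom_mem (hasEdge_mem hlt l))
      (RealFrom.ite (bitFrom_eq_path hz hlz (hasBits_slot hlt l) (rank_mem hl l) (rank_mem' hl l) p)
        ((realFrom_siteEnergy (n := n) (entry_mem hlt l) a b p).sub_const Δ))).mono subset_rfl
          ?_).congr fun ω => by simp only [decide_eq_true_eq]
    rw [Fintype.card_fin, placeCost]
    refine Nat.add_le_add_right (Nat.mul_le_mul_left _ ?_) 1
    omega
  have h3 : ∀ p ∈ Icc (2 * n + 7) (4 * n + 7), RealFrom O c S (placeCost n s)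
      fun ω => ∑ l, if (O ω).hasEdge θ (rightString (z ω)) l then
        (if z ω = path (O ω).entry θ s ((O ω).slot (rightString (z ω)) l) (rightString (z ω)) p then
          siteEnergy n a b ((O ω).entry (rightString (z ω)) ((O ω).slot (rightString (z ω)) l)) p - Δ
        else 0) else 0 := fun p _ => by
    refine ((RealFrom.sum fun l : Fin s => RealFrom.ite (bitFrom_mem (hasEdge_mem hrt l))
      (RealFrom.ite (bitFrom_eq_path hz (hasBits_slot hrt l) hrz (rank_mem' hr l) (rank_mem hr l) p)
        ((realFrom_siteEnergy (n := n) (entry_mem hrt l) a b p).sub_const Δ))).mono subset_rfl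
          ?_).congr fun ω => by simp only [decide_eq_true_eq]
    rw [Fintype.card_fin, placeCost]
    refine Nat.add_le_add_right (Nat.mul_le_mul_left _ ?_) 1
    omega
  refine (((h1.const_add Δ).add ((RealFrom.finsetSum _ h2).add
    (RealFrom.finsetSum _ h3))).mono subset_rfl ?_).congr
      fun ω => ((hO ω).energy_eq hθ a b Δ (z ω)).symm
  rw [Nat.card_Icc, Nat.card_Icc, show 4 * n + 7 + 1 - (2 * n + 7) = 2 * n + 1 by omega,
    show 2 * n + 6 + 1 - 1 = 2 * n + 6 by omega]
  exact le_of_eq (by ring)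

open Classical in
theorem realFrom_cube {m : ℕ} {z z' : Ω → Bits m} (hz : HasBits S z) (hz' : HasBits S z') :
    RealFrom O c S (m * (m * 11 + 7) + 1) fun ω => cube (z ω) (z' ω) := by
  have h1 : ∀ i k : Fin m, BitFrom O c S 6
      fun ω => decide (z' ω k = Function.update (z ω) i (!(z ω i)) k) := by
    intro i k
    by_cases hk : k = i
    · subst hk
      refine ((bitFrom_mem (hz' k)).beq (bitFrom_mem (hz k)).not).congr fun ω => ?_
      simp
    · refine (((bitFrom_mem (hz' k)).beq (bitFrom_mem (hz k))).mono subset_rfl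
        (by omega)).congr fun ω => ?_
      rw [Function.update_of_ne hk]
  refine ((RealFrom.sum fun i => (BitFrom.all (h1 i)).toReal).mono subset_rfl ?_).congr
    fun ω => ?_
  · rw [Fintype.card_fin]
  · unfold cube
    simp only [decide_eq_true_eq, funext_iff]

open Classical in
theorem realFrom_tfdEntry {m l : ℕ} {z z' : Ω → Bits m} (hz : HasBits S z) (hz' : HasBits S z')
    {D : Ω → Bits m → ℝ} (hD : RealFrom O c S l fun ω => D ω (z ω)) (a : ℝ) :
    RealFrom O c S (m * (m * 11 + 7) + 3 + (m * 9 + 4 + l + 2) + 2)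
      fun ω => tfdEntry a (D ω) (z ω) (z' ω) := by
  have h1 : RealFrom O c S (m * 9 + 4 + l + 2) fun ω => if z ω = z' ω then D ω (z ω) else 0 := by
    refine ((RealFrom.ite (BitFrom.all fun k =>
      (bitFrom_mem (hz k)).beq (bitFrom_mem (hz' k))) hD).mono subset_rfl ?_).congr fun ω => ?_
    · rw [Fintype.card_fin]
    · simp only [decide_eq_true_eq, funext_iff]
  refine ((((realFrom_cube hz hz').const_mul (-a)).add h1).mono subset_rfl (by omega)).congr
    fun ω => ?_
  rw [tfdEntry]

/-- The number of gates for a matrix element of the simulator. -/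
def entryCost (n s : ℕ) : ℕ :=
  2 * ((1 + s) * (1 + s * (9 * n + 13)) + s * (2 * (s * (10 * n + 10) + 1))) + 1 +
    ((6 * n + 4 * s) * ((6 * n + 4 * s) * 11 + 7) + 3 + ((6 * n + 4 * s) * 9 + 4 +
      ((6 * n + 4 * s) * 10 + s * 23 + 21 + (4 * n + 7) * (placeCost n s + 2)) + 2) + 2)

/-- Two full tables, for the strings in the two halves of the row index, and one query for the
diagonal entry that `codeEnergy` contains. -/
theorem derives_entry_tfd (hO : ∀ ω, (O ω).Regular) (hθ : 0 ≤ θ)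
    {z z' : Ω → Bits (6 * n + 4 * s)} (hz : HasBits S z) (hz' : HasBits S z') (a b Δ : ℝ) :
    Derives O c S (2 * (1 + s) ^ 2 + 1) (entryCost n s) {Sum.inr fun ω =>
      tfdEntry a (energy s (O ω).entry θ a b Δ) (z ω) (z' ω)} := by
  have hlz : HasBits S fun ω => leftString (z ω) := fun b => hz _
  have hrz : HasBits S fun ω => rightString (z ω) := fun b => hz _
  have h1 := ((derives_fullTable (c := c) hO hθ hlz).union
    (derives_fullTable (c := c) hO hθ hrz)).union (derives_entry (O := O) (c := c) hlz hlz)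
  refine (h1.bind (realFrom_tfdEntry (hz.mono Set.subset_union_left)
    (hz'.mono Set.subset_union_left)
    (realFrom_energy hO hθ (hz.mono Set.subset_union_left) ?_ ?_ ?_ a b Δ) a)).mono subset_rfl
    subset_rfl (le_of_eq (by ring)) (le_of_eq (by rw [entryCost]; ring))
  · exact fun f hf => Or.inr (Or.inl (Or.inl hf))
  · exact fun f hf => Or.inr (Or.inl (Or.inr hf))
  · exact Or.inr (Or.inr rfl)

end EnergyCircuit

end StoqTFD
end

noncomputable section
namespace StoqTFD

/-! ### The circuit for the matrix elements -/

section EntryCircuit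

variable {n s : ℕ} {β ρ : Type} [DecidableEq β] [DecidableEq ρ] {Ω : Type*}
  {O : Ω → Oracle n s} {c : Ω → Config β ρ}

/-- The bits of the input. -/
def inputs (c : Ω → Config β ρ) : Set (Fn Ω) := Set.range fun w => Sum.inl fun ω => (c ω).bit w

theorem realizes_inputs : Realizes O c [] (inputs c) := by
  refine ⟨0, 0, by simp, fun ω k _ => rfl, fun ω k _ => rfl, ?_, ?_⟩
  · rintro f ⟨w, hw⟩
    obtain rfl := Sum.inl_injective hw
    exact ⟨Sum.inl w, by simp, fun ω => rfl⟩
  · rintro f ⟨w, hw⟩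
    simp at hw

/-- A derivable real function can be added to a wire, with all ancillas returned to zero. -/
theorem Derives.exists_circuit {q l : ℕ} {F : Ω → ℝ} (h : Derives O c (inputs c) q l {Sum.inr F})
    (t : ρ) : ∃ P : Circuit n s (β ⊕ ℕ) (ρ ⊕ ℕ), Circuit.queries P ≤ 2 * q ∧
      P.length ≤ 2 * l + 1 ∧ ∀ ω, Circuit.run (O ω) P (c ω).withAncillas =
        ((c ω).addReal false t (F ω)).withAncillas := by
  obtain ⟨Q, hq, hl, nb, nr, hQ⟩ := h [] (inputs c) subset_rfl realizes_inputs
  rw [List.nil_append] at hQ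
  obtain ⟨w, -, hw⟩ := hQ.real F (Or.inr rfl)
  -- Compute, add the result to t, undo the computation.
  refine ⟨Q ++ .add false (Sum.inr w) (Sum.inl t) (by simp) :: Circuit.reversed Q, ?_, ?_,
    fun ω => ?_⟩
  · have h1 : ∀ g : Gate n s (β ⊕ ℕ) (ρ ⊕ ℕ), g.isQuery = false →
        Circuit.queries (g :: Circuit.reversed Q) = Circuit.queries Q := by
      intro g hg
      rw [Circuit.queries, List.countP_cons_of_neg (by simp [hg])]
      exact Circuit.queries_reversed Q
    rw [Circuit.queries_append, h1 _ rfl]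
    omega
  · rw [List.length_append, List.length_cons, Circuit.length_reversed]
    omega
  · rw [Circuit.run_append, Circuit.run_cons]
    have h1 : Circuit.run (O ω) Q (c ω).withAncillas = after O c Q ω := rfl
    have h2 : ∀ g ∈ Circuit.reversed Q, g.Avoids (Sum.inl t) := by
      intro g hg
      rw [Circuit.reversed, List.mem_reverse, List.mem_map] at hg
      obtain ⟨g', hg', rfl⟩ := hg
      exact (hQ.avoids g' hg' t).inverse
    simp only [Gate.step]
    rw [h1, hw, Circuit.run_addReal h2, ← h1, Circuit.run_reversed]
    simp only [Config.addReal, Config.withAncillas, Config.mk.injEq, true_and]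
    funext w
    rcases w with w | w
    · by_cases hw : w = t
      · subst hw
        simp
      · simp [hw]
    · simp

end EntryCircuit

theorem Oracle.IsFor.entry_eq {n s : ℕ} {O : Oracle n s} {H : Op n} (h : O.IsFor H) :
    O.entry = fun x y => (H x y).re := by
  funext x y
  rw [h.2 x y, Complex.ofReal_re]

theorem Oracle.IsFor.regular {n s : ℕ} {O : Oracle n s} {H : Op n} (h : O.IsFor H)
    (hH : IsStoquastic H) : O.Regular := by
  have h1 := h.2
  obtain ⟨⟨G, -, hG, hadj, hinj⟩, -⟩ := h
  refine ⟨fun x y => ?_, fun x y hxy => ?_, hinj⟩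
  · have h2 := hH.1.apply x y
    rw [h1, h1] at h2
    simpa using h2.symm
  · refine (hadj x y).mp (hG x y ?_)
    rw [h1]
    exact_mod_cast hxy

theorem exists_entry_circuit (n s : ℕ) {θ : ℝ} (hθ : 0 ≤ θ) (a b Δ : ℝ) :
    ∃ P : Circuit n s (EntryReg (6 * n + 4 * s) ⊕ ℕ) (Unit ⊕ ℕ),
      Circuit.queries P ≤ 2 * (2 * (1 + s) ^ 2 + 1) ∧ P.length ≤ 2 * entryCost n s + 1 ∧
      ∀ OH : Oracle n s, OH.Regular → ∀ OK : Oracle (6 * n + 4 * s) (6 * n + 4 * s + 1),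
        (OK.entry = fun z z' => tfdEntry a (energy s OH.entry θ a b Δ) z z') →
        P.Implements OH (entryGate (6 * n + 4 * s) (6 * n + 4 * s + 1)) OK := by
  -- The oracle is part of the input, so one circuit serves all oracles and all Hamiltonians.
  let Ω : Type := {O : Oracle n s // O.Regular} × Config (EntryReg (6 * n + 4 * s)) Unit
  have h1 := derives_entry_tfd (O := fun ω : Ω => ω.1.1) (c := fun ω : Ω => ω.2)
    (S := inputs fun ω : Ω => ω.2) (fun ω => ω.1.2) hθ
    (z := fun ω k => ω.2.bit (Sum.inl k)) (z' := fun ω k => ω.2.bit (Sum.inr k))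
    (fun k => ⟨Sum.inl k, rfl⟩) (fun k => ⟨Sum.inr k, rfl⟩) a b Δ
  obtain ⟨P, hq, hl, hP⟩ := h1.exists_circuit ()
  refine ⟨P, hq, hl, fun OH hOH OK hOK d => ?_⟩
  have h2 := hP (⟨OH, hOH⟩, d)
  simp only [entryGate, Gate.step, hOK]
  exact h2

/-! ### The circuit for the adjacency lists -/

section AdjCircuit

variable {n s N : ℕ}

/-- The adjacency lists of the cube, with a loop at every string. -/
def cubeOracle (e : Bits N → Bits N → ℝ) : Oracle N (N + 1) where
  adj x l := some fun j => xor (x j) (decide ((l : ℕ) = j))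
  entry := e

theorem cubeOracle_last (e : Bits N → Bits N → ℝ) (x : Bits N) :
    (cubeOracle e).adj x (Fin.last N) = some x := by
  simp only [cubeOracle, Option.some.injEq]
  funext j
  have := j.2
  simp [Fin.val_last, this.ne']

theorem cubeOracle_castSucc (e : Bits N → Bits N → ℝ) (x : Bits N) (i : Fin N) :
    (cubeOracle e).adj x i.castSucc = some (Function.update x i (!(x i))) := by
  simp only [cubeOracle, Option.some.injEq]
  funext j
  by_cases hj : j = i
  · subst hj
    simp
  · have : (i : ℕ) ≠ j := fun h => hj (Fin.ext h.symm)
    simp [hj, this]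

theorem isFor_cubeOracle (a : ℝ) (D : Bits N → ℝ) :
    (cubeOracle (tfdEntry a D)).IsFor (tfd a D) := by
  refine ⟨⟨fun x y => ∃ l, (cubeOracle (tfdEntry a D)).adj x l = some y, ?_, ?_,
    fun _ _ => Iff.rfl, ?_⟩, tfd_apply a D⟩
  · rintro x y ⟨l, hl⟩
    refine ⟨l, ?_⟩
    simp only [cubeOracle, Option.some.injEq] at hl ⊢
    subst hl
    funext j
    simp
  · intro x y hxy
    rw [tfd_apply, Complex.ofReal_ne_zero] at hxy
    by_cases h : x = y
    · subst h
      exact ⟨_, cubeOracle_last _ x⟩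
    · by_contra! hne
      refine hxy ?_
      rw [tfdEntry, if_neg h, cube, Finset.sum_eq_zero, mul_zero, add_zero]
      intro i _
      refine if_neg fun hi => hne i.castSucc ?_
      rw [cubeOracle_castSucc, hi]
  · intro x l l' y hl hl'
    rw [← hl'] at hl
    simp only [cubeOracle, Option.some.injEq] at hl
    have h1 : ∀ j : Fin N, (l : ℕ) = j ↔ (l' : ℕ) = j := by
      intro j
      have := congrFun hl j
      simpa using this
    apply Fin.ext
    rcases Nat.lt_succ_iff_lt_or_eq.mp l.2 with h | h
    · exact ((h1 ⟨l, h⟩).mp rfl).symm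
    · rcases Nat.lt_succ_iff_lt_or_eq.mp l'.2 with h' | h'
      · exact (h1 ⟨l', h'⟩).mpr rfl
      · rw [h, h']

/-- The gates which write one bit of an adjacency list of the cube. -/
def cubeAdjGates : Fin (N + 1) × Option (Fin N) →
    Circuit n s (AdjReg N (N + 1) ⊕ ℕ) (Empty ⊕ ℕ)
  | (l, none) => [.not (Sum.inl (Sum.inr (l, none)))]
  | (l, some j) =>
    .toffoli (Sum.inl (Sum.inl j)) (Sum.inl (Sum.inl j)) (Sum.inl (Sum.inr (l, some j)))
      (by simp) (by simp) ::
        if (l : ℕ) = j then [.not (Sum.inl (Sum.inr (l, some j)))] else []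

theorem run_cubeAdjGates (O : Oracle n s) (e : Bits N → Bits N → ℝ)
    (p : Fin (N + 1) × Option (Fin N)) (c : Config (AdjReg N (N + 1) ⊕ ℕ) (Empty ⊕ ℕ)) :
    Circuit.run O (cubeAdjGates p) c = c.xorBit (Sum.inl (Sum.inr p))
      ((cubeOracle e).adjBits (fun j => c.bit (Sum.inl (Sum.inl j))) p) := by
  obtain ⟨l, _ | j⟩ := p
  · simp [cubeAdjGates, Circuit.run, Gate.step, Oracle.adjBits, cubeOracle]
  · by_cases h : (l : ℕ) = j <;>
      simp [cubeAdjGates, Circuit.run, Gate.step, Oracle.adjBits, cubeOracle, h,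
        Config.xorBit_xorBit]

theorem run_flatMap_cubeAdjGates (O : Oracle n s) (e : Bits N → Bits N → ℝ)
    (L : List (Fin (N + 1) × Option (Fin N))) (hL : L.Nodup)
    (c : Config (AdjReg N (N + 1) ⊕ ℕ) (Empty ⊕ ℕ)) :
    (Circuit.run O (L.flatMap cubeAdjGates) c).real = c.real ∧
    (∀ j, (Circuit.run O (L.flatMap cubeAdjGates) c).bit (Sum.inl (Sum.inl j)) =
      c.bit (Sum.inl (Sum.inl j))) ∧
    (∀ k, (Circuit.run O (L.flatMap cubeAdjGates) c).bit (Sum.inr k) = c.bit (Sum.inr k)) ∧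
    ∀ p, (Circuit.run O (L.flatMap cubeAdjGates) c).bit (Sum.inl (Sum.inr p)) =
      xor (c.bit (Sum.inl (Sum.inr p))) (decide (p ∈ L) &&
        (cubeOracle e).adjBits (fun j => c.bit (Sum.inl (Sum.inl j))) p) := by
  induction L generalizing c with
  | nil => exact ⟨rfl, fun _ => rfl, fun _ => rfl, fun p => by simp [Circuit.run]⟩
  | cons p L ih =>
    rw [List.nodup_cons] at hL
    rw [List.flatMap_cons, Circuit.run_append, run_cubeAdjGates O e]
    set d := c.xorBit (Sum.inl (Sum.inr p))
      ((cubeOracle e).adjBits (fun j => c.bit (Sum.inl (Sum.inl j))) p) with hd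
    obtain ⟨h1, h2, h3, h4⟩ := ih hL.2 d
    have hq : ∀ j, d.bit (Sum.inl (Sum.inl j)) = c.bit (Sum.inl (Sum.inl j)) := by
      intro j
      simp [hd, Config.xorBit]
    refine ⟨h1, fun j => (h2 j).trans (hq j), fun k => (h3 k).trans ?_, fun p' => ?_⟩
    · simp [hd, Config.xorBit]
    · rw [h4]
      simp only [hq]
      by_cases hp : p' = p
      · subst hp
        simp [hd, Config.xorBit, hL.1]
      · simp [hd, Config.xorBit, hp]

/-- The cube with loops contains the interaction graph of every transverse field diagonal
Hamiltonian, so its lists are written without knowledge of H. -/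
theorem exists_adj_circuit (n s N : ℕ) :
    ∃ P : Circuit n s (AdjReg N (N + 1) ⊕ ℕ) (Empty ⊕ ℕ),
      Circuit.queries P = 0 ∧ P.length ≤ (N + 1) * (N + 1) * 2 ∧
      ∀ (O : Oracle n s) (e : Bits N → Bits N → ℝ),
        P.Implements O (adjGate N (N + 1)) (cubeOracle e) := by
  refine ⟨(Finset.univ : Finset (Fin (N + 1) × Option (Fin N))).toList.flatMap cubeAdjGates,
    ?_, ?_, fun O e c => ?_⟩
  · rw [Circuit.queries, List.countP_eq_zero]
    intro g hg
    obtain ⟨⟨l, _ | j⟩, -, hg⟩ := List.mem_flatMap.mp hg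
    · obtain rfl := List.mem_singleton.mp hg
      simp [Gate.isQuery]
    · rcases List.mem_cons.mp hg with rfl | hg
      · simp [Gate.isQuery]
      · split at hg
        · obtain rfl := List.mem_singleton.mp hg
          simp [Gate.isQuery]
        · simp at hg
  · rw [List.length_flatMap]
    refine (List.sum_le_card_nsmul _ 2 ?_).trans ?_
    · intro k hk
      obtain ⟨⟨l, _ | j⟩, -, rfl⟩ := List.mem_map.mp hk
      · simp [cubeAdjGates]
      · simp only [cubeAdjGates, List.length_cons]
        split <;> simp
    · simp
  · obtain ⟨h1, h2, h3, h4⟩ := run_flatMap_cubeAdjGates O e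
      (Finset.univ : Finset (Fin (N + 1) × Option (Fin N))).toList (Finset.nodup_toList _)
      c.withAncillas
    have hinj : Function.Injective
        (Sum.inr : Fin (N + 1) × Option (Fin N) → AdjReg N (N + 1)) := Sum.inr_injective
    have h5 : ∀ {d d' : Config (AdjReg N (N + 1) ⊕ ℕ) (Empty ⊕ ℕ)}, d.bit = d'.bit →
        d.real = d'.real → d = d' := by
      rintro ⟨_, _⟩ ⟨_, _⟩ rfl rfl
      rfl
    refine h5 ?_ (h1.trans rfl)
    funext w
    rcases w with (j | p) | k
    · rw [h2]
      simp only [adjGate, Gate.step, Config.withAncillas, Sum.elim_inl]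
      rw [Function.extend_apply' _ _ _ (by simp)]
      simp
    · rw [h4]
      have h6 := hinj.extend_apply ((cubeOracle e).adjBits fun j => c.bit (Sum.inl j))
        (fun _ => false) p
      simp only [adjGate, Gate.step, Config.withAncillas, Sum.elim_inl,
        Function.Embedding.coeFn_mk, h6]
      simp
    · rw [h3]
      rfl

end AdjCircuit

/-- The numbers of gates are polynomial. -/
theorem exists_costPolynomial : ∃ q : MvPolynomial (Fin 2) ℝ, ∀ n s : ℕ,
    MvPolynomial.eval ![(n : ℝ), (s : ℝ)] q = ((2 * entryCost n s + 1 +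
      (6 * n + 4 * s + 1) * (6 * n + 4 * s + 1) * 2 : ℕ) : ℝ) := by
  let n : MvPolynomial (Fin 2) ℝ := MvPolynomial.X 0
  let s : MvPolynomial (Fin 2) ℝ := MvPolynomial.X 1
  let r : MvPolynomial (Fin 2) ℝ := s * ((6 * n + 4 * s) * 27 + 26) + 1
  refine ⟨2 * (2 * ((1 + s) * (1 + s * (9 * n + 13)) + s * (2 * (s * (10 * n + 10) + 1))) + 1 +
    ((6 * n + 4 * s) * ((6 * n + 4 * s) * 11 + 7) + 3 + ((6 * n + 4 * s) * 9 + 4 +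
      ((6 * n + 4 * s) * 10 + s * 23 + 21 + (4 * n + 7) * (r + 2)) + 2) + 2)) + 1 +
    (6 * n + 4 * s + 1) * (6 * n + 4 * s + 1) * 2, fun k l => ?_⟩
  simp [n, s, r, entryCost, placeCost]

end StoqTFD
end

/-! ### The proposition -/

theorem propositionB1 :
    ∃ (n₀ s₀ : ℕ) (M₀ η₀ ε₀ C : ℝ) (p : MvPolynomial (Fin 5) ℝ) (q : MvPolynomial (Fin 2) ℝ),
      0 < η₀ ∧ 0 < ε₀ ∧
      ∀ (n s : ℕ) (M η ε : ℝ), n₀ ≤ n → s₀ ≤ s → M₀ ≤ M → 0 < η → η ≤ η₀ → 0 < ε → ε ≤ ε₀ →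
        ∃ (a : ℝ) (D : StoqTFD.Op n → StoqTFD.Bits (6 * n + 4 * s) → ℝ)
          (PAdj : StoqTFD.Circuit n s
            (StoqTFD.AdjReg (6 * n + 4 * s) (6 * n + 4 * s + 1) ⊕ ℕ) (Empty ⊕ ℕ))
          (PEntry : StoqTFD.Circuit n s
            (StoqTFD.EntryReg (6 * n + 4 * s) ⊕ ℕ) (Unit ⊕ ℕ)),
          0 < a ∧
          ((PAdj.queries : ℝ) ≤ C * ((n : ℝ) * s + (s : ℝ) ^ 2) ∧
            (PEntry.queries : ℝ) ≤ C * ((n : ℝ) * s + (s : ℝ) ^ 2) ∧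
            (PAdj.length : ℝ) ≤ MvPolynomial.eval ![(n : ℝ), (s : ℝ)] q ∧
            (PEntry.length : ℝ) ≤ MvPolynomial.eval ![(n : ℝ), (s : ℝ)] q) ∧
          ∀ H : StoqTFD.Op n, StoqTFD.IsStoquastic H → StoqTFD.IsSparse s H →
            StoqTFD.opNorm H ≤ M →
            StoqTFD.IsStoquastic (StoqTFD.tfd a (D H)) ∧
            StoqTFD.Simulates (StoqTFD.tfd a (D H)) (StoqTFD.encoding n s) H η ε ∧
            StoqTFD.opNorm (StoqTFD.tfd a (D H)) ≤
              MvPolynomial.eval ![1 / η, 1 / ε, (n : ℝ), (s : ℝ), M] p ∧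
            ∃ OK : StoqTFD.Oracle (6 * n + 4 * s) (6 * n + 4 * s + 1),
              OK.IsFor (StoqTFD.tfd a (D H)) ∧
              ∀ OH : StoqTFD.Oracle n s, OH.IsFor H →
                PAdj.Implements OH (StoqTFD.adjGate (6 * n + 4 * s) (6 * n + 4 * s + 1)) OK ∧
                PEntry.Implements OH (StoqTFD.entryGate (6 * n + 4 * s) (6 * n + 4 * s + 1)) OK := by
  -- The variables stand for 1/η, 1/ε, n, s and M, and r, b, f, m and d for the accuracy, the
  -- damping, the field, the number of qubits and the penalty.
  let r : MvPolynomial (Fin 5) ℝ := 30 * (MvPolynomial.X 0 + MvPolynomial.X 4 * MvPolynomial.X 1)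
  let b : MvPolynomial (Fin 5) ℝ := 11 * MvPolynomial.X 3 * (4 * MvPolynomial.X 2 + 7) * r
  let f : MvPolynomial (Fin 5) ℝ := MvPolynomial.X 4 * (4 * MvPolynomial.X 2 + 7) * b ^ 2
  let m : MvPolynomial (Fin 5) ℝ := 6 * MvPolynomial.X 2 + 4 * MvPolynomial.X 3
  let d : MvPolynomial (Fin 5) ℝ := 16 * f ^ 2 * m ^ 2 * MvPolynomial.X 1 + f +
    2 * f * m ^ 2 * (4 * MvPolynomial.X 2 + 7) ^ 2
  let p : MvPolynomial (Fin 5) ℝ := f * m + (d +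
    (MvPolynomial.X 4 + MvPolynomial.X 3 *
      (MvPolynomial.X 4 * (1 + (4 * MvPolynomial.X 2 + 7) * b) + f)) +
    f * (1 + b) + 2 * f + f * (1 + 2 * f * (8 * MvPolynomial.X 3 * MvPolynomial.X 1)))
  obtain ⟨q, hq⟩ : ∃ q : MvPolynomial (Fin 2) ℝ, ∀ n s : ℕ,
      MvPolynomial.eval ![(n : ℝ), (s : ℝ)] q = ((2 * StoqTFD.entryCost n s + 1 +
        (6 * n + 4 * s + 1) * (6 * n + 4 * s + 1) * 2 : ℕ) : ℝ) :=
    StoqTFD.exists_costPolynomial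
  -- The constant 18 comes from 4(1 + s)² + 2 ≤ 18s² for s ≥ 1.
  refine ⟨0, 1, 1, 1, 1, 18, p, q, one_pos, one_pos, ?_⟩
  intro n s M η ε _ hs hM hη hη1 hε hε1
  have hs0 : (1 : ℝ) ≤ s := by exact_mod_cast hs
  have hθ : 0 ≤ StoqTFD.cutoff s ε := by unfold StoqTFD.cutoff; positivity
  have ha := StoqTFD.field_pos (n := n) hs hM hη hη1 hε
  obtain ⟨PE, hE1, hE2, hE3⟩ := StoqTFD.exists_entry_circuit n s hθ (StoqTFD.field n s M η ε)
    (StoqTFD.damping n s M η ε) (StoqTFD.penalty n s M η ε)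
  obtain ⟨PA, hA1, hA2, hA3⟩ := StoqTFD.exists_adj_circuit n s (6 * n + 4 * s)
  refine ⟨StoqTFD.field n s M η ε, StoqTFD.simulatorEnergy n s M η ε, PA, PE, ha,
    ⟨?_, ?_, ?_, ?_⟩, fun H hH hHs hHM => ⟨StoqTFD.isStoquastic_tfd ha.le _,
      StoqTFD.simulates_of_choice hs hM hη hη1 hε hH hHs hHM hε1, ?_,
      StoqTFD.cubeOracle (StoqTFD.tfdEntry _ _), StoqTFD.isFor_cubeOracle _ _,
      fun OH hOH => ⟨hA3 OH _, hE3 OH (hOH.regular hH) _ ?_⟩⟩⟩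
  · rw [hA1, Nat.cast_zero]
    positivity
  · have h1 : (PE.queries : ℝ) ≤ ((2 * (2 * (1 + s) ^ 2 + 1) : ℕ) : ℝ) := by exact_mod_cast hE1
    refine h1.trans ?_
    push_cast
    have h2 : (0 : ℝ) ≤ n * s := by positivity
    nlinarith
  · rw [hq, Nat.cast_le]
    omega
  · rw [hq, Nat.cast_le]
    omega
  · refine (StoqTFD.opNorm_of_choice hs hM hη hη1 hε hH hHs hHM).trans (le_of_eq ?_)
    simp [p, d, m, f, b, r, StoqTFD.penalty, StoqTFD.field, StoqTFD.damping, StoqTFD.accuracy]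
  · rw [hOH.entry_eq]
    rfl
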